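/- **Setting.** Let $X$ be a separable real Hilbert space and $H\in(0,1)$. Let $L$ be a (generally unbounded) linear operator on $X$ with compact resolvent which generates an analytic $C_0$-semigroup $(e^{tL})_{t\ge 0}$ and whose kernel $\mathcal N$ is finite dimensional. Let $P_c$ be the orthogonal projection onto $\mathcal N$ and $P_s=\mathrm{Id}-P_c$; assume that $P_c$ and $P_s$ commute with $L$ and that there are $M\ge 1$, $\mu>0$ with $\|e^{tL}P_s\|\le Me^{-t\mu}$ for all $t\ge 0$. Let $\alpha\in[0,1)$, and let $X^{-\alpha}$ be the completion of $X$ under $\|x\|_{-\alpha}=\|(\mathrm{Id}-L)^{-\alpha}x\|$; the operators $P_c$ and $e^{tL}$ ($t>0$) are extended by continuity to operators $X^{-\alpha}\to X$. Let $A:X\to X^{-\alpha}$ be bounded and linear, and let $\mathcal F:X^3\to X^{-\alpha}$ be continuous, trilinear and symmetric. Write $\mathcal F(u)=\mathcal F(u,u,u)$, $A_c=P_cA$, $\mathcal F_c=P_c\mathcal F$, and assume that $\langle \mathcal F_c(v),v\rangle<0$ and $\langle\mathcal F_c(v,v,w),w\rangle<0$ for all $v,w\in\mathcal N\setminus\{0\}$,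 and that for some $\eta,C_\eta>0$ $$\langle\mathcal F_c(\phi+v),v\rangle\le C_\eta\|\phi\|^4-\eta\|v\|^4\qquad\text{for all }v,\phi\in\mathcal N .$$ Let $W=W^H$ be a continuous $X$-valued fractional Brownian motion with Hurst index $H$ and trace-class covariance operator on a probability space $(\Omega,\mathbb P)$, and let $W_L(t)=\int_0^te^{(t-\tau)L}\,dW(\tau)$ be the (continuous) stochastic convolution, the stochastic integral being the limit in probability of the Riemann sums $\sum_{i<n}e^{(t-t_i)L}(W(t_{i+1})-W(t_i))$, $t_i=it/n$. For $\varepsilon>0$ and an initial value $u_0:\Omega\to X$ (possibly random and depending on $\varepsilon$), let $u:[0,t^\star)\to X$ be a maximal mild solution of $$du=(Lu+\varepsilon^2Au+\mathcal F(u))\,dt+\varepsilon^{2H+1}\,dW,\qquad u(0)=u_0,$$ that is, $t^\star>0$, $u$ has continuous paths, almost surely $$u(t)=e^{tL}u_0+\int_0^te^{(t-\tau)L}[\varepsilon^2Au(\tau)+\mathcal F(u(\tau))]\,d\tau+\varepsilon^{2H+1}W_L(t)\quad\text{for }t\in(0,t^\star),$$ and either $t^\star=\infty$ or $\|u(t)\|\to\infty$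 as $t\nearrow t^\star$. Given $T_0>0$, let $a$ be a process with paths in $C([0,T_0];\mathcal N)$ that solves the amplitude equation $$a(T)=\varepsilon^{-1}P_cu_0+\int_0^T[A_ca(s)+\mathcal F_c(a(s))]\,ds+\varepsilon^{2H}P_cW(\varepsilon^{-2}T),\qquad T\in[0,T_0],$$ and put $$\psi_s(t)=\varepsilon^{-2H-1}e^{tL}P_su_0+P_sW_L(t),\qquad \psi(t)=\varepsilon a(\varepsilon^2t)+\varepsilon^{2H+1}\psi_s(t).$$ For $\kappa>0$ let $\beta\in(\tfrac12,H)$ be arbitrary if $H>\tfrac12$ and $\beta=H-\kappa$ if $H\le\tfrac12$, and let $$\tilde\Omega_\varepsilon=\Big\{\sup_{t\in[0,T_0\varepsilon^{-2}]}\|P_sW_L(t)\|\le\varepsilon^{-\kappa},\ \|W(\varepsilon^{-2}\cdot)\|_{C^\beta([0,T_0];X)}\le\varepsilon^{-2H-\kappa},\ \|\varepsilon^{-2H-1}P_su_0\|\le\varepsilon^{-\kappa},\ \|\varepsilon^{-1}P_cu_0\|\le\varepsilon^{-\kappa}\Big\}.$$ **Theorem.** For every $H\in(0,1)$ there is $\kappa_0>0$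 such that for every choice of $X,L,\alpha,A,\mathcal F,\Omega,\mathbb P,W$ as above, every $\kappa\in(0,\kappa_0)$, every $T_0>0$ and every $\beta$ as above, there are constants $C>0$ and $\varepsilon_0>0$ such that for all $\varepsilon\in(0,\varepsilon_0]$ and all $u_0$, $u$, $t^\star$, $a$ as above the following holds for $\mathbb P$-almost every $\omega\in\tilde\Omega_\varepsilon$: one has $t^\star>T_0\varepsilon^{-2}$ and $$\sup_{t\in[0,T_0\varepsilon^{-2}]}\|u(t)-\psi(t)\|\le C\,\varepsilon^{3-18\kappa}\qquad\text{if }H>\tfrac12,$$ $$\sup_{t\in[0,T_0\varepsilon^{-2}]}\|u(t)-\psi(t)\|\le C\,\varepsilon^{2H+1+\frac{2H^2}{1-H}-23\kappa}\qquad\text{if }H\le\tfrac12.$$ -/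

import Mathlib

open MeasureTheory ProbabilityTheory Filter Topology
open scoped NNReal ENNReal

universe u v

noncomputable section

namespace AmplitudeSPDE

section Semigroups

variable {X : Type u} [NormedAddCommGroup X] [InnerProductSpace ℝ X]

/-- `S` (restricted to `t ≥ 0`) is a `C₀`-semigroup of bounded linear operators. -/
structure IsC0Semigroup (S : ℝ → X →L[ℝ] X) : Prop where
  zero : S 0 = ContinuousLinearMap.id ℝ X
  comp : ∀ s t : ℝ, 0 ≤ s → 0 ≤ t → S (s + t) = (S s).comp (S t)
  continuous : ∀ x : X, ContinuousOn (fun t : ℝ => S t x) (Set.Ici 0)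

/-- The (in general unbounded) operator `L` is the infinitesimal generator of `S`: `x ∈ D(L)` with
`L x = y` exactly when the difference quotients `(S t x - x) / t` converge to `y` as `t ↘ 0`. -/
def IsGenerator (L : X →ₗ.[ℝ] X) (S : ℝ → X →L[ℝ] X) : Prop :=
  ∀ x y : X, (x, y) ∈ L.graph ↔
    Tendsto (fun t : ℝ => t⁻¹ • (S t x - x)) (𝓝[>] 0) (𝓝 y)

/-- The open complex sector of half-opening `θ` around the positive real axis. -/
def sector (θ : ℝ) : Set ℂ := {z | z ≠ 0 ∧ |z.arg| < θ}

/-- `S` is an analytic semigroup: it extends holomorphically to a complex sector around `(0, ∞)`,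
boundedly near the origin. As `X` is real, the extension takes values in the bounded
operators on the complexification of `X`; holomorphy of operator-valued functions is tested on
matrix elements `t ↦ φ (S t x)`, with a bound uniform in `φ` and `x`. -/
def IsAnalyticSemigroup (S : ℝ → X →L[ℝ] X) : Prop :=
  ∃ θ : ℝ, 0 < θ ∧ ∃ K : ℝ, ∀ (x : X) (φ : X →L[ℝ] ℝ), ∃ f : ℂ → ℂ,
    DifferentiableOn ℂ f (sector θ) ∧
    (∀ t : ℝ, 0 < t → f (t : ℂ) = ((φ (S t x) : ℝ) : ℂ)) ∧
    ∀ z ∈ sector θ, ‖z‖ ≤ 1 → ‖f z‖ ≤ K * ‖φ‖ * ‖x‖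

/-- `L` has compact resolvent: for some `l`, the operator `l - L` is a bijection from `D(L)`
onto `X` whose inverse `R` is a compact operator. -/
def HasCompactResolvent (L : X →ₗ.[ℝ] X) : Prop :=
  ∃ (l : ℝ) (R : X →L[ℝ] X), IsCompactOperator R ∧
    (∀ x : X, (R x, l • R x - x) ∈ L.graph) ∧
    ∀ x y : X, (x, y) ∈ L.graph → R (l • x - y) = x

/-- The kernel `N` of `L`. -/
def kerOf (L : X →ₗ.[ℝ] X) : Submodule ℝ X :=
  L.graph.comap (LinearMap.inl ℝ X X)

/-- The orthogonal projection `P_c` onto `N`. -/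
def projC (L : X →ₗ.[ℝ] X) [FiniteDimensional ℝ (kerOf L)] : X →L[ℝ] X :=
  (kerOf L).starProjection

/-- The complementary projection `P_s = Id - P_c`. -/
def projS (L : X →ₗ.[ℝ] X) [FiniteDimensional ℝ (kerOf L)] : X →L[ℝ] X :=
  ContinuousLinearMap.id ℝ X - projC L

/-- The assumptions on the differential operator `L` and its semigroup `S t = e^{tL}`
(besides finite dimension of the kernel). -/
structure OperatorAssumption (L : X →ₗ.[ℝ] X) [FiniteDimensional ℝ (kerOf L)]
    (S : ℝ → X →L[ℝ] X) : Prop where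
  semigroup : IsC0Semigroup S
  generator : IsGenerator L S
  analytic : IsAnalyticSemigroup S
  compact_resolvent : HasCompactResolvent L
  commutes : ∀ x y : X, (x, y) ∈ L.graph → (projC L x, projC L y) ∈ L.graph
  stable : ∃ M μ : ℝ, 1 ≤ M ∧ 0 < μ ∧
    ∀ t : ℝ, 0 ≤ t → ‖(S t).comp (projS L)‖ ≤ M * Real.exp (-(t * μ))

/-! ### The space `X^{-α}` -/

/-- The negative fractional power
`(Id - L)^{-α} = Γ(α)⁻¹ ∫₀^∞ t^{α-1} e^{-t} e^{tL} dt` for `α > 0`, and `Id` for `α = 0`. -/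
def negPower (S : ℝ → X →L[ℝ] X) (α : ℝ) : X →L[ℝ] X :=
  open Classical in
  if α = 0 then ContinuousLinearMap.id ℝ X
  else (Real.Gamma α)⁻¹ • ∫ t in Set.Ioi (0 : ℝ), (t ^ (α - 1) * Real.exp (-t)) • S t

/-- A copy of `X`, to be normed by `‖x‖_{-α} = ‖(Id - L)^{-α} x‖`. -/
def PreNeg (_S : ℝ → X →L[ℝ] X) (_α : ℝ) : Type u := X

instance (S : ℝ → X →L[ℝ] X) (α : ℝ) : AddCommGroup (PreNeg S α) :=
  inferInstanceAs (AddCommGroup X)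

instance (S : ℝ → X →L[ℝ] X) (α : ℝ) : Module ℝ (PreNeg S α) :=
  inferInstanceAs (Module ℝ X)

/-- `(Id - L)^{-α}` on the copy of `X`. -/
def negPowerOn (S : ℝ → X →L[ℝ] X) (α : ℝ) : PreNeg S α →ₗ[ℝ] X :=
  (negPower S α).toLinearMap

instance (S : ℝ → X →L[ℝ] X) (α : ℝ) : SeminormedAddCommGroup (PreNeg S α) :=
  SeminormedAddCommGroup.induced (PreNeg S α) X (negPowerOn S α)

instance (S : ℝ → X →L[ℝ] X) (α : ℝ) : NormedSpace ℝ (PreNeg S α) :=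
  NormedSpace.induced ℝ (PreNeg S α) X (negPowerOn S α)

/-- `X^{-α}`: the completion of `X` under `‖x‖_{-α} = ‖(Id - L)^{-α} x‖`. -/
abbrev NegSpace (S : ℝ → X →L[ℝ] X) (α : ℝ) : Type u :=
  UniformSpace.Completion (PreNeg S α)

/-- The extension by continuity of an operator `T` on `X` to an operator `X^{-α} → X`
(meaningful when `T` is bounded from `‖·‖_{-α}` to `‖·‖`, as is the case for `P_c`, and for
`e^{tL}` with `t > 0`). -/
def extendNeg (S : ℝ → X →L[ℝ] X) (α : ℝ) (T : X →L[ℝ] X) : NegSpace S α → X :=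
  UniformSpace.Completion.extension (fun x : PreNeg S α => T (show X from x))

/-- The assumptions on the trilinear map `F : X³ → X^{-α}`: symmetry and the sign conditions on the
kernel `N` of `L`, with `F_c = P_c F`. Here `F ![u, v, w]` is `F(u, v, w)`. -/
structure CubicAssumption (L : X →ₗ.[ℝ] X) [FiniteDimensional ℝ (kerOf L)]
    (S : ℝ → X →L[ℝ] X) (α : ℝ) (F : X [×3]→L[ℝ] NegSpace S α) : Prop where
  symmetric : ∀ (σ : Equiv.Perm (Fin 3)) (x : Fin 3 → X), F (fun i => x (σ i)) = F x
  sign : ∀ v ∈ kerOf L, v ≠ 0 →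
    inner ℝ (extendNeg S α (projC L) (F ![v, v, v])) v < 0
  sign_linearized : ∀ v ∈ kerOf L, ∀ w ∈ kerOf L, v ≠ 0 → w ≠ 0 →
    inner ℝ (extendNeg S α (projC L) (F ![v, v, w])) w < 0
  dissipative : ∃ η C : ℝ, 0 < η ∧ 0 < C ∧ ∀ v ∈ kerOf L, ∀ φ ∈ kerOf L,
    inner ℝ (extendNeg S α (projC L) (F ![φ + v, φ + v, φ + v])) v
      ≤ C * ‖φ‖ ^ 4 - η * ‖v‖ ^ 4

end Semigroups

section Noise

variable {X : Type u} [NormedAddCommGroup X] [InnerProductSpace ℝ X] [MeasurableSpace X]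
variable {Ω : Type v} [MeasurableSpace Ω]

/-- A non-negative self-adjoint operator of trace class. -/
def IsPositiveTraceClass [CompleteSpace X] (Q : X →L[ℝ] X) : Prop :=
  Q.IsPositive ∧ ∃ (ι : Set X) (b : HilbertBasis ι ℝ X),
    Summable (fun i => inner ℝ (Q (b i)) (b i))

/-- `W` (restricted to `t ≥ 0`) is a continuous centered Gaussian process in `X` with
`E ⟨W t, x⟩ ⟨W s, y⟩ = (t^{2H} + s^{2H} - |t - s|^{2H}) / 2 * ⟨Q x, y⟩`. -/
structure IsQFractionalBM (P : Measure Ω) (H : ℝ) (Q : X →L[ℝ] X) (W : ℝ → Ω → X) : Prop where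
  gaussian : IsGaussianProcess (fun t : ℝ≥0 => W (t : ℝ)) P
  mean_zero : ∀ t : ℝ, 0 ≤ t → ∫ ω, W t ω ∂P = 0
  covariance : ∀ s t : ℝ, 0 ≤ s → 0 ≤ t → ∀ x y : X,
    ∫ ω, inner ℝ (W t ω) x * inner ℝ (W s ω) y ∂P
      = (t ^ (2 * H) + s ^ (2 * H) - |t - s| ^ (2 * H)) / 2 * inner ℝ (Q x) y
  continuous : ∀ᵐ ω ∂P, ContinuousOn (fun t : ℝ => W t ω) (Set.Ici 0)

/-- A trace-class fractional Brownian motion with Hurst index `H`. -/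
def IsTraceClassFBM [CompleteSpace X] (P : Measure Ω) (H : ℝ) (W : ℝ → Ω → X) : Prop :=
  ∃ Q : X →L[ℝ] X, IsPositiveTraceClass Q ∧ IsQFractionalBM P H Q W

/-- The Riemann sums `∑_{i<n} e^{(t-tᵢ)L} (W(tᵢ₊₁) - W(tᵢ))`, `tᵢ = i t / n`. -/
def convolutionSum (S : ℝ → X →L[ℝ] X) (W : ℝ → Ω → X) (t : ℝ) (n : ℕ) (ω : Ω) : X :=
  ∑ i ∈ Finset.range n,
    S (t - (i : ℝ) * t / n) (W (((i : ℝ) + 1) * t / n) ω - W ((i : ℝ) * t / n) ω)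

/-- `Z` is the stochastic convolution `W_L(t) = ∫₀ᵗ e^{(t-τ)L} dW(τ)`: a process with continuous
paths such that, for every `t ≥ 0`, `Z t` is the stochastic (Wiener) integral of the deterministic
integrand `τ ↦ e^{(t-τ)L}` against `W`, i.e. the limit in probability of its Riemann sums. -/
structure IsStochasticConvolution (P : Measure Ω) (S : ℝ → X →L[ℝ] X) (W Z : ℝ → Ω → X) :
    Prop where
  integral : ∀ t : ℝ, 0 ≤ t → TendstoInMeasure P (convolutionSum S W t) atTop (Z t)
  continuous : ∀ᵐ ω ∂P, ContinuousOn (fun t : ℝ => Z t ω) (Set.Ici 0)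

end Noise

section Hoelder

variable {X : Type u} [NormedAddCommGroup X]

/-- The norm of `C^β([0, T]; X)`: supremum plus Hölder seminorm, with value `∞` if `f` is not
`β`-Hölder continuous on `[0, T]`. -/
def hoelderNorm (β T : ℝ) (f : ℝ → X) : ℝ≥0∞ :=
  (⨆ t : Set.Icc (0 : ℝ) T, ‖f t‖ₑ)
    + eHolderNorm β.toNNReal (fun t : Set.Icc (0 : ℝ) T => f t)

end Hoelder

section Equations

variable {X : Type u} [NormedAddCommGroup X] [InnerProductSpace ℝ X]
variable {Ω : Type v} [MeasurableSpace Ω]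

/-- `u`, defined on the random interval `[0, tstar)`, is a maximal mild solution of
`du = (L u + ε² A u + F(u)) dt + ε^{2H+1} dW`, `u(0) = u₀`, where `Z` is the stochastic
convolution `W_L`. -/
structure IsMaximalMildSolution (P : Measure Ω) (S : ℝ → X →L[ℝ] X) (α : ℝ)
    (A : X →L[ℝ] NegSpace S α) (F : X [×3]→L[ℝ] NegSpace S α) (H ε : ℝ)
    (Z : ℝ → Ω → X) (u₀ : Ω → X) (tstar : Ω → EReal) (u : ℝ → Ω → X) : Prop where
  pos : ∀ᵐ ω ∂P, 0 < tstar ω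
  continuous : ∀ᵐ ω ∂P, ContinuousOn (fun t : ℝ => u t ω) {t | 0 ≤ t ∧ (t : EReal) < tstar ω}
  initial : ∀ᵐ ω ∂P, u 0 ω = u₀ ω
  mild : ∀ᵐ ω ∂P, ∀ t : ℝ, 0 < t → (t : EReal) < tstar ω →
    u t ω = S t (u₀ ω)
      + (∫ τ in (0 : ℝ)..t,
          extendNeg S α (S (t - τ)) (ε ^ 2 • A (u τ ω) + F ![u τ ω, u τ ω, u τ ω]))
      + ε ^ (2 * H + 1) • Z t ω
  maximal : ∀ᵐ ω ∂P, tstar ω = ⊤ ∨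
    Tendsto (fun t : ℝ => ‖u t ω‖) (𝓝[<] (tstar ω).toReal) atTop

/-- `a` is a continuous `N`-valued solution on `[0, T₀]` of the amplitude equation
`∂_T a = A_c a + F_c(a) + ∂_T b`, `a(0) = ε⁻¹ P_c u₀`, with `b(T) = ε^{2H} P_c W(ε^{-2} T)`. -/
structure IsAmplitudeSolution (P : Measure Ω) (L : X →ₗ.[ℝ] X) [FiniteDimensional ℝ (kerOf L)]
    (S : ℝ → X →L[ℝ] X) (α : ℝ) (A : X →L[ℝ] NegSpace S α) (F : X [×3]→L[ℝ] NegSpace S α)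
    (H ε T₀ : ℝ) (W : ℝ → Ω → X) (u₀ : Ω → X) (a : ℝ → Ω → X) : Prop where
  continuous : ∀ᵐ ω ∂P, ContinuousOn (fun T : ℝ => a T ω) (Set.Icc 0 T₀)
  mem_ker : ∀ᵐ ω ∂P, ∀ T ∈ Set.Icc (0 : ℝ) T₀, a T ω ∈ kerOf L
  equation : ∀ᵐ ω ∂P, ∀ T ∈ Set.Icc (0 : ℝ) T₀,
    a T ω = ε⁻¹ • projC L (u₀ ω)
      + (∫ s in (0 : ℝ)..T, (extendNeg S α (projC L) (A (a s ω))
          + extendNeg S α (projC L) (F ![a s ω, a s ω, a s ω])))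
      + ε ^ (2 * H) • projC L (W (T / ε ^ 2) ω)

/-- The fast fractional Ornstein-Uhlenbeck process
`ψ_s(t) = e^{tL} ψ_s(0) + P_s W_L(t)`, `ψ_s(0) = ε^{-2H-1} P_s u₀`. -/
def fastOU (L : X →ₗ.[ℝ] X) [FiniteDimensional ℝ (kerOf L)] (S : ℝ → X →L[ℝ] X)
    (H ε : ℝ) (Z : ℝ → Ω → X) (u₀ : Ω → X) (t : ℝ) (ω : Ω) : X :=
  S t (ε ^ (-2 * H - 1) • projS L (u₀ ω)) + projS L (Z t ω)

/-- The approximation `ψ(t) = ε a(ε² t) + ε^{2H+1} ψ_s(t)`. -/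
def approximation (L : X →ₗ.[ℝ] X) [FiniteDimensional ℝ (kerOf L)] (S : ℝ → X →L[ℝ] X)
    (H ε : ℝ) (Z : ℝ → Ω → X) (u₀ : Ω → X) (a : ℝ → Ω → X) (t : ℝ) (ω : Ω) : X :=
  ε • a (ε ^ 2 * t) ω + ε ^ (2 * H + 1) • fastOU L S H ε Z u₀ t ω

/-- The set `Ω̃_ε` of large probability, with `ψ_s(0) = ε^{-2H-1} P_s u₀` and
`ψ_c(0) = ε⁻¹ P_c u₀`. -/
def largeSet (L : X →ₗ.[ℝ] X) [FiniteDimensional ℝ (kerOf L)] (H κ β T₀ ε : ℝ)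
    (W Z : ℝ → Ω → X) (u₀ : Ω → X) : Set Ω :=
  {ω | (∀ t ∈ Set.Icc (0 : ℝ) (T₀ / ε ^ 2), ‖projS L (Z t ω)‖ ≤ ε ^ (-κ)) ∧
    hoelderNorm β T₀ (fun T => W (T / ε ^ 2) ω) ≤ ENNReal.ofReal (ε ^ (-2 * H - κ)) ∧
    ‖ε ^ (-2 * H - 1) • projS L (u₀ ω)‖ ≤ ε ^ (-κ) ∧
    ‖ε⁻¹ • projC L (u₀ ω)‖ ≤ ε ^ (-κ)}

end Equations

end AmplitudeSPDE

end

/-!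
The proof is pathwise: probability enters only through three facts that hold almost surely. The
noise and the stochastic convolution have continuous paths and start at zero, `P_c W_L = P_c W`,
and the primitive of `P_s W_L` is `R (W - W_L)` with `R = ∫₀^∞ e^{τL} P_s dτ`
(`IsStochasticConvolution.ae_paths`). The last identity comes from the Riemann sums defining `W_L`:
`R` inverts `-L` on the range of `P_s`, so that `R e^{tL}` is differentiable in `t` and the sums can be
summed by parts path by path.

In slow time, `ε⁻¹ u(T/ε²) = a + r + ρ + w`, where `ρ` is the fast Ornstein-Uhlenbeck process, `r` the
error in the kernel `N` and `w` the error in its complement. The smoothing estimate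
`‖e^{tL} x‖ ≤ C t^{-γ} ‖x‖_{-α}`, `γ < 1`, of analytic semigroups and the exponential stability on the range of
`P_s` bound the drift convolution in the stable part (`OperatorAssumption.exists_mild_bound`), hence
`w` is of order `ε²` up to powers of `ε^{-κ}`.

The error `r` solves the amplitude equation perturbed by `ρ` and `w`. The process `ρ` is only of order
`ε^{2H}`, but it is fast: by the identity above its primitive is bounded by increments of the noise
and of `ρ`, and is `O(ε²)` in the Hölder norm of the noise (`IsStableInverse.exists_fast_bound`).
The terms linear in `ρ` have the form `∫ (A_c + 3 F_c(a, a, ·)) ρ`, and Young's estimate for integrals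
against Hölder functions (`norm_integral_apply_le`) applies to them, since dissipativity bounds `a`
and the amplitude equation gives `a` the Hölder regularity of the noise. If `H > 1/2` the exponents
add up to more than one. If `H ≤ 1/2` one interpolates with the Lipschitz bound of order `ε^{2H}` for
the primitive, at the cost of powers of `ε` (`exists_interpolated_exponent`); the resulting order
`ε^{4H}`, up to powers of `ε^{-κ}`, is at least as good as `ε^{2H + 2H²/(1-H)}`, as `2H²/(1-H) ≤ 2H`
for `H ≤ 1/2`.

The cubic terms in the equation for `r` are dissipative: the sign condition on
`⟨F_c(v,v,w), w⟩` makes `F_c` one-sided Lipschitz on `N` with constant zero, so that Gronwall's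
inequality does not see the size `ε^{-κ}` of `a` (`IsDissipativeCubic.exists_remainder_bound`). All
estimates hold while the errors are at most one and improve on this bound, hence hold up to time
`T₀`; as `u` then stays bounded, the maximal solution exists beyond `T₀ / ε²`.
-/

noncomputable section

namespace AmplitudeSPDE

/-! ### The semigroup and the spectral projections -/

section SemigroupBasics

variable {X : Type u} [NormedAddCommGroup X] [InnerProductSpace ℝ X]
  {L : X →ₗ.[ℝ] X} {S : ℝ → X →L[ℝ] X}

lemma IsC0Semigroup.apply_add (hS : IsC0Semigroup S) {s t : ℝ} (hs : 0 ≤ s) (ht : 0 ≤ t) (x : X) :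
    S (s + t) x = S s (S t x) := by
  rw [hS.comp s t hs ht]; rfl

lemma IsC0Semigroup.zero_apply (hS : IsC0Semigroup S) (x : X) : S 0 x = x := by
  rw [hS.zero]; rfl

lemma IsGenerator.hasDerivWithinAt (hS : IsC0Semigroup S) (hG : IsGenerator L S) {x y : X}
    (hxy : (x, y) ∈ L.graph) {s : ℝ} (hs : 0 ≤ s) :
    HasDerivWithinAt (fun r => S r x) (S s y) (Set.Ici s) s := by
  rw [← hasDerivWithinAt_Ioi_iff_Ici, hasDerivWithinAt_iff_tendsto_slope' (by simp)]
  have h1 : Tendsto (fun t : ℝ => t - s) (𝓝[>] s) (𝓝[>] 0) := by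
    refine tendsto_nhdsWithin_iff.2 ⟨?_, ?_⟩
    · have : Tendsto (fun t : ℝ => t - s) (𝓝 s) (𝓝 (s - s)) := by
        exact (continuous_id.sub continuous_const).tendsto s
      rw [sub_self] at this
      exact this.mono_left nhdsWithin_le_nhds
    · filter_upwards [self_mem_nhdsWithin] with t ht
      exact sub_pos.2 (Set.mem_Ioi.1 ht)
  have h2 := ((S s).continuous.tendsto y).comp (((hG x y).1 hxy).comp h1)
  refine h2.congr' ?_
  filter_upwards [self_mem_nhdsWithin] with t ht
  have h3 : S t x = S s (S (t - s) x) := by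
    rw [← hS.apply_add hs (sub_nonneg.2 (le_of_lt ht))]; congr 2; ring
  simp [slope_def_module, h3]

lemma mem_kerOf {x : X} : x ∈ kerOf L ↔ (x, (0 : X)) ∈ L.graph := by
  simp [kerOf]

lemma graph_unique {x y z : X} (h : (x, y) ∈ L.graph) (h' : (x, z) ∈ L.graph) : y = z :=
  L.mem_graph_snd_inj h h' rfl

variable [FiniteDimensional ℝ (kerOf L)]

lemma projC_mem (x : X) : projC L x ∈ kerOf L := by
  simp [projC]

lemma projC_of_mem {x : X} (hx : x ∈ kerOf L) : projC L x = x := by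
  simpa [projC] using Submodule.starProjection_eq_self_iff.2 hx

lemma projC_projC (x : X) : projC L (projC L x) = projC L x := projC_of_mem (projC_mem x)

lemma projS_apply (x : X) : projS L x = x - projC L x := by simp [projS]

lemma projC_projS (x : X) : projC L (projS L x) = 0 := by
  simp [projS_apply, projC_projC]

lemma projS_projS (x : X) : projS L (projS L x) = projS L x := by
  rw [projS_apply (projS L x), projC_projS, sub_zero]

lemma projC_add_projS (x : X) : projC L x + projS L x = x := by simp [projS_apply]

lemma norm_projC_le (x : X) : ‖projC L x‖ ≤ ‖x‖ := by
  simpa [projC] using (kerOf L).norm_starProjection_apply_le x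

lemma norm_projS_le (x : X) : ‖projS L x‖ ≤ 2 * ‖x‖ := by
  rw [projS_apply]
  have := norm_sub_le x (projC L x)
  have := norm_projC_le (L := L) x
  linarith

lemma OperatorAssumption.apply_of_mem_ker (hL : OperatorAssumption L S) {x : X}
    (hx : x ∈ kerOf L) {t : ℝ} (ht : 0 ≤ t) : S t x = x := by
  have h := constant_of_has_deriv_right_zero (f := fun r => S r x) (a := 0) (b := t)
    ((hL.semigroup.continuous x).mono Set.Icc_subset_Ici_self) (fun s hs => by
      simpa using hL.generator.hasDerivWithinAt hL.semigroup (mem_kerOf.1 hx) hs.1) t ⟨ht, le_rfl⟩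
  rw [h, hL.semigroup.zero_apply]

lemma OperatorAssumption.apply_projC (hL : OperatorAssumption L S) {t : ℝ} (ht : 0 ≤ t) (x : X) :
    S t (projC L x) = projC L x :=
  hL.apply_of_mem_ker (projC_mem x) ht

/-- `P_c` vanishes on the range of `L`, because it commutes with `L`. -/
lemma OperatorAssumption.projC_of_graph (hL : OperatorAssumption L S) {x y : X}
    (h : (x, y) ∈ L.graph) : projC L y = 0 :=
  graph_unique (hL.commutes x y h) (mem_kerOf.1 (projC_mem x))

lemma OperatorAssumption.exists_decay (hL : OperatorAssumption L S) :
    ∃ M μ : ℝ, 1 ≤ M ∧ 0 < μ ∧ ∀ t : ℝ, 0 ≤ t → ∀ x,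
      ‖S t (projS L x)‖ ≤ M * Real.exp (-(t * μ)) * ‖x‖ := by
  obtain ⟨M, μ, hM, hμ, h⟩ := hL.stable
  exact ⟨M, μ, hM, hμ, fun t ht x =>
    ((S t).comp (projS L)).le_of_opNorm_le (h t ht) x⟩

lemma OperatorAssumption.exists_bound (hL : OperatorAssumption L S) :
    ∃ K : ℝ, 1 ≤ K ∧ ∀ t : ℝ, 0 ≤ t → ‖S t‖ ≤ K := by
  obtain ⟨M, μ, hM, hμ, h⟩ := hL.exists_decay
  refine ⟨1 + M, by linarith, fun t ht => ContinuousLinearMap.opNorm_le_bound _ (by linarith) ?_⟩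
  intro x
  have h1 : S t x = projC L x + S t (projS L x) := by
    rw [← hL.apply_projC ht, ← map_add, projC_add_projS]
  have h2 : M * Real.exp (-(t * μ)) ≤ M * 1 := by
    gcongr
    rw [Real.exp_le_one_iff]; have := mul_nonneg ht hμ.le; linarith
  calc ‖S t x‖ ≤ ‖projC L x‖ + ‖S t (projS L x)‖ := by rw [h1]; exact norm_add_le _ _
    _ ≤ ‖x‖ + M * ‖x‖ := by
      gcongr
      · exact norm_projC_le x
      · exact (h t ht x).trans (by rw [mul_one] at h2; gcongr)
    _ = _ := by ring

variable [CompleteSpace X]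

/-- Orbit averages belong to the domain of the generator. -/
lemma OperatorAssumption.integral_mem_graph (hL : OperatorAssumption L S) (x : X) {t : ℝ}
    (ht : 0 ≤ t) : (∫ s in (0 : ℝ)..t, S s x, S t x - x) ∈ L.graph := by
  set f : ℝ → X := fun s => S (max s 0) x with hf
  have hfc : Continuous f :=
    (hL.semigroup.continuous x).comp_continuous (by fun_prop) (fun s => Set.mem_Ici.2 (le_max_right _ _))
  have hfe : ∀ s, 0 ≤ s → S s x = f s := fun s hs => by simp [hf, hs]
  rw [hL.generator]
  have hd : ∀ a : ℝ, 0 ≤ a → HasDerivWithinAt (fun r => ∫ s in (0 : ℝ)..(a + r), f s) (f a)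
      (Set.Ioi 0) 0 := by
    intro a ha
    have h1 : HasDerivAt (fun r => ∫ s in (0 : ℝ)..r, f s) (f a) (a + 0) := by
      rw [add_zero]
      exact intervalIntegral.integral_hasDerivAt_right (hfc.intervalIntegrable _ _)
        hfc.stronglyMeasurable.stronglyMeasurableAtFilter hfc.continuousAt
    have h2 : HasDerivAt (fun r : ℝ => a + r) 1 0 := (hasDerivAt_id (0 : ℝ)).const_add a
    have h3 := h1.scomp (0 : ℝ) h2
    rw [one_smul] at h3
    exact h3.hasDerivWithinAt
  have h3 := (hd t ht).sub (hd 0 le_rfl)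
  rw [hasDerivWithinAt_iff_tendsto_slope' (by simp)] at h3
  have h0 : f 0 = x := by simp [hf, hL.semigroup.zero_apply]
  rw [hfe t ht]
  rw [h0] at h3
  refine h3.congr' ?_
  filter_upwards [self_mem_nhdsWithin] with h hh
  have hh0 : (0 : ℝ) ≤ h := le_of_lt hh
  have e0 : ∫ s in (0 : ℝ)..t, S s x = ∫ s in (0 : ℝ)..t, f s :=
    intervalIntegral.integral_congr (fun s hs => by
      rw [Set.uIcc_of_le ht] at hs; exact hfe s hs.1)
  have e1 : S h (∫ s in (0 : ℝ)..t, f s) = ∫ s in (0 : ℝ)..t, f (s + h) := by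
    rw [← ContinuousLinearMap.intervalIntegral_comp_comm _ (hfc.intervalIntegrable _ _)]
    refine intervalIntegral.integral_congr (fun s hs => ?_)
    rw [Set.uIcc_of_le ht] at hs
    change S h (f s) = _
    rw [← hfe s hs.1, ← hfe _ (add_nonneg hs.1 hh0), add_comm, hL.semigroup.apply_add hh0 hs.1]
  rw [e0, e1, intervalIntegral.integral_comp_add_right]
  have e2 : ∫ s in (0 + h)..(t + h), f s = (∫ s in (0:ℝ)..(t + h), f s) - ∫ s in (0:ℝ)..h, f s := by
    rw [zero_add, intervalIntegral.integral_interval_sub_left] <;>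
      exact hfc.intervalIntegrable _ _
  rw [e2]
  simp only [slope_def_module, Pi.sub_apply, sub_zero, zero_add, add_zero,
    intervalIntegral.integral_same]

/-- The increment `e^{tL} x - x` is `L` applied to an orbit average, and `P_c` vanishes on the range
of `L`. -/
lemma OperatorAssumption.projC_apply (hL : OperatorAssumption L S) {t : ℝ} (ht : 0 ≤ t) (x : X) :
    projC L (S t x) = projC L x := by
  have := hL.projC_of_graph (hL.integral_mem_graph x ht)
  rwa [map_sub, sub_eq_zero] at this

lemma OperatorAssumption.projS_apply_comm (hL : OperatorAssumption L S) {t : ℝ} (ht : 0 ≤ t)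
    (x : X) : projS L (S t x) = S t (projS L x) := by
  rw [projS_apply, projS_apply, hL.projC_apply ht, map_sub, hL.apply_projC ht]

end SemigroupBasics

/-! ### Smoothing by the analytic semigroup -/

section Smoothing

lemma exists_closedBall_subset_sector {θ : ℝ} (hθ : 0 < θ) :
    ∃ c : ℝ, 0 < c ∧ c < 1 ∧ ∀ t : ℝ, 0 < t → Metric.closedBall (t : ℂ) (c * t) ⊆ sector θ := by
  have h1 : ContinuousAt Complex.arg 1 := Complex.continuousAt_arg (by simp)
  obtain ⟨δ, hδ, h⟩ := Metric.continuousAt_iff.1 h1 θ hθ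
  refine ⟨min (δ / 2) (1 / 2), by positivity, by
    have := min_le_right (δ / 2) (1 / 2); linarith, fun t ht z hz => ?_⟩
  set c := min (δ / 2) (1 / 2) with hc
  have hc1 : c ≤ δ / 2 := min_le_left _ _
  have hc2 : c ≤ 1 / 2 := min_le_right _ _
  have htC : (t : ℂ) ≠ 0 := by exact_mod_cast ht.ne'
  have hz1 : dist (z / t) 1 ≤ c := by
    rw [Metric.mem_closedBall, dist_eq_norm] at hz
    rw [dist_eq_norm, div_sub_one htC, norm_div, Complex.norm_real, Real.norm_of_nonneg ht.le,
      div_le_iff₀ ht]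
    exact hz
  have hz0 : z / t ≠ 0 := by
    intro h0
    rw [h0] at hz1
    simp at hz1
    linarith
  have hz2 : z = (t : ℂ) * (z / t) := by field_simp
  have h3 := h (lt_of_le_of_lt hz1 (by linarith))
  rw [Complex.arg_one, Real.dist_eq, sub_zero] at h3
  refine ⟨fun h0 => hz0 (by simp [h0]), ?_⟩
  rw [hz2, Complex.arg_real_mul _ ht]
  exact h3

variable {X : Type u} [NormedAddCommGroup X] [InnerProductSpace ℝ X]
  {L : X →ₗ.[ℝ] X} {S : ℝ → X →L[ℝ] X} [FiniteDimensional ℝ (kerOf L)]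

/-- Cauchy's estimate: an analytic semigroup has `‖(d/dt) e^{tL}‖ ≤ C / t` near `t = 0`. -/
lemma IsAnalyticSemigroup.exists_deriv_bound_small (hS : IsAnalyticSemigroup S) :
    ∃ C : ℝ, 0 ≤ C ∧ ∀ (x : X) (φ : X →L[ℝ] ℝ) (t : ℝ), 0 < t → t ≤ 1 / 2 →
      ∃ d : ℝ, HasDerivAt (fun r => φ (S r x)) d t ∧ |d| ≤ C * t⁻¹ * ‖φ‖ * ‖x‖ := by
  obtain ⟨θ, hθ, K, hK⟩ := hS
  obtain ⟨c, hc0, hc1, hc⟩ := exists_closedBall_subset_sector hθ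
  refine ⟨max K 0 / c, by positivity, fun x φ t ht ht2 => ?_⟩
  obtain ⟨f, hf, hfr, hfb⟩ := hK x φ
  have hR : 0 < c * t := by positivity
  have hball := hc t ht
  have hnorm : ∀ z ∈ Metric.sphere (t : ℂ) (c * t), ‖f z‖ ≤ max K 0 * ‖φ‖ * ‖x‖ := by
    intro z hz
    refine (hfb z (hball (Metric.sphere_subset_closedBall hz)) ?_).trans ?_
    · have h1 : ‖z‖ ≤ ‖z - t‖ + ‖(t : ℂ)‖ := by
        simpa using norm_add_le (z - t) (t : ℂ)
      rw [mem_sphere_iff_norm] at hz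
      rw [hz, Complex.norm_real, Real.norm_of_nonneg ht.le] at h1
      nlinarith
    · gcongr
      exact le_max_left _ _
  have h1 := Complex.norm_deriv_le_of_forall_mem_sphere_norm_le hR
    (hf.diffContOnCl_ball hball) hnorm
  have hd : DifferentiableAt ℂ f t :=
    hf.differentiableAt (mem_of_superset (Metric.closedBall_mem_nhds _ hR) hball)
  refine ⟨(deriv f t).re, ?_, ?_⟩
  · refine hd.hasDerivAt.real_of_complex.congr_of_eventuallyEq ?_
    filter_upwards [lt_mem_nhds ht] with r hr
    rw [hfr r hr, Complex.ofReal_re]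
  · refine (Complex.abs_re_le_norm _).trans (h1.trans (le_of_eq ?_))
    field_simp

/-- The derivative bound for all times: for large `t` the semigroup law reduces it to `t = 1/4`. -/
lemma OperatorAssumption.exists_deriv_bound (hL : OperatorAssumption L S) :
    ∃ C : ℝ, 0 ≤ C ∧ ∀ (x : X) (φ : X →L[ℝ] ℝ) (t : ℝ), 0 < t →
      ∃ d : ℝ, HasDerivAt (fun r => φ (S r x)) d t ∧ |d| ≤ C * (t⁻¹ + 1) * ‖φ‖ * ‖x‖ := by
  obtain ⟨C, hC, h⟩ := hL.analytic.exists_deriv_bound_small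
  obtain ⟨K, hK1, hK⟩ := hL.exists_bound
  refine ⟨C * 4 * K, by positivity, fun x φ t ht => ?_⟩
  have hti : 0 < t⁻¹ := inv_pos.2 ht
  rcases le_or_gt t (1 / 2) with h2 | h2
  · obtain ⟨d, hd, hdb⟩ := h x φ t ht h2
    refine ⟨d, hd, hdb.trans ?_⟩
    gcongr
    · nlinarith
    · linarith
  · obtain ⟨d, hd, hdb⟩ := h x (φ.comp (S (t - 1 / 4))) (1 / 4) (by norm_num) (by norm_num)
    refine ⟨d, ?_, hdb.trans ?_⟩
    · have h3 : HasDerivAt (fun r : ℝ => r - (t - 1 / 4)) 1 t := (hasDerivAt_id t).sub_const _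
      have h4 : HasDerivAt (fun r => (φ.comp (S (t - 1 / 4))) (S r x)) d (t - (t - 1 / 4)) := by
        convert hd using 1; ring
      have h5 := h4.comp t h3
      rw [mul_one] at h5
      refine h5.congr_of_eventuallyEq ?_
      filter_upwards [lt_mem_nhds (show t - 1 / 4 < t by linarith)] with r hr
      change _ = φ (S (t - 1 / 4) (S (r - (t - 1 / 4)) x))
      rw [← hL.semigroup.apply_add (by linarith) (by linarith)]
      congr 3; ring
    · have h6 : ‖φ.comp (S (t - 1 / 4))‖ ≤ ‖φ‖ * K :=
        (φ.opNorm_comp_le _).trans (by gcongr; exact hK _ (by linarith))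
      calc C * (1 / 4)⁻¹ * ‖φ.comp (S (t - 1 / 4))‖ * ‖x‖ ≤ C * (1 / 4)⁻¹ * (‖φ‖ * K) * ‖x‖ := by
            gcongr
        _ = C * 4 * K * 1 * ‖φ‖ * ‖x‖ := by ring
        _ ≤ _ := by gcongr; linarith

/-- Testing against functionals of norm at most one. -/
lemma norm_le_of_forall_functional {x : X} {c : ℝ}
    (h : ∀ φ : X →L[ℝ] ℝ, ‖φ‖ ≤ 1 → |φ x| ≤ c) : ‖x‖ ≤ c := by
  obtain ⟨φ, hφ, hx⟩ := exists_dual_vector'' ℝ x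
  have := h φ hφ
  rw [hx] at this
  simpa using this

/-- An analytic semigroup is continuous in operator norm away from `t = 0`. -/
lemma OperatorAssumption.continuousOn_norm (hL : OperatorAssumption L S) :
    ContinuousOn S (Set.Ioi 0) := by
  obtain ⟨C, hC, h⟩ := hL.exists_deriv_bound
  intro t ht
  have ht0 : (0 : ℝ) < t := ht
  have key : ∀ s, t / 2 < s → ‖S s - S t‖ ≤ C * ((t / 2)⁻¹ + 1) * |s - t| := by
    intro s hs
    refine ContinuousLinearMap.opNorm_le_bound _ (by positivity) fun x => ?_
    refine norm_le_of_forall_functional fun φ hφ => ?_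
    choose! d hd hdb using h x φ
    have := (convex_Ioi (t / 2)).norm_image_sub_le_of_norm_hasDerivWithin_le
      (f := fun r => φ (S r x)) (f' := d) (C := C * ((t / 2)⁻¹ + 1) * ‖x‖) (x := t) (y := s)
      (fun r hr => (hd r (lt_trans (by positivity) hr)).hasDerivWithinAt) (fun r hr => by
        have hr' : t / 2 < r := hr
        refine (hdb r (lt_trans (by positivity) hr)).trans ?_
        calc C * (r⁻¹ + 1) * ‖φ‖ * ‖x‖ ≤ C * ((t / 2)⁻¹ + 1) * 1 * ‖x‖ := by gcongr
          _ = _ := by ring)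
      (Set.mem_Ioi.2 (by linarith)) (Set.mem_Ioi.2 hs)
    simp only [Real.norm_eq_abs] at this
    rw [sub_apply, map_sub]
    linarith
  apply ContinuousAt.continuousWithinAt
  rw [ContinuousAt, tendsto_iff_norm_sub_tendsto_zero]
  refine squeeze_zero' (Eventually.of_forall fun _ => norm_nonneg _)
    ((lt_mem_nhds (show t / 2 < t by linarith)).mono key) ?_
  have : Continuous fun s => C * ((t / 2)⁻¹ + 1) * |s - t| := by fun_prop
  simpa using this.tendsto t

/-- The derivative of the damped orbit `e^{-τ} φ (e^{τL} y)` as a functional of `y`. -/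
lemma OperatorAssumption.exists_deriv_functional (hL : OperatorAssumption L S) :
    ∃ C : ℝ, 0 ≤ C ∧ ∀ (φ : X →L[ℝ] ℝ) (τ : ℝ), 0 < τ → ∃ Λ : X →L[ℝ] ℝ,
      ‖Λ‖ ≤ C * (τ⁻¹ + 1) * Real.exp (-τ) * ‖φ‖ ∧
      ∀ y, HasDerivAt (fun r => Real.exp (-r) * φ (S r y)) (Λ y) τ := by
  obtain ⟨C, hC, h⟩ := hL.exists_deriv_bound
  obtain ⟨K, hK1, hK⟩ := hL.exists_bound
  refine ⟨C + K, by positivity, fun φ τ hτ => ?_⟩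
  choose d hd hdb using fun y => h y φ τ hτ
  have hadd : ∀ y z, d (y + z) = d y + d z := fun y z => by
    refine (hd (y + z)).unique ?_
    simpa using (hd y).fun_add (hd z)
  have hsmul : ∀ (c : ℝ) y, d (c • y) = c • d y := fun c y => by
    refine (hd (c • y)).unique ?_
    simpa using (hd y).const_mul c
  let D : X →ₗ[ℝ] ℝ := ⟨⟨d, hadd⟩, fun c y => by simpa using hsmul c y⟩
  let D' : X →L[ℝ] ℝ := D.mkContinuous (C * (τ⁻¹ + 1) * ‖φ‖) (fun y => hdb y)
  refine ⟨Real.exp (-τ) • (D' - φ.comp (S τ)), ?_, fun y => ?_⟩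
  · rw [norm_smul, Real.norm_of_nonneg (Real.exp_pos _).le]
    have h1 : ‖D' - φ.comp (S τ)‖ ≤ C * (τ⁻¹ + 1) * ‖φ‖ + ‖φ‖ * K := by
      refine (norm_sub_le _ _).trans (add_le_add ?_ ?_)
      · exact LinearMap.mkContinuous_norm_le _ (by positivity) _
      · exact (φ.opNorm_comp_le _).trans (by gcongr; exact hK _ hτ.le)
    have h2 : ‖φ‖ * K ≤ K * (τ⁻¹ + 1) * ‖φ‖ := by
      have : 0 ≤ τ⁻¹ * K * ‖φ‖ := by positivity
      nlinarith
    calc Real.exp (-τ) * ‖D' - φ.comp (S τ)‖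
        ≤ Real.exp (-τ) * (C * (τ⁻¹ + 1) * ‖φ‖ + K * (τ⁻¹ + 1) * ‖φ‖) := by gcongr; linarith
      _ = _ := by ring
  · have h1 : HasDerivAt (fun r : ℝ => Real.exp (-r)) (-Real.exp (-τ)) τ := by
      simpa using (hasDerivAt_neg τ).exp
    refine (h1.fun_mul (hd y)).congr_deriv ?_
    change _ = Real.exp (-τ) * (d y - φ (S τ y))
    ring

end Smoothing

/-! ### An integral identity for the Beta kernel -/

section BetaKernel

/-- `B(a, 1 - a)` as an integral over the half line. -/
def betaConst (a : ℝ) : ℝ := ∫ v in Set.Ioi (0 : ℝ), v ^ (a - 1) * (1 + v)⁻¹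

lemma integrableOn_betaKernel {a : ℝ} (h0 : 0 < a) (h1 : a < 1) :
    IntegrableOn (fun v : ℝ => v ^ (a - 1) * (1 + v)⁻¹) (Set.Ioi 0) := by
  have hm : Measurable (fun v : ℝ => v ^ (a - 1) * (1 + v)⁻¹) := by fun_prop
  rw [← Set.Ioc_union_Ioi_eq_Ioi zero_le_one]
  refine IntegrableOn.union ?_ ?_
  · have : IntegrableOn (fun v : ℝ => v ^ (a - 1)) (Set.Ioc 0 1) := by
      have := intervalIntegral.intervalIntegrable_rpow' (a := 0) (b := 1)
        (show -1 < a - 1 by linarith)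
      rwa [intervalIntegrable_iff_integrableOn_Ioc_of_le zero_le_one] at this
    refine Integrable.mono' this hm.aestronglyMeasurable ?_
    filter_upwards [ae_restrict_mem measurableSet_Ioc] with v hv
    have hv0 : 0 < v := hv.1
    rw [Real.norm_of_nonneg (by positivity)]
    refine mul_le_of_le_one_right (by positivity) (inv_le_one_of_one_le₀ (by linarith))
  · refine Integrable.mono' (integrableOn_Ioi_rpow_of_lt (show a - 2 < -1 by linarith) one_pos)
      hm.aestronglyMeasurable ?_
    filter_upwards [ae_restrict_mem measurableSet_Ioi] with v hv
    have hv0 : (0 : ℝ) < v := zero_lt_one.trans hv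
    rw [Real.norm_of_nonneg (by positivity), show a - 2 = a - 1 + -1 by ring,
      Real.rpow_add hv0, Real.rpow_neg_one]
    gcongr
    linarith

lemma betaConst_pos {a : ℝ} (h0 : 0 < a) (h1 : a < 1) : 0 < betaConst a := by
  have hpos : ∀ v ∈ Set.Ioi (0 : ℝ), 0 < v ^ (a - 1) * (1 + v)⁻¹ := fun v hv => by
    have : (0 : ℝ) < v := hv
    positivity
  rw [betaConst, setIntegral_pos_iff_support_of_nonneg_ae _ (integrableOn_betaKernel h0 h1)]
  · have : Set.Ioi (0 : ℝ) ⊆ Function.support (fun v : ℝ => v ^ (a - 1) * (1 + v)⁻¹) :=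
      fun v hv => (hpos v hv).ne'
    rw [Set.inter_eq_right.2 this, Real.volume_Ioi]
    exact ENNReal.zero_lt_top
  · filter_upwards [ae_restrict_mem measurableSet_Ioi] with v hv using (hpos v hv).le

/-- The substitution `r = s v` turns the double fractional integral into a multiple of `∫ Φ`. -/
lemma integral_betaKernel {a : ℝ} (h0 : 0 < a) (h1 : a < 1) {Φ : ℝ → ℝ} (hΦm : Measurable Φ)
    (hΦ : IntegrableOn Φ (Set.Ioi 0)) :
    ∫ s in Set.Ioi (0 : ℝ), s ^ (-a) * ∫ r in Set.Ioi (0 : ℝ), r ^ (a - 1) * Φ (s + r)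
      = betaConst a * ∫ σ in Set.Ioi (0 : ℝ), Φ σ := by
  have e1 : ∀ s ∈ Set.Ioi (0 : ℝ), s ^ (-a) * ∫ r in Set.Ioi (0 : ℝ), r ^ (a - 1) * Φ (s + r)
      = ∫ v in Set.Ioi (0 : ℝ), v ^ (a - 1) * Φ ((1 + v) * s) := by
    intro s hs
    have hs0 : (0 : ℝ) < s := hs
    have h2 := integral_comp_mul_left_Ioi (fun r => r ^ (a - 1) * Φ (s + r)) 0 hs0
    rw [mul_zero] at h2
    have h3 : ∫ r in Set.Ioi (0 : ℝ), r ^ (a - 1) * Φ (s + r)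
        = s * ∫ v in Set.Ioi (0 : ℝ), (s * v) ^ (a - 1) * Φ (s + s * v) := by
      rw [h2, smul_eq_mul, mul_inv_cancel_left₀ hs0.ne']
    rw [h3, ← mul_assoc, ← integral_const_mul]
    refine setIntegral_congr_fun measurableSet_Ioi fun v hv => ?_
    have hv0 : (0 : ℝ) < v := hv
    rw [Real.mul_rpow hs0.le hv0.le, show (1 + v) * s = s + s * v by ring]
    have : s ^ (-a) * s * s ^ (a - 1) = 1 := by
      rw [← Real.rpow_add_one hs0.ne', ← Real.rpow_add hs0]
      simp
    calc s ^ (-a) * s * (s ^ (a - 1) * v ^ (a - 1) * Φ (s + s * v))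
        = (s ^ (-a) * s * s ^ (a - 1)) * (v ^ (a - 1) * Φ (s + s * v)) := by ring
      _ = _ := by rw [this, one_mul]
  have e2 : ∀ v ∈ Set.Ioi (0 : ℝ), ∀ Φ : ℝ → ℝ, ∫ s in Set.Ioi (0 : ℝ), v ^ (a - 1) * Φ ((1 + v) * s)
      = v ^ (a - 1) * (1 + v)⁻¹ * ∫ σ in Set.Ioi (0 : ℝ), Φ σ := by
    intro v hv Φ
    have hv0 : (0 : ℝ) < v := hv
    have h2 := integral_comp_mul_left_Ioi Φ 0 (show 0 < 1 + v by linarith)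
    rw [mul_zero] at h2
    rw [integral_const_mul, h2, smul_eq_mul, mul_assoc]
  have hint : Integrable (Function.uncurry fun s v : ℝ => v ^ (a - 1) * Φ ((1 + v) * s))
      ((volume.restrict (Set.Ioi 0)).prod (volume.restrict (Set.Ioi 0))) := by
    have hm : Measurable (Function.uncurry fun s v : ℝ => v ^ (a - 1) * Φ ((1 + v) * s)) := by
      simp only [Function.uncurry_def]
      fun_prop
    rw [integrable_prod_iff' hm.aestronglyMeasurable]
    constructor
    · filter_upwards [ae_restrict_mem measurableSet_Ioi] with v hv
      have hv0 : (0 : ℝ) < v := hv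
      have : IntegrableOn (fun s => Φ ((1 + v) * s)) (Set.Ioi 0) := by
        rw [integrableOn_Ioi_comp_mul_left_iff _ _ (show 0 < 1 + v by linarith), mul_zero]
        exact hΦ
      exact Integrable.const_mul this (v ^ (a - 1))
    · have h3 := (integrableOn_betaKernel h0 h1).mul_const (∫ σ in Set.Ioi (0 : ℝ), ‖Φ σ‖)
      refine h3.congr ?_
      filter_upwards [ae_restrict_mem measurableSet_Ioi] with v hv
      have hv0 : (0 : ℝ) < v := hv
      rw [← e2 v hv (fun σ => ‖Φ σ‖)]
      refine integral_congr_ae (ae_of_all _ fun s => ?_)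
      simp only [Function.uncurry_apply_pair, norm_mul]
      rw [Real.norm_of_nonneg (Real.rpow_nonneg hv0.le _)]
  rw [setIntegral_congr_fun measurableSet_Ioi e1, integral_integral_swap hint,
    setIntegral_congr_fun measurableSet_Ioi (fun v hv => e2 v hv Φ), integral_mul_const, betaConst]

end BetaKernel

/-! ### The negative fractional power controls the semigroup -/

section NegativePower

variable {X : Type u} [NormedAddCommGroup X] [InnerProductSpace ℝ X]
  {L : X →ₗ.[ℝ] X} {S : ℝ → X →L[ℝ] X} [FiniteDimensional ℝ (kerOf L)]

lemma integrableOn_rpow_mul_exp {a b : ℝ} (ha : 0 < a) (hb : 0 < b) :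
    IntegrableOn (fun t : ℝ => t ^ (a - 1) * Real.exp (-(b * t))) (Set.Ioi 0) := by
  simpa using integrableOn_rpow_mul_exp_neg_mul_rpow (s := a - 1) (p := 1) (b := b)
    (by linarith) one_pos hb

lemma OperatorAssumption.integrableOn_negPower (hL : OperatorAssumption L S) {α : ℝ}
    (hα : 0 < α) :
    IntegrableOn (fun t : ℝ => (t ^ (α - 1) * Real.exp (-t)) • S t) (Set.Ioi 0) := by
  obtain ⟨K, hK1, hK⟩ := hL.exists_bound
  have h1 : IntegrableOn (fun t : ℝ => t ^ (α - 1) * Real.exp (-t)) (Set.Ioi 0) := by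
    simpa using integrableOn_rpow_mul_exp hα one_pos
  refine Integrable.mono' (h1.mul_const K) ?_ ?_
  · exact h1.aestronglyMeasurable.smul
      (hL.continuousOn_norm.aestronglyMeasurable measurableSet_Ioi)
  · filter_upwards [ae_restrict_mem measurableSet_Ioi] with t ht
    have ht0 : (0 : ℝ) < t := ht
    rw [norm_smul, Real.norm_of_nonneg (by positivity)]
    gcongr
    exact hK t ht0.le

lemma OperatorAssumption.gamma_smul_negPower (hL : OperatorAssumption L S) {α : ℝ}
    (hα : 0 < α) (x : X) :
    Real.Gamma α • negPower S α x
      = ∫ t in Set.Ioi (0 : ℝ), (t ^ (α - 1) * Real.exp (-t)) • S t x := by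
  rw [negPower, if_neg hα.ne', smul_apply, smul_smul,
    mul_inv_cancel₀ (Real.Gamma_pos_of_pos hα).ne', one_smul,
    ContinuousLinearMap.integral_apply (hL.integrableOn_negPower hα)]
  rfl

variable [CompleteSpace X]

/-- `P_c` is unaffected by `(Id - L)^{-α}`, hence bounded on `X^{-α}`. -/
lemma OperatorAssumption.norm_projC_le_negPower (hL : OperatorAssumption L S) {α : ℝ}
    (hα : 0 ≤ α) (x : X) : ‖projC L x‖ ≤ ‖negPower S α x‖ := by
  rcases hα.eq_or_lt with rfl | hα
  · simpa [negPower] using norm_projC_le x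
  have hΓ := Real.Gamma_pos_of_pos hα
  have hi : IntegrableOn (fun t : ℝ => (t ^ (α - 1) * Real.exp (-t)) • S t x) (Set.Ioi 0) :=
    (hL.integrableOn_negPower hα).apply_continuousLinearMap x
  have h1 : Real.Gamma α • projC L (negPower S α x) = Real.Gamma α • projC L x := by
    rw [← map_smul, hL.gamma_smul_negPower hα, ← ContinuousLinearMap.integral_comp_comm _ hi,
      Real.Gamma_eq_integral hα, ← integral_smul_const]
    refine setIntegral_congr_fun measurableSet_Ioi fun t ht => ?_
    rw [map_smul, hL.projC_apply (le_of_lt ht), mul_comm]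
  rw [← smul_right_injective X hΓ.ne' h1]
  exact norm_projC_le _

/-- The smoothing estimate: `e^{tL}` maps `X^{-α}` boundedly into `X`, with a norm that is
integrable at `t = 0`. The exponent `(1 + α) / 2` is not optimal, but it is less than one.

With `J = (Id - L)^{-α}` and `Λ_τ y` the derivative of `e^{-τ} φ (e^{τL} y)` in `τ`, Fubini's theorem
and the Beta integral give
`B(α, 1 - α) e^{-t} φ (e^{tL} x) = - Γ(α) ∫₀^∞ s^{-α} Λ_{t+s} (J x) ds`,
where the derivative bound for the analytic semigroup applies to the right-hand side. -/
lemma OperatorAssumption.exists_smoothing (hL : OperatorAssumption L S) {α : ℝ}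
    (hα0 : 0 ≤ α) (hα1 : α < 1) :
    ∃ C : ℝ, 0 ≤ C ∧ ∀ (x : X) (t : ℝ), 0 < t → t ≤ 1 →
      ‖S t x‖ ≤ C * t ^ (-((1 + α) / 2)) * ‖negPower S α x‖ := by
  obtain ⟨K, hK1, hK⟩ := hL.exists_bound
  rcases hα0.eq_or_lt with rfl | hα
  · refine ⟨K, by positivity, fun x t ht ht1 => ?_⟩
    have h1 : 1 ≤ t ^ (-((1 + (0 : ℝ)) / 2)) :=
      Real.one_le_rpow_of_pos_of_le_one_of_nonpos ht ht1 (by norm_num)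
    simp only [negPower, if_true, ContinuousLinearMap.id_apply]
    calc ‖S t x‖ ≤ K * ‖x‖ := (S t).le_of_opNorm_le (hK t ht.le) x
      _ ≤ K * t ^ (-((1 + (0 : ℝ)) / 2)) * ‖x‖ := by
        gcongr
        exact le_mul_of_one_le_right (by positivity) h1
  obtain ⟨C, hC, hΛ⟩ := hL.exists_deriv_functional
  set γ : ℝ := (1 + α) / 2 with hγ
  have hB := betaConst_pos hα hα1
  have hΓ := Real.Gamma_pos_of_pos hα
  have hg1 : IntegrableOn (fun s : ℝ => s ^ ((γ - α) - 1) * Real.exp (-s)) (Set.Ioi 0) := by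
    simpa using integrableOn_rpow_mul_exp (a := γ - α) (by rw [hγ]; linarith) one_pos
  have hg2 : IntegrableOn (fun s : ℝ => s ^ ((1 - α) - 1) * Real.exp (-s)) (Set.Ioi 0) := by
    simpa using integrableOn_rpow_mul_exp (a := 1 - α) (by linarith) one_pos
  set G₁ := ∫ s in Set.Ioi (0 : ℝ), s ^ ((γ - α) - 1) * Real.exp (-s) with hG₁
  set G₂ := ∫ s in Set.Ioi (0 : ℝ), s ^ ((1 - α) - 1) * Real.exp (-s) with hG₂
  have hG₁0 : 0 ≤ G₁ := setIntegral_nonneg measurableSet_Ioi fun s hs => by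
    have : (0 : ℝ) < s := hs
    positivity
  have hG₂0 : 0 ≤ G₂ := setIntegral_nonneg measurableSet_Ioi fun s hs => by
    have : (0 : ℝ) < s := hs
    positivity
  refine ⟨Real.exp 1 * (betaConst α)⁻¹ * C * (G₁ + G₂) * Real.Gamma α, by positivity,
    fun x t ht ht1 => ?_⟩
  refine norm_le_of_forall_functional fun φ hφ => ?_
  choose! Λ hΛb hΛd using hΛ φ
  set g : ℝ → ℝ := fun r => Real.exp (-r) * φ (S r x) with hg
  have hgd : ∀ τ, 0 < τ → HasDerivAt g (Λ τ x) τ := fun τ hτ => hΛd τ hτ x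
  set Φ : ℝ → ℝ := fun σ => deriv g (t + σ) with hΦ
  have hΦm : Measurable Φ := (measurable_deriv g).comp (measurable_const.add measurable_id)
  have hΦe : ∀ σ, 0 < σ → Φ σ = Λ (t + σ) x := fun σ hσ => (hgd _ (by linarith)).deriv
  have hexp : IntegrableOn (fun σ : ℝ => Real.exp (-σ)) (Set.Ioi 0) :=
    integrableOn_exp_neg_Ioi 0
  have hΦb : ∀ σ, 0 < σ → ‖Φ σ‖ ≤ C * (t⁻¹ + 1) * ‖x‖ * Real.exp (-σ) := fun σ hσ => by
    rw [hΦe σ hσ]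
    calc ‖Λ (t + σ) x‖ ≤ (C * ((t + σ)⁻¹ + 1) * Real.exp (-(t + σ)) * ‖φ‖) * ‖x‖ :=
          (Λ (t + σ)).le_of_opNorm_le (hΛb _ (by linarith)) x
      _ ≤ (C * (t⁻¹ + 1) * Real.exp (-σ) * 1) * ‖x‖ := by
        gcongr <;> linarith
      _ = _ := by ring
  have hΦi : IntegrableOn Φ (Set.Ioi 0) := by
    refine Integrable.mono' (hexp.const_mul (C * (t⁻¹ + 1) * ‖x‖)) hΦm.aestronglyMeasurable ?_
    filter_upwards [ae_restrict_mem measurableSet_Ioi] with σ hσ using hΦb σ hσ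
  -- the fundamental theorem of calculus recovers the orbit from its derivative
  have hFTC : ∫ σ in Set.Ioi (0 : ℝ), Φ σ = -g t := by
    have hder : ∀ σ ∈ Set.Ici (0 : ℝ), HasDerivAt (fun σ => g (t + σ)) (Φ σ) σ := fun σ hσ => by
      have h1 : HasDerivAt g (Φ σ) (t + σ) := by
        have hpos : 0 < t + σ := by have : (0 : ℝ) ≤ σ := hσ; linarith
        exact (hgd _ hpos).differentiableAt.hasDerivAt
      exact h1.comp_const_add t σ
    have hlim : Tendsto (fun σ => g (t + σ)) atTop (𝓝 0) := by
      have h1 : Tendsto (fun σ : ℝ => Real.exp (-σ) * (K * ‖x‖)) atTop (𝓝 0) := by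
        simpa using (Real.tendsto_exp_neg_atTop_nhds_zero.mul_const (K * ‖x‖))
      refine squeeze_zero_norm' ?_ h1
      filter_upwards [eventually_ge_atTop 0] with σ hσ
      rw [hg, norm_mul, Real.norm_of_nonneg (Real.exp_pos _).le]
      have h2 : ‖φ (S (t + σ) x)‖ ≤ K * ‖x‖ := by
        calc ‖φ (S (t + σ) x)‖ ≤ 1 * ‖S (t + σ) x‖ := φ.le_of_opNorm_le hφ _
          _ ≤ K * ‖x‖ := by
            rw [one_mul]; exact (S _).le_of_opNorm_le (hK _ (by linarith)) x
      gcongr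
      linarith
    have := integral_Ioi_of_hasDerivAt_of_tendsto' hder hΦi hlim
    simpa using this
  -- by the semigroup law, the inner fractional integral is the derivative applied to `J x`
  have hinner : ∀ s ∈ Set.Ioi (0 : ℝ),
      s ^ (-α) * ∫ r in Set.Ioi (0 : ℝ), r ^ (α - 1) * Φ (s + r)
        = s ^ (-α) * (Real.Gamma α * Λ (t + s) (negPower S α x)) := by
    intro s hs
    have hs0 : (0 : ℝ) < s := hs
    have hi : IntegrableOn (fun t : ℝ => (t ^ (α - 1) * Real.exp (-t)) • S t x) (Set.Ioi 0) :=
      (hL.integrableOn_negPower hα).apply_continuousLinearMap x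
    congr 1
    rw [← smul_eq_mul (Real.Gamma α), ← map_smul, hL.gamma_smul_negPower hα,
      ← ContinuousLinearMap.integral_comp_comm _ hi]
    refine setIntegral_congr_fun measurableSet_Ioi fun r hr => ?_
    have hr0 : (0 : ℝ) < r := hr
    have h1 : HasDerivAt (fun τ => g (τ + r)) (Φ (s + r)) (t + s) := by
      have h2 : HasDerivAt g (Φ (s + r)) (t + s + r) := by
        rw [hΦe _ (by linarith), ← add_assoc]
        exact hgd _ (by linarith)
      exact h2.comp_add_const (t + s) r
    have h3 : HasDerivAt (fun τ => Real.exp (-r) * (Real.exp (-τ) * φ (S τ (S r x))))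
        (Real.exp (-r) * Λ (t + s) (S r x)) (t + s) :=
      (hΛd (t + s) (by linarith) (S r x)).const_mul _
    have h4 : Φ (s + r) = Real.exp (-r) * Λ (t + s) (S r x) := by
      refine h1.unique (h3.congr_of_eventuallyEq ?_)
      filter_upwards [lt_mem_nhds (show 0 < t + s by linarith)] with τ hτ
      change Real.exp (-(τ + r)) * φ (S (τ + r) x) = _
      rw [← hL.semigroup.apply_add hτ.le hr0.le, ← mul_assoc, ← Real.exp_add,
        show -(τ + r) = -r + -τ by ring]
    simp only [map_smul, smul_eq_mul, h4]
    ring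
  have hkey := integral_betaKernel hα hα1 hΦm hΦi
  rw [setIntegral_congr_fun measurableSet_Ioi hinner, hFTC] at hkey
  have hbound : ‖∫ s in Set.Ioi (0 : ℝ), s ^ (-α) * (Real.Gamma α * Λ (t + s) (negPower S α x))‖
      ≤ C * Real.Gamma α * ‖negPower S α x‖ * (t ^ (-γ) * G₁ + G₂) := by
    have h1 : C * Real.Gamma α * ‖negPower S α x‖ * (t ^ (-γ) * G₁ + G₂)
        = ∫ s in Set.Ioi (0 : ℝ), C * Real.Gamma α * ‖negPower S α x‖ *
          (t ^ (-γ) * (s ^ ((γ - α) - 1) * Real.exp (-s)) + s ^ ((1 - α) - 1) * Real.exp (-s)) := by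
      rw [integral_const_mul, integral_add (hg1.const_mul _) hg2, integral_const_mul]
    rw [h1]
    refine norm_integral_le_of_norm_le (((hg1.const_mul _).add hg2).const_mul _) ?_
    filter_upwards [ae_restrict_mem measurableSet_Ioi] with s hs
    have hs0 : (0 : ℝ) < s := hs
    have hts : 0 < t + s := by linarith
    have h2 : (t + s)⁻¹ ≤ t ^ (-γ) * s ^ (γ - 1) := by
      have h3 : t ^ γ * s ^ (1 - γ) ≤ t + s := by
        calc t ^ γ * s ^ (1 - γ) ≤ (t + s) ^ γ * (t + s) ^ (1 - γ) := by
              gcongr <;> linarith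
          _ = t + s := by rw [← Real.rpow_add hts]; simp
      have h4 : t ^ (-γ) * s ^ (γ - 1) = (t ^ γ * s ^ (1 - γ))⁻¹ := by
        rw [mul_inv, ← Real.rpow_neg ht.le, ← Real.rpow_neg hs0.le]
        congr 2; ring
      rw [h4]
      gcongr
    have h5 : ‖Λ (t + s) (negPower S α x)‖
        ≤ (C * (t ^ (-γ) * s ^ (γ - 1) + 1) * Real.exp (-s) * 1) * ‖negPower S α x‖ := by
      refine ((Λ (t + s)).le_of_opNorm_le (hΛb _ hts) _).trans ?_
      gcongr
      linarith
    rw [norm_mul, norm_mul, Real.norm_of_nonneg (by positivity : 0 ≤ s ^ (-α)),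
      Real.norm_of_nonneg hΓ.le]
    calc s ^ (-α) * (Real.Gamma α * ‖Λ (t + s) (negPower S α x)‖)
        ≤ s ^ (-α) * (Real.Gamma α * ((C * (t ^ (-γ) * s ^ (γ - 1) + 1) * Real.exp (-s) * 1)
          * ‖negPower S α x‖)) := by gcongr
      _ = _ := by
        have h6 : s ^ ((γ - α) - 1) = s ^ (γ - 1) * s ^ (-α) := by
          rw [← Real.rpow_add hs0]; congr 1; ring
        have h7 : s ^ ((1 - α) - 1) = s ^ (-α) := by congr 1; ring
        rw [h6, h7]; ring
  rw [hkey, norm_mul, Real.norm_of_nonneg hB.le, norm_neg, hg, norm_mul,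
    Real.norm_of_nonneg (Real.exp_pos _).le, Real.norm_eq_abs] at hbound
  have htγ : 1 ≤ t ^ (-γ) :=
    Real.one_le_rpow_of_pos_of_le_one_of_nonpos ht ht1 (by rw [hγ]; linarith)
  have hfin : betaConst α * (Real.exp (-1) * |φ (S t x)|)
      ≤ C * Real.Gamma α * ‖negPower S α x‖ * (t ^ (-γ) * (G₁ + G₂)) := by
    calc betaConst α * (Real.exp (-1) * |φ (S t x)|)
        ≤ betaConst α * (Real.exp (-t) * |φ (S t x)|) := by gcongr
      _ ≤ _ := hbound
      _ ≤ _ := by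
        gcongr
        rw [mul_add]
        gcongr
        exact le_mul_of_one_le_left hG₂0 htγ
  have he : |φ (S t x)| = Real.exp 1 * (betaConst α)⁻¹ *
      (betaConst α * (Real.exp (-1) * |φ (S t x)|)) := by
    have : Real.exp 1 * Real.exp (-1) = 1 := by rw [← Real.exp_add]; simp
    field_simp
    rw [mul_assoc, this, mul_one]
  rw [he]
  calc _ ≤ Real.exp 1 * (betaConst α)⁻¹ *
        (C * Real.Gamma α * ‖negPower S α x‖ * (t ^ (-γ) * (G₁ + G₂))) := by gcongr
    _ = _ := by ring

end NegativePower

/-! ### Operators on the completion `X^{-α}` and the mild formulation -/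

section Extension

variable {X : Type u} [NormedAddCommGroup X] [InnerProductSpace ℝ X]
  {L : X →ₗ.[ℝ] X} {S : ℝ → X →L[ℝ] X} {α : ℝ}

lemma norm_coe_negSpace (x : PreNeg S α) : ‖(x : NegSpace S α)‖ = ‖negPower S α x‖ := by
  rw [UniformSpace.Completion.norm_coe]; rfl

lemma negSpace_ext {T T' : NegSpace S α →L[ℝ] X} (h : ∀ x : PreNeg S α, T x = T' x)
    (y : NegSpace S α) : T y = T' y := by
  induction y using UniformSpace.Completion.induction_on with
  | hp => exact isClosed_eq T.continuous T'.continuous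
  | ih y => exact h y

variable [CompleteSpace X]

/-- A bounded operator from `‖·‖_{-α}` to `‖·‖` extends to a bounded operator on `X^{-α}`, and
`extendNeg` is that extension. -/
lemma exists_extendNeg_eq {T : X →L[ℝ] X} {c : ℝ} (hT : ∀ x, ‖T x‖ ≤ c * ‖negPower S α x‖) :
    ∃ T' : NegSpace S α →L[ℝ] X, (∀ y, extendNeg S α T y = T' y) ∧ (∀ y, ‖T' y‖ ≤ c * ‖y‖) ∧
      ∀ x : PreNeg S α, T' x = T (show X from x) := by
  let f₀ : PreNeg S α →ₗ[ℝ] X := T.toLinearMap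
  let f : PreNeg S α →L[ℝ] X := f₀.mkContinuous c hT
  have hcont : Continuous (extendNeg S α T) := UniformSpace.Completion.continuous_extension
  have hcoe : ∀ x : PreNeg S α, extendNeg S α T x = f x := fun x =>
    UniformSpace.Completion.extension_coe f.uniformContinuous x
  have hb : ∀ y, ‖extendNeg S α T y‖ ≤ c * ‖y‖ := fun y => by
    induction y using UniformSpace.Completion.induction_on with
    | hp => exact isClosed_le hcont.norm (by fun_prop)
    | ih y =>
      rw [hcoe, norm_coe_negSpace]
      exact hT y
  have hsmul : ∀ (r : ℝ) y, extendNeg S α T (r • y) = r • extendNeg S α T y := fun r y => by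
    induction y using UniformSpace.Completion.induction_on with
    | hp => exact isClosed_eq (hcont.comp (continuous_const_smul r)) (hcont.const_smul r)
    | ih y => rw [← UniformSpace.Completion.coe_smul, hcoe, hcoe, map_smul]
  let T₀ : NegSpace S α →ₗ[ℝ] X :=
    { toFun := extendNeg S α T
      map_add' := fun y z => by
        induction y, z using UniformSpace.Completion.induction_on₂ with
        | hp => exact isClosed_eq (by fun_prop) (by fun_prop)
        | ih y z => rw [← UniformSpace.Completion.coe_add, hcoe, hcoe, hcoe, map_add]
      map_smul' := hsmul }
  let T' : NegSpace S α →L[ℝ] X := ⟨T₀, hcont⟩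
  have hT' : ∀ y, extendNeg S α T y = T' y := fun y => rfl
  exact ⟨T', hT', hb, hcoe⟩

variable [FiniteDimensional ℝ (kerOf L)]

/-- The extension of `P_c` to `X^{-α}`. -/
lemma OperatorAssumption.exists_extension_projC (hL : OperatorAssumption L S) (hα0 : 0 ≤ α) :
    ∃ PC : NegSpace S α →L[ℝ] X, (∀ y, extendNeg S α (projC L) y = PC y) ∧
      (∀ x : PreNeg S α, PC x = projC L (show X from x)) ∧ ∀ y, PC y ∈ kerOf L := by
  obtain ⟨PC, h1, h2, h3⟩ := exists_extendNeg_eq (S := S) (α := α) (T := projC L) (c := 1)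
    (fun x => by rw [one_mul]; exact hL.norm_projC_le_negPower hα0 x)
  refine ⟨PC, h1, h3, fun y => ?_⟩
  have : PC y = projC L (PC y) := negSpace_ext (T' := (projC L).comp PC) (fun x => by
    rw [ContinuousLinearMap.comp_apply, h3, projC_projC]) y
  rw [this]
  exact projC_mem _

lemma OperatorAssumption.exists_norm_le_negPower (hL : OperatorAssumption L S)
    (hα0 : 0 ≤ α) (hα1 : α < 1) {t : ℝ} (ht : 0 < t) :
    ∃ c : ℝ, ∀ x, ‖S t x‖ ≤ c * ‖negPower S α x‖ := by
  obtain ⟨C, hC, h⟩ := hL.exists_smoothing hα0 hα1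
  obtain ⟨K, hK1, hK⟩ := hL.exists_bound
  have hm : 0 < min t 1 := lt_min ht one_pos
  refine ⟨K * (C * (min t 1) ^ (-((1 + α) / 2))), fun x => ?_⟩
  have h1 : S t x = S (t - min t 1) (S (min t 1) x) := by
    rw [← hL.semigroup.apply_add (by simp) hm.le, sub_add_cancel]
  rw [h1, mul_assoc]
  refine ((S _).le_of_opNorm_le (hK _ (by simp)) _).trans ?_
  gcongr
  exact h x _ hm (min_le_right _ _)

/-- The extensions of `e^{tL}`, `t > 0`, to `X^{-α}`. -/
lemma OperatorAssumption.exists_extension_semigroup (hL : OperatorAssumption L S)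
    (hα0 : 0 ≤ α) (hα1 : α < 1) {PC : NegSpace S α →L[ℝ] X}
    (hPC : ∀ x : PreNeg S α, PC x = projC L (show X from x)) :
    ∃ (E : ℝ → NegSpace S α →L[ℝ] X) (k : ℝ → ℝ),
      (∀ t, 0 < t → ∀ y, extendNeg S α (S t) y = E t y) ∧
      (∀ s t, 0 ≤ s → 0 < t → ∀ y, E (s + t) y = S s (E t y)) ∧
      (∀ t, 0 < t → ∀ y, projC L (E t y) = PC y) ∧
      (∀ t, 0 < t → 0 ≤ k t) ∧ IntegrableOn k (Set.Ioi 0) ∧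
      ∀ t, 0 < t → ∀ y, ‖projS L (E t y)‖ ≤ k t * ‖y‖ := by
  obtain ⟨C, hC, hsm⟩ := hL.exists_smoothing hα0 hα1
  obtain ⟨M, μ, hM, hμ, hdec⟩ := hL.exists_decay
  have hex : ∀ t : ℝ, ∃ E : NegSpace S α →L[ℝ] X, 0 < t →
      (∀ y, extendNeg S α (S t) y = E y) ∧ ∀ x : PreNeg S α, E x = S t (show X from x) := by
    intro t
    by_cases ht : 0 < t
    · obtain ⟨c, hc⟩ := hL.exists_norm_le_negPower hα0 hα1 ht
      obtain ⟨E, h1, -, h3⟩ := exists_extendNeg_eq hc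
      exact ⟨E, fun _ => ⟨h1, h3⟩⟩
    · exact ⟨0, fun h => absurd h ht⟩
  choose E hE using hex
  set γ : ℝ := (1 + α) / 2 with hγ
  have hEsem : ∀ s t, 0 ≤ s → 0 < t → ∀ y, E (s + t) y = S s (E t y) := fun s t hs ht y =>
    negSpace_ext (T' := (S s).comp (E t)) (fun x => by
      rw [(hE _ (by linarith)).2, ContinuousLinearMap.comp_apply, (hE t ht).2,
        hL.semigroup.apply_add hs ht.le]) y
  have hEC : ∀ t, 0 < t → ∀ y, projC L (E t y) = PC y := fun t ht y =>
    negSpace_ext (T := (projC L).comp (E t)) (fun x => by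
      rw [ContinuousLinearMap.comp_apply, (hE t ht).2, hL.projC_apply ht.le, hPC]) y
  have hEb : ∀ t, 0 < t → t ≤ 1 → ∀ y, ‖E t y‖ ≤ C * t ^ (-γ) * ‖y‖ := fun t ht ht1 y => by
    induction y using UniformSpace.Completion.induction_on with
    | hp => exact isClosed_le (by fun_prop) (by fun_prop)
    | ih y =>
      rw [(hE t ht).2, norm_coe_negSpace]
      exact hsm y t ht ht1
  refine ⟨E, fun t => 2 * C * M * Real.exp μ * ((t ^ (((1 - α) / 2) - 1) * Real.exp (-(μ * t)))
    + t ^ ((1 : ℝ) - 1) * Real.exp (-(μ * t))), fun t ht => (hE t ht).1, hEsem, hEC, ?_, ?_, ?_⟩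
  · intro t ht
    positivity
  · exact ((integrableOn_rpow_mul_exp (by linarith) hμ).add
      (integrableOn_rpow_mul_exp one_pos hμ)).const_mul _
  · intro t ht y
    have e1 : ((1 - α) / 2) - 1 = -γ := by rw [hγ]; ring
    simp only [e1, sub_self, Real.rpow_zero, one_mul]
    rcases le_or_gt t 1 with h1 | h1
    · have h2 : 1 ≤ Real.exp μ * Real.exp (-(μ * t)) := by
        rw [← Real.exp_add]; apply Real.one_le_exp; nlinarith
      calc ‖projS L (E t y)‖ ≤ 2 * ‖E t y‖ := norm_projS_le _
        _ ≤ 2 * (C * t ^ (-γ) * ‖y‖) := by gcongr; exact hEb t ht h1 y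
        _ = 2 * C * t ^ (-γ) * ‖y‖ * 1 * 1 := by ring
        _ ≤ 2 * C * t ^ (-γ) * ‖y‖ * M * (Real.exp μ * Real.exp (-(μ * t))) := by gcongr
        _ = 2 * C * M * Real.exp μ * (t ^ (-γ) * Real.exp (-(μ * t)) + 0) * ‖y‖ := by ring
        _ ≤ _ := by gcongr; positivity
    · have h2 : E t y = S (t - 1) (E 1 y) := by
        rw [← hEsem _ _ (by linarith) one_pos, sub_add_cancel]
      have h3 : ‖E 1 y‖ ≤ C * ‖y‖ := by simpa using hEb 1 one_pos le_rfl y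
      have h4 : Real.exp (-((t - 1) * μ)) = Real.exp μ * Real.exp (-(μ * t)) := by
        rw [← Real.exp_add]; congr 1; ring
      calc ‖projS L (E t y)‖ ≤ M * Real.exp (-((t - 1) * μ)) * ‖E 1 y‖ := by
            rw [h2, hL.projS_apply_comm (by linarith)]
            exact hdec _ (by linarith) _
        _ ≤ M * (Real.exp μ * Real.exp (-(μ * t))) * (C * ‖y‖) := by rw [h4]; gcongr
        _ = 1 * C * M * Real.exp μ * (0 + Real.exp (-(μ * t))) * ‖y‖ := by ring
        _ ≤ _ := by
          gcongr
          · norm_num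
          · positivity

/-- The two spectral components of the mild convolution with a continuous `X^{-α}`-valued
function: the `P_c`-part is a plain integral, the `P_s`-part is bounded uniformly in time. -/
lemma OperatorAssumption.exists_mild_bound (hL : OperatorAssumption L S)
    (hα0 : 0 ≤ α) (hα1 : α < 1) {PC : NegSpace S α →L[ℝ] X}
    (hPC : ∀ x : PreNeg S α, PC x = projC L (show X from x)) :
    ∃ K : ℝ, 0 ≤ K ∧ ∀ (t : ℝ), 0 < t → ∀ (ξ : ℝ → NegSpace S α),
      ContinuousOn ξ (Set.Icc 0 t) →
      (projC L (∫ τ in (0 : ℝ)..t, extendNeg S α (S (t - τ)) (ξ τ))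
        = ∫ τ in (0 : ℝ)..t, PC (ξ τ)) ∧
      ∀ m : ℝ, (∀ τ ∈ Set.Icc 0 t, ‖ξ τ‖ ≤ m) →
        ‖projS L (∫ τ in (0 : ℝ)..t, extendNeg S α (S (t - τ)) (ξ τ))‖ ≤ K * m := by
  obtain ⟨E, k, hE, hEs, hEC, hk0, hki, hkb⟩ := hL.exists_extension_semigroup hα0 hα1 hPC
  refine ⟨∫ s in Set.Ioi (0 : ℝ), k s, setIntegral_nonneg measurableSet_Ioi hk0, ?_⟩
  intro t ht ξ hξ
  have hio : Set.Ioo (0 : ℝ) t =ᵐ[volume] Set.uIoc 0 t := by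
    rw [Set.uIoc_of_le ht.le]; exact Ioo_ae_eq_Ioc
  have hcongr : ∀ f g : ℝ → X, (∀ τ ∈ Set.Ioo 0 t, f τ = g τ) →
      ∫ τ in (0 : ℝ)..t, f τ = ∫ τ in (0 : ℝ)..t, g τ := fun f g h => by
    rw [intervalIntegral.integral_of_le ht.le, intervalIntegral.integral_of_le ht.le,
      integral_Ioc_eq_integral_Ioo, integral_Ioc_eq_integral_Ioo]
    exact setIntegral_congr_fun measurableSet_Ioo h
  have hcont : ContinuousOn (fun τ => E (t - τ) (ξ τ)) (Set.Ioo 0 t) := by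
    intro τ₀ hτ₀
    set s₀ := (t - τ₀) / 2 with hs₀
    have hs0 : 0 < s₀ := by have := hτ₀.2; rw [hs₀]; linarith
    have h1 : ContinuousOn (fun τ => S (t - τ - s₀) (E s₀ (ξ τ))) (Set.Ioo 0 (t - s₀)) := by
      refine ContinuousOn.clm_apply ?_ ?_
      · refine hL.continuousOn_norm.comp (by fun_prop) fun τ hτ => ?_
        have := hτ.2
        exact Set.mem_Ioi.2 (by linarith)
      · exact (E s₀).continuous.comp_continuousOn
          (hξ.mono fun τ hτ => ⟨hτ.1.le, by have := hτ.2; linarith⟩)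
    have hmem : Set.Ioo 0 (t - s₀) ∈ 𝓝 τ₀ := Ioo_mem_nhds hτ₀.1 (by rw [hs₀]; linarith [hτ₀.2])
    refine ((h1.continuousAt hmem).congr ?_).continuousWithinAt
    filter_upwards [hmem] with τ hτ
    rw [← hEs _ _ (by linarith [hτ.2]) hs0, sub_add_cancel]
  have hkint : IntervalIntegrable (fun τ => k (t - τ)) volume 0 t := by
    have : IntervalIntegrable k volume 0 t := by
      rw [intervalIntegrable_iff_integrableOn_Ioc_of_le ht.le]
      exact hki.mono_set Set.Ioc_subset_Ioi_self
    simpa using (this.comp_sub_left t).symm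
  obtain ⟨m₀, hm₀⟩ := (isCompact_Icc.image_of_continuousOn hξ.norm).bddAbove
  have hm₀' : ∀ τ ∈ Set.Icc 0 t, ‖ξ τ‖ ≤ m₀ := fun τ hτ => hm₀ ⟨τ, hτ, rfl⟩
  have hint : IntervalIntegrable (fun τ => E (t - τ) (ξ τ)) volume 0 t := by
    have h1 : IntervalIntegrable (fun τ => (‖PC‖ + k (t - τ)) * m₀) volume 0 t :=
      ((intervalIntegrable_const).add hkint).mul_const _
    rw [intervalIntegrable_iff_integrableOn_Ioo_of_le ht.le] at h1 ⊢
    refine Integrable.mono' h1 (hcont.aestronglyMeasurable measurableSet_Ioo) ?_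
    filter_upwards [ae_restrict_mem measurableSet_Ioo] with τ hτ
    have hτ' : 0 < t - τ := by linarith [hτ.2]
    have h0 : 0 ≤ k (t - τ) := hk0 _ hτ'
    rw [← projC_add_projS (L := L) (E (t - τ) (ξ τ)), hEC _ hτ']
    calc ‖PC (ξ τ) + projS L (E (t - τ) (ξ τ))‖ ≤ ‖PC‖ * ‖ξ τ‖ + k (t - τ) * ‖ξ τ‖ :=
          (norm_add_le _ _).trans (add_le_add (PC.le_opNorm _) (hkb _ hτ' _))
      _ = (‖PC‖ + k (t - τ)) * ‖ξ τ‖ := by ring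
      _ ≤ _ := by gcongr; exact hm₀' τ ⟨hτ.1.le, hτ.2.le⟩
  have hIe : ∫ τ in (0 : ℝ)..t, extendNeg S α (S (t - τ)) (ξ τ)
      = ∫ τ in (0 : ℝ)..t, E (t - τ) (ξ τ) :=
    hcongr _ _ fun τ hτ => hE _ (by linarith [hτ.2]) _
  rw [hIe]
  refine ⟨?_, fun m hm => ?_⟩
  · rw [← ContinuousLinearMap.intervalIntegral_comp_comm _ hint]
    exact hcongr _ _ fun τ hτ => hEC _ (by linarith [hτ.2]) _
  · rw [← ContinuousLinearMap.intervalIntegral_comp_comm _ hint]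
    have hm0 : 0 ≤ m := (norm_nonneg _).trans (hm 0 ⟨le_rfl, ht.le⟩)
    have h1 : ‖∫ τ in (0 : ℝ)..t, projS L (E (t - τ) (ξ τ))‖ ≤ ∫ τ in (0 : ℝ)..t, k (t - τ) * m := by
      rw [intervalIntegral.integral_of_le ht.le, intervalIntegral.integral_of_le ht.le,
        integral_Ioc_eq_integral_Ioo, integral_Ioc_eq_integral_Ioo]
      refine norm_integral_le_of_norm_le ?_ ?_
      · exact (intervalIntegrable_iff_integrableOn_Ioo_of_le ht.le).1 (hkint.mul_const m)
      · filter_upwards [ae_restrict_mem measurableSet_Ioo] with τ hτ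
        have hτ' : 0 < t - τ := by linarith [hτ.2]
        have h0 : 0 ≤ k (t - τ) := hk0 _ hτ'
        refine (hkb _ hτ' _).trans ?_
        gcongr
        exact hm τ ⟨hτ.1.le, hτ.2.le⟩
    refine h1.trans ?_
    rw [intervalIntegral.integral_mul_const]
    gcongr
    rw [intervalIntegral.integral_comp_sub_left (fun s => k s) t, sub_self, sub_zero,
      intervalIntegral.integral_of_le ht.le]
    refine setIntegral_mono_set hki ?_ Set.Ioc_subset_Ioi_self.eventuallyLE
    filter_upwards [ae_restrict_mem measurableSet_Ioi] with s hs using hk0 s hs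

end Extension

/-! ### The inverse of the stable part of the generator -/

section StableInverse

variable {X : Type u} [NormedAddCommGroup X] [InnerProductSpace ℝ X]
  {L : X →ₗ.[ℝ] X} {S : ℝ → X →L[ℝ] X} [FiniteDimensional ℝ (kerOf L)]

/-- The semigroup, continued by the identity to negative times, is jointly continuous. -/
lemma OperatorAssumption.continuous_joint (hL : OperatorAssumption L S) :
    Continuous fun p : ℝ × X => S (max p.1 0) p.2 := by
  obtain ⟨K, hK1, hK⟩ := hL.exists_bound
  rw [continuous_iff_continuousAt]
  rintro ⟨t, x⟩
  have h1 : Continuous fun s : ℝ => S (max s 0) x :=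
    (hL.semigroup.continuous x).comp_continuous (by fun_prop)
      (fun s => Set.mem_Ici.2 (le_max_right _ _))
  have h2 : Continuous fun p : ℝ × X => K * ‖p.2 - x‖ + ‖S (max p.1 0) x - S (max t 0) x‖ := by
    have h3 : Continuous fun p : ℝ × X => S (max p.1 0) x := h1.comp continuous_fst
    exact (continuous_const.mul (continuous_snd.sub continuous_const).norm).add
      (h3.sub continuous_const).norm
  rw [ContinuousAt, tendsto_iff_norm_sub_tendsto_zero]
  refine squeeze_zero (fun _ => norm_nonneg _) (fun p => ?_) (by simpa using h2.tendsto (t, x))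
  calc ‖S (max p.1 0) p.2 - S (max t 0) x‖
      = ‖S (max p.1 0) (p.2 - x) + (S (max p.1 0) x - S (max t 0) x)‖ := by
        rw [map_sub]; congr 1; abel
    _ ≤ ‖S (max p.1 0) (p.2 - x)‖ + ‖S (max p.1 0) x - S (max t 0) x‖ := norm_add_le _ _
    _ ≤ _ := by
      gcongr
      exact (S _).le_of_opNorm_le (hK _ (le_max_right _ _)) _

/-- An operator `R` that inverts `-L` on the range of `P_s` and vanishes on the kernel of `L`,
expressed through the semigroup only. -/
structure IsStableInverse (L : X →ₗ.[ℝ] X) [FiniteDimensional ℝ (kerOf L)] (S : ℝ → X →L[ℝ] X)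
    (R : X →L[ℝ] X) : Prop where
  sub_apply : ∀ (x : X) (t : ℝ), 0 ≤ t → R x - R (S t x) = ∫ τ in (0 : ℝ)..t, S τ (projS L x)
  comp_projS : ∀ x, R (projS L x) = R x
  injective : ∀ x, R x = 0 → projS L x = 0

lemma OperatorAssumption.integrableOn_stable (hL : OperatorAssumption L S) :
    IntegrableOn (fun τ : ℝ => (S τ).comp (projS L)) (Set.Ioi 0) := by
  obtain ⟨M, μ, hM, hμ, h⟩ := hL.stable
  have h1 : IntegrableOn (fun t : ℝ => M * Real.exp (-(t * μ))) (Set.Ioi 0) := by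
    have h2 := (integrableOn_rpow_mul_exp one_pos hμ).const_mul M
    simp only [sub_self, Real.rpow_zero, one_mul, mul_comm μ] at h2
    exact h2
  refine Integrable.mono' h1
    ((hL.continuousOn_norm.clm_comp continuousOn_const).aestronglyMeasurable measurableSet_Ioi) ?_
  filter_upwards [ae_restrict_mem measurableSet_Ioi] with t ht using h t (le_of_lt ht)

lemma IsStableInverse.apply_sub_apply {R : X →L[ℝ] X} (hL : OperatorAssumption L S)
    (hR : IsStableInverse L S R) (x : X) {s t : ℝ} (hs : 0 ≤ s) (hst : s ≤ t) :
    R (S s x) - R (S t x) = ∫ τ in s..t, S (max τ 0) (projS L x) := by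
  have hc : Continuous fun τ => S (max τ 0) (projS L x) :=
    hL.continuous_joint.comp (Continuous.prodMk continuous_id continuous_const)
  have h : ∀ r, 0 ≤ r → R x - R (S r x) = ∫ τ in (0 : ℝ)..r, S (max τ 0) (projS L x) :=
    fun r hr => by
      rw [hR.sub_apply x r hr]
      refine intervalIntegral.integral_congr fun τ hτ => ?_
      rw [Set.uIcc_of_le hr] at hτ
      simp only [max_eq_left hτ.1]
  rw [← intervalIntegral.integral_interval_sub_left (hc.intervalIntegrable 0 t)
    (hc.intervalIntegrable 0 s), ← h t (hs.trans hst), ← h s hs]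
  abel

lemma OperatorAssumption.continuous_stableKernel (hL : OperatorAssumption L S) {w : ℝ → X}
    (hw : Continuous w) :
    Continuous (Function.uncurry fun σ τ : ℝ => S (max (σ - τ) 0) (projS L (w τ))) :=
  hL.continuous_joint.comp (Continuous.prodMk (by fun_prop)
    ((projS L).continuous.comp (hw.comp continuous_snd)))

variable [CompleteSpace X]

/-- By exponential stability, `R = ∫₀^∞ e^{τL} P_s dτ` converges in operator norm. -/
lemma OperatorAssumption.exists_stableInverse (hL : OperatorAssumption L S) :
    ∃ R : X →L[ℝ] X, IsStableInverse L S R := by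
  set R : X →L[ℝ] X := ∫ τ in Set.Ioi (0 : ℝ), (S τ).comp (projS L) with hR
  have hi : ∀ x, IntegrableOn (fun τ : ℝ => S τ (projS L x)) (Set.Ioi 0) := fun x =>
    hL.integrableOn_stable.apply_continuousLinearMap x
  have hRx : ∀ x, R x = ∫ τ in Set.Ioi (0 : ℝ), S τ (projS L x) := fun x => by
    rw [hR, ContinuousLinearMap.integral_apply hL.integrableOn_stable]
    rfl
  have hRS : ∀ x t, 0 ≤ t → R (S t x) = ∫ τ in Set.Ioi t, S τ (projS L x) := fun x t ht => by
    rw [hRx, ← (measurePreserving_add_right volume t).setIntegral_preimage_emb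
      (measurableEmbedding_addRight t) (fun τ => S τ (projS L x)) (Set.Ioi t)]
    simp only [Set.preimage_add_const_Ioi, sub_self]
    refine setIntegral_congr_fun measurableSet_Ioi fun τ hτ => ?_
    rw [hL.projS_apply_comm ht, hL.semigroup.apply_add (le_of_lt hτ) ht]
  have hsub : ∀ (x : X) (t : ℝ), 0 ≤ t →
      R x - R (S t x) = ∫ τ in (0 : ℝ)..t, S τ (projS L x) := fun x t ht => by
    rw [hRx, hRS x t ht, intervalIntegral.integral_Ioi_sub_Ioi (hi x) ht]
  refine ⟨R, hsub, fun x => by rw [hRx, hRx, projS_projS], fun x hx => ?_⟩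
  -- `R` commutes with the semigroup, so all orbit averages of `P_s x` vanish
  have hcomm : ∀ t, 0 ≤ t → R (S t x) = 0 := fun t ht => by
    have h1 : R (S t x) = S t (R x) := by
      rw [hRx, hRx, ← ContinuousLinearMap.integral_comp_comm _ (hi x)]
      refine setIntegral_congr_fun measurableSet_Ioi fun τ hτ => ?_
      rw [hL.projS_apply_comm ht, ← hL.semigroup.apply_add (le_of_lt hτ) ht, add_comm,
        hL.semigroup.apply_add ht (le_of_lt hτ)]
    rw [h1, hx, map_zero]
  have hz : ∀ t, 0 ≤ t → ∫ τ in (0 : ℝ)..t, S (max τ 0) (projS L x) = 0 := fun t ht => by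
    have h1 := hsub x t ht
    rw [hx, hcomm t ht, sub_zero] at h1
    rw [h1]
    refine intervalIntegral.integral_congr fun τ hτ => ?_
    rw [Set.uIcc_of_le ht] at hτ
    simp only [max_eq_left hτ.1]
  have hc : Continuous fun τ => S (max τ 0) (projS L x) :=
    hL.continuous_joint.comp (Continuous.prodMk continuous_id continuous_const)
  have hd : HasDerivAt (fun t => ∫ τ in (0 : ℝ)..t, S (max τ 0) (projS L x))
      (S (max 0 0) (projS L x)) 0 :=
    intervalIntegral.integral_hasDerivAt_right (hc.intervalIntegrable _ _)
      hc.stronglyMeasurable.stronglyMeasurableAtFilter hc.continuousAt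
  have hd0 : HasDerivWithinAt (fun t => ∫ τ in (0 : ℝ)..t, S (max τ 0) (projS L x)) 0
      (Set.Ici 0) 0 :=
    (hasDerivWithinAt_const (0 : ℝ) (Set.Ici 0) (0 : X)).congr (fun t ht => hz t ht) (hz 0 le_rfl)
  have := (uniqueDiffWithinAt_Ici (0 : ℝ)).eq_deriv _ hd.hasDerivWithinAt hd0
  rwa [max_self, hL.semigroup.zero_apply] at this

end StableInverse

/-! ### Pathwise analysis of the convolution with the stable semigroup -/

section PathwiseConvolution

/-- Fubini's theorem on a triangle. -/
lemma integral_integral_triangle {X : Type u} [NormedAddCommGroup X] [NormedSpace ℝ X]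
    {k : ℝ → ℝ → X} (hk : Continuous (Function.uncurry k)) {t : ℝ} (ht : 0 ≤ t) :
    ∫ τ in (0 : ℝ)..t, ∫ σ in τ..t, k σ τ = ∫ σ in (0 : ℝ)..t, ∫ τ in (0 : ℝ)..σ, k σ τ := by
  set ν := (volume : Measure ℝ).restrict (Set.Ioc 0 t) with hν
  set F : ℝ → ℝ → X := fun τ σ => Set.indicator {p : ℝ × ℝ | p.1 < p.2} (fun p => k p.2 p.1) (τ, σ)
    with hF
  have hint : Integrable (Function.uncurry F) (ν.prod ν) := by
    have h1 : IntegrableOn (fun p : ℝ × ℝ => k p.2 p.1) (Set.Icc 0 t ×ˢ Set.Icc 0 t)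
        ((volume : Measure ℝ).prod volume) := by
      refine ContinuousOn.integrableOn_compact (isCompact_Icc.prod isCompact_Icc) ?_
      exact (hk.comp continuous_swap).continuousOn
    have h2 : Integrable (fun p : ℝ × ℝ => k p.2 p.1) (ν.prod ν) := by
      rw [hν, Measure.prod_restrict]
      exact h1.mono_set (Set.prod_mono Set.Ioc_subset_Icc_self Set.Ioc_subset_Icc_self)
    exact h2.indicator (measurableSet_lt measurable_fst measurable_snd)
  have hsw := integral_integral_swap hint
  have e1 : ∫ τ in (0 : ℝ)..t, ∫ σ in τ..t, k σ τ = ∫ τ, ∫ σ, F τ σ ∂ν ∂ν := by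
    rw [intervalIntegral.integral_of_le ht]
    refine setIntegral_congr_fun measurableSet_Ioc fun τ hτ => ?_
    have h3 : (fun σ => F τ σ) = Set.indicator (Set.Ioi τ) (fun σ => k σ τ) := by
      ext σ
      simp [hF, Set.indicator_apply]
    rw [h3, integral_indicator measurableSet_Ioi, hν, Measure.restrict_restrict measurableSet_Ioi,
      intervalIntegral.integral_of_le hτ.2]
    congr 2
    ext σ
    simp only [Set.mem_Ioc, Set.mem_inter_iff, Set.mem_Ioi]
    have := hτ.1
    constructor
    · rintro ⟨h1, h2⟩; exact ⟨h1, by linarith, h2⟩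
    · rintro ⟨h1, h2, h4⟩; exact ⟨h1, h4⟩
  have e2 : ∫ σ in (0 : ℝ)..t, ∫ τ in (0 : ℝ)..σ, k σ τ = ∫ σ, ∫ τ, F τ σ ∂ν ∂ν := by
    rw [intervalIntegral.integral_of_le ht]
    refine setIntegral_congr_fun measurableSet_Ioc fun σ hσ => ?_
    have h3 : (fun τ => F τ σ) = Set.indicator (Set.Iio σ) (fun τ => k σ τ) := by
      ext τ
      simp [hF, Set.indicator_apply]
    rw [h3, integral_indicator measurableSet_Iio, hν, Measure.restrict_restrict measurableSet_Iio,
      intervalIntegral.integral_of_le hσ.1.le, integral_Ioc_eq_integral_Ioo]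
    congr 2
    ext τ
    simp only [Set.mem_Ioc, Set.mem_inter_iff, Set.mem_Iio, Set.mem_Ioo]
    have := hσ.2
    constructor
    · rintro ⟨h1, h2⟩; exact ⟨h2, h1, by linarith⟩
    · rintro ⟨h1, h2, h4⟩; exact ⟨h2, h1⟩
  rw [e1, e2, hsw]

variable {X : Type u} [NormedAddCommGroup X] [InnerProductSpace ℝ X]
  {L : X →ₗ.[ℝ] X} {S : ℝ → X →L[ℝ] X} [FiniteDimensional ℝ (kerOf L)]

/-- The convolution `∫₀ᵗ e^{(t-τ)L} P_s w(τ) dτ`; the truncation only extends the integrand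
continuously beyond `τ ≤ t`. -/
def stableConv (L : X →ₗ.[ℝ] X) [FiniteDimensional ℝ (kerOf L)] (S : ℝ → X →L[ℝ] X)
    (w : ℝ → X) (t : ℝ) : X :=
  ∫ τ in (0 : ℝ)..t, S (max (t - τ) 0) (projS L (w τ))

lemma OperatorAssumption.continuous_stableConv (hL : OperatorAssumption L S) {w : ℝ → X}
    (hw : Continuous w) : Continuous (stableConv L S w) :=
  intervalIntegral.continuous_parametric_intervalIntegral_of_continuous
    (hL.continuous_stableKernel hw) continuous_id

/-- Summation by parts: after applying `R`, the Riemann sums of the stochastic convolution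
converge for every continuous path. -/
lemma IsStableInverse.tendsto_riemannSum {R : X →L[ℝ] X} (hL : OperatorAssumption L S)
    (hR : IsStableInverse L S R) {w : ℝ → X} (hw : Continuous w) (hw0 : w 0 = 0) {t : ℝ}
    (ht : 0 ≤ t) :
    Tendsto (fun n : ℕ => R (∑ i ∈ Finset.range n,
      S (t - (i : ℝ) * t / n) (w (((i : ℝ) + 1) * t / n) - w ((i : ℝ) * t / n)))) atTop
      (𝓝 (R (w t) - stableConv L S w t)) := by
  obtain ⟨K, hK1, hK⟩ := hL.exists_bound
  have hker := hL.continuous_stableKernel hw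
  have hk : ∀ x : X, Continuous fun τ => S (max (t - τ) 0) (projS L x) := fun x =>
    hL.continuous_joint.comp (Continuous.prodMk (by fun_prop) continuous_const)
  have hkw : Continuous fun τ => S (max (t - τ) 0) (projS L (w τ)) :=
    hker.comp (Continuous.prodMk continuous_const continuous_id)
  rw [Metric.tendsto_atTop]
  intro ε hε
  have huc := isCompact_Icc.uniformContinuousOn_of_continuous (hw.continuousOn (s := Set.Icc 0 t))
  obtain ⟨δ, hδ, hδw⟩ := Metric.uniformContinuousOn_iff.1 huc (ε / (2 * K * (t + 1))) (by positivity)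
  obtain ⟨N, hN⟩ := exists_nat_gt (t / δ)
  refine ⟨N + 1, fun n hn => ?_⟩
  have hn0 : (0 : ℝ) < n := by
    have : 0 < n := by omega
    exact_mod_cast this
  have hNn : (N : ℝ) + 1 ≤ n := by exact_mod_cast hn
  have htn : t / n < δ := by
    rw [div_lt_iff₀ hδ] at hN
    rw [div_lt_iff₀ hn0]
    nlinarith
  set p : ℕ → ℝ := fun i => (i : ℝ) * t / n with hp
  have hp1 : ∀ i : ℕ, ((i : ℝ) + 1) * t / n = p (i + 1) := fun i => by simp [hp]
  have hp0 : p 0 = 0 := by simp [hp]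
  have hpn : p n = t := by simp only [hp]; field_simp
  have hpd : ∀ i, p (i + 1) - p i = t / n := fun i => by simp only [hp]; push_cast; ring
  have hpm : ∀ i, p i ≤ p (i + 1) := fun i => by
    have := hpd i; have : 0 ≤ t / n := by positivity
    linarith
  have hpmono : Monotone p := monotone_nat_of_le_succ hpm
  have hpnn : ∀ i, 0 ≤ p i := fun i => by rw [← hp0]; exact hpmono (Nat.zero_le i)
  have hpt : ∀ i, i ≤ n → p i ≤ t := fun i hi => by rw [← hpn]; exact hpmono hi
  -- Abel summation, written as a telescoping sum
  have e1 : R (∑ i ∈ Finset.range n, S (t - p i) (w (p (i + 1)) - w (p i)))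
      = R (w t) - ∑ i ∈ Finset.range n, ∫ τ in p i..p (i + 1),
          S (max (t - τ) 0) (projS L (w (p (i + 1)))) := by
    have h1 : ∑ i ∈ Finset.range n, (R (S (t - p (i + 1)) (w (p (i + 1)))) -
        R (S (t - p i) (w (p i)))) = R (w t) := by
      rw [Finset.sum_range_sub (fun i => R (S (t - p i) (w (p i)))), hpn, hp0, hw0, sub_self,
        hL.semigroup.zero_apply, map_zero, map_zero, sub_zero]
    rw [← h1, map_sum, ← Finset.sum_sub_distrib]
    refine Finset.sum_congr rfl fun i hi => ?_
    have hin : i + 1 ≤ n := Finset.mem_range.1 hi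
    have h2 := hR.apply_sub_apply hL (w (p (i + 1))) (s := t - p (i + 1)) (t := t - p i)
      (sub_nonneg.2 (hpt _ hin)) (by linarith [hpm i])
    rw [intervalIntegral.integral_comp_sub_left
      (fun τ => S (max τ 0) (projS L (w (p (i + 1))))) t, ← h2, map_sub, map_sub]
    abel
  have e2 : stableConv L S w t = ∑ i ∈ Finset.range n, ∫ τ in p i..p (i + 1),
      S (max (t - τ) 0) (projS L (w τ)) := by
    rw [intervalIntegral.sum_integral_adjacent_intervals
      (fun k _ => hkw.intervalIntegrable _ _), hp0, hpn, stableConv]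
  have e3 : ∀ i ∈ Finset.range n, ‖(∫ τ in p i..p (i + 1), S (max (t - τ) 0) (projS L (w τ)))
      - ∫ τ in p i..p (i + 1), S (max (t - τ) 0) (projS L (w (p (i + 1))))‖
        ≤ K * (2 * (ε / (2 * K * (t + 1)))) * (t / n) := by
    intro i hi
    have hin : i + 1 ≤ n := Finset.mem_range.1 hi
    rw [← intervalIntegral.integral_sub (hkw.intervalIntegrable _ _)
      ((hk _).intervalIntegrable _ _), ← hpd i, ← abs_of_nonneg (sub_nonneg.2 (hpm i))]
    refine intervalIntegral.norm_integral_le_of_norm_le_const fun τ hτ => ?_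
    rw [Set.uIoc_of_le (hpm i)] at hτ
    rw [← map_sub, ← map_sub]
    refine ((S _).le_of_opNorm_le (hK _ (le_max_right _ _)) _).trans ?_
    gcongr
    refine (norm_projS_le _).trans ?_
    gcongr
    rw [← dist_eq_norm]
    refine (hδw τ ⟨(hpnn i).trans hτ.1.le, hτ.2.trans (hpt _ hin)⟩ _ ⟨hpnn _, hpt _ hin⟩ ?_).le
    rw [Real.dist_eq, abs_sub_comm, abs_of_nonneg (sub_nonneg.2 hτ.2)]
    have := hpd i
    linarith [hτ.1]
  simp only [hp1]
  change dist (R (∑ i ∈ Finset.range n, S (t - p i) (w (p (i + 1)) - w (p i)))) _ < ε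
  rw [e1, dist_eq_norm, e2, sub_sub_sub_cancel_left, ← Finset.sum_sub_distrib]
  refine (norm_sum_le_of_le _ e3).trans_lt ?_
  rw [Finset.sum_const, Finset.card_range, nsmul_eq_mul]
  have e4 : (n : ℝ) * (K * (2 * (ε / (2 * K * (t + 1)))) * (t / n)) = ε * (t / (t + 1)) := by
    field_simp
  rw [e4]
  have : t / (t + 1) < 1 := by rw [div_lt_one (by linarith)]; linarith
  nlinarith

variable [CompleteSpace X]

lemma OperatorAssumption.projS_stableConv (hL : OperatorAssumption L S) {w : ℝ → X}
    (hw : Continuous w) (t : ℝ) : projS L (stableConv L S w t) = stableConv L S w t := by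
  have hc : Continuous fun τ => S (max (t - τ) 0) (projS L (w τ)) :=
    (hL.continuous_stableKernel hw).comp (Continuous.prodMk continuous_const continuous_id)
  rw [stableConv, ← ContinuousLinearMap.intervalIntegral_comp_comm _ (hc.intervalIntegrable _ _)]
  refine intervalIntegral.integral_congr fun τ _ => ?_
  rw [hL.projS_apply_comm (le_max_right _ _), projS_projS]

/-- If `R z = R w - ∫₀ᵗ e^{(t-τ)L} P_s w(τ) dτ`, then the primitive of `P_s z` is `R (w - z)`. -/
lemma IsStableInverse.integral_projS {R : X →L[ℝ] X} (hL : OperatorAssumption L S)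
    (hR : IsStableInverse L S R) {w z : ℝ → X} (hw : Continuous w) (hz : Continuous z)
    (h : ∀ t, 0 ≤ t → R (z t) = R (w t) - stableConv L S w t) {t : ℝ} (ht : 0 ≤ t) :
    ∫ τ in (0 : ℝ)..t, projS L (z τ) = R (w t - z t) := by
  set Y := stableConv L S w with hY
  have hYc : Continuous Y := hL.continuous_stableConv hw
  have hker := hL.continuous_stableKernel hw
  have hzs : Continuous fun τ => projS L (z τ) := (projS L).continuous.comp hz
  have e1 : R (Y t) = ∫ τ in (0 : ℝ)..t, R (S (max (t - τ) 0) (w τ)) := by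
    have hc : Continuous fun τ => S (max (t - τ) 0) (projS L (w τ)) :=
      hker.comp (Continuous.prodMk continuous_const continuous_id)
    rw [hY, stableConv, ← ContinuousLinearMap.intervalIntegral_comp_comm _
      (hc.intervalIntegrable _ _)]
    refine intervalIntegral.integral_congr fun τ _ => ?_
    rw [← hL.projS_apply_comm (le_max_right _ _), hR.comp_projS]
  have hRSc : Continuous fun τ => R (S (max (t - τ) 0) (w τ)) :=
    R.continuous.comp (hL.continuous_joint.comp (Continuous.prodMk (by fun_prop) hw))
  have hRw : Continuous fun τ => R (w τ) := R.continuous.comp hw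
  have e2 : ∫ σ in (0 : ℝ)..t, Y σ = (∫ τ in (0 : ℝ)..t, R (w τ)) - R (Y t) := by
    rw [e1, ← intervalIntegral.integral_sub (hRw.intervalIntegrable _ _)
      (hRSc.intervalIntegrable _ _)]
    have := integral_integral_triangle hker ht
    rw [hY]
    simp only [stableConv]
    rw [← this]
    refine intervalIntegral.integral_congr fun τ hτ => ?_
    rw [Set.uIcc_of_le ht] at hτ
    have h1 := hR.apply_sub_apply hL (w τ) le_rfl (sub_nonneg.2 hτ.2)
    rw [hL.semigroup.zero_apply] at h1
    simp only [max_eq_left (sub_nonneg.2 hτ.2)]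
    rw [h1, intervalIntegral.integral_comp_sub_right
      (fun σ => S (max σ 0) (projS L (w τ))) τ, sub_self]
  have e3 : R (∫ τ in (0 : ℝ)..t, projS L (z τ)) = R (Y t) := by
    rw [← ContinuousLinearMap.intervalIntegral_comp_comm _ (hzs.intervalIntegrable _ _)]
    have h1 : ∫ τ in (0 : ℝ)..t, R (projS L (z τ)) = ∫ τ in (0 : ℝ)..t, (R (w τ) - Y τ) := by
      refine intervalIntegral.integral_congr fun τ hτ => ?_
      rw [Set.uIcc_of_le ht] at hτ
      rw [hR.comp_projS, h τ hτ.1]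
    rw [h1, intervalIntegral.integral_sub (hRw.intervalIntegrable _ _)
      (hYc.intervalIntegrable _ _), e2]
    abel
  have e4 := hR.injective ((∫ τ in (0 : ℝ)..t, projS L (z τ)) - Y t) (by rw [map_sub, e3, sub_self])
  have e5 : projS L (∫ τ in (0 : ℝ)..t, projS L (z τ)) = ∫ τ in (0 : ℝ)..t, projS L (z τ) := by
    rw [← ContinuousLinearMap.intervalIntegral_comp_comm _ (hzs.intervalIntegrable _ _)]
    simp only [projS_projS]
  rw [map_sub, e5, hL.projS_stableConv hw, sub_eq_zero] at e4
  rw [e4, map_sub, h t ht]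
  abel

end PathwiseConvolution

/-! ### Almost sure properties of the noise and of the stochastic convolution -/

section ConvolutionSum

variable {X : Type u} [NormedAddCommGroup X] [InnerProductSpace ℝ X] {Ω : Type v}
  {L : X →ₗ.[ℝ] X} {S : ℝ → X →L[ℝ] X} [FiniteDimensional ℝ (kerOf L)] [CompleteSpace X]

/-- Under `P_c` the Riemann sums telescope, because `P_c e^{tL} = P_c`. -/
lemma projC_convolutionSum (hL : OperatorAssumption L S) {W : ℝ → Ω → X} {t : ℝ} (ht : 0 ≤ t)
    {n : ℕ} (hn : 0 < n) (ω : Ω) :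
    projC L (convolutionSum S W t n ω) = projC L (W t ω) - projC L (W 0 ω) := by
  have hn0 : (0 : ℝ) < n := by exact_mod_cast hn
  have h1 : ∀ i ∈ Finset.range n, projC L
      (S (t - (i : ℝ) * t / n) (W (((i : ℝ) + 1) * t / n) ω - W ((i : ℝ) * t / n) ω))
      = projC L (W (((i + 1 : ℕ) : ℝ) * t / n) ω) - projC L (W ((i : ℝ) * t / n) ω) := by
    intro i hi
    have hin : (i : ℝ) ≤ n := by exact_mod_cast (Finset.mem_range.1 hi).le
    have h2 : (i : ℝ) * t / n ≤ t := by
      rw [div_le_iff₀ hn0, mul_comm]; gcongr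
    rw [hL.projC_apply (sub_nonneg.2 h2), map_sub]
    push_cast
    rfl
  rw [convolutionSum, map_sum, Finset.sum_congr rfl h1,
    Finset.sum_range_sub (fun i : ℕ => projC L (W ((i : ℝ) * t / n) ω))]
  have h3 : (n : ℝ) * t / n = t := by field_simp
  simp [h3]

end ConvolutionSum

lemma eq_of_forall_rat {Y : Type*} [TopologicalSpace Y] [T2Space Y] {f g : ℝ → Y}
    (hf : Continuous f) (hg : Continuous g) (h : ∀ q : ℚ, f q = g q) (t : ℝ) : f t = g t :=
  congrFun (Rat.isDenseEmbedding_coe_real.dense.equalizer hf hg (funext h)) t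

section NoisePaths

variable {X : Type u} [NormedAddCommGroup X] [InnerProductSpace ℝ X] [MeasurableSpace X]
  [BorelSpace X] {Ω : Type v} [MeasurableSpace Ω] {P : Measure Ω}

/-- The covariance vanishes at time zero. -/
lemma IsQFractionalBM.ae_zero [TopologicalSpace.SeparableSpace X] {H : ℝ} (hH : 0 < H)
    {Q : X →L[ℝ] X} {W : ℝ → Ω → X} (hW : IsQFractionalBM P H Q W) : ∀ᵐ ω ∂P, W 0 ω = 0 := by
  have hg : HasGaussianLaw (W 0) P := by
    have := hW.gaussian.hasGaussianLaw_eval (0 : ℝ≥0)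
    simpa using this
  have hx : ∀ x : X, ∀ᵐ ω ∂P, inner ℝ (W 0 ω) x = 0 := by
    intro x
    have h1 : HasGaussianLaw (fun ω => inner ℝ x (W 0 ω)) P := hg.map_fun (innerSL ℝ x)
    have h2 : Integrable (fun ω => inner ℝ x (W 0 ω) ^ 2) P := h1.memLp_two.integrable_sq
    have h3 := hW.covariance 0 0 le_rfl le_rfl x x
    rw [Real.zero_rpow (by positivity), sub_self, abs_zero, Real.zero_rpow (by positivity)] at h3
    have h4 : ∫ ω, inner ℝ x (W 0 ω) ^ 2 ∂P = 0 := by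
      have h5 : ∫ ω, inner ℝ x (W 0 ω) ^ 2 ∂P = ∫ ω, inner ℝ (W 0 ω) x * inner ℝ (W 0 ω) x ∂P :=
        integral_congr_ae (ae_of_all _ fun ω => by simp only [real_inner_comm x, sq])
      rw [h5, h3]
      ring
    rw [integral_eq_zero_iff_of_nonneg (fun ω => sq_nonneg _) h2] at h4
    filter_upwards [h4] with ω hω
    have : inner ℝ x (W 0 ω) = 0 := by simpa using hω
    rwa [real_inner_comm]
  have hall : ∀ᵐ ω ∂P, ∀ n, inner ℝ (W 0 ω) (TopologicalSpace.denseSeq X n) = 0 :=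
    ae_all_iff.2 fun n => hx _
  filter_upwards [hall] with ω hω
  exact (TopologicalSpace.denseRange_denseSeq X).eq_zero_of_inner_left ℝ hω

variable [CompleteSpace X] {L : X →ₗ.[ℝ] X} {S : ℝ → X →L[ℝ] X}
  [FiniteDimensional ℝ (kerOf L)]

/-- The facts about the stochastic convolution `Z` used below. In particular the primitive of
`P_s Z` is controlled by the noise itself, `R` being the inverse of `-L` on the stable part. -/
lemma IsStochasticConvolution.ae_paths [TopologicalSpace.SeparableSpace X]
    (hL : OperatorAssumption L S) {R : X →L[ℝ] X} (hR : IsStableInverse L S R)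
    {H : ℝ} (hH : 0 < H) {W Z : ℝ → Ω → X} (hW : IsTraceClassFBM P H W)
    (hZ : IsStochasticConvolution P S W Z) :
    ∀ᵐ ω ∂P, W 0 ω = 0 ∧ Z 0 ω = 0 ∧ ContinuousOn (fun t : ℝ => W t ω) (Set.Ici 0) ∧
      ContinuousOn (fun t : ℝ => Z t ω) (Set.Ici 0) ∧
      (∀ t, 0 ≤ t → projC L (Z t ω) = projC L (W t ω)) ∧
      ∀ t, 0 ≤ t → ∫ τ in (0 : ℝ)..t, projS L (Z τ ω) = R (W t ω - Z t ω) := by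
  obtain ⟨Q, -, hW⟩ := hW
  have hsub : ∀ t : ℝ, 0 ≤ t → ∀ᵐ ω ∂P, ∃ ns : ℕ → ℕ, StrictMono ns ∧
      Tendsto (fun i => convolutionSum S W t (ns i) ω) atTop (𝓝 (Z t ω)) := fun t ht => by
    obtain ⟨ns, hns, h⟩ := (hZ.integral t ht).exists_seq_tendsto_ae
    filter_upwards [h] with ω hω using ⟨ns, hns, hω⟩
  have hrat : ∀ᵐ ω ∂P, ∀ q : ℚ, ∃ ns : ℕ → ℕ, StrictMono ns ∧
      Tendsto (fun i => convolutionSum S W (max (q : ℝ) 0) (ns i) ω) atTop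
        (𝓝 (Z (max (q : ℝ) 0) ω)) :=
    ae_all_iff.2 fun q => hsub _ (le_max_right _ _)
  filter_upwards [hW.ae_zero hH, hsub 0 le_rfl, hW.continuous, hZ.continuous, hrat]
    with ω hW0 hZ0 hWc hZc hq
  have hm : ∀ t : ℝ, max t 0 ∈ Set.Ici (0 : ℝ) := fun t => Set.mem_Ici.2 (le_max_right _ _)
  have hmc : Continuous fun t : ℝ => max t 0 := by fun_prop
  set w : ℝ → X := fun t => W (max t 0) ω with hw
  set z : ℝ → X := fun t => Z (max t 0) ω with hz
  have hwc : Continuous w := hWc.comp_continuous hmc hm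
  have hzc : Continuous z := hZc.comp_continuous hmc hm
  have hwe : ∀ t, 0 ≤ t → w t = W t ω := fun t ht => by simp only [hw, max_eq_left ht]
  have hze : ∀ t, 0 ≤ t → z t = Z t ω := fun t ht => by simp only [hz, max_eq_left ht]
  have hw0 : w 0 = 0 := by rw [hwe 0 le_rfl, hW0]
  have hconvw : ∀ t, 0 ≤ t → ∀ n, convolutionSum S W t n ω = ∑ i ∈ Finset.range n,
      S (t - (i : ℝ) * t / n) (w (((i : ℝ) + 1) * t / n) - w ((i : ℝ) * t / n)) := by
    intro t ht n
    refine Finset.sum_congr rfl fun i _ => ?_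
    rw [hwe _ (by positivity), hwe _ (by positivity)]
  have hkey : ∀ t, 0 ≤ t → (∃ ns : ℕ → ℕ, StrictMono ns ∧
      Tendsto (fun i => convolutionSum S W t (ns i) ω) atTop (𝓝 (Z t ω))) →
      projC L (z t) = projC L (w t) ∧ R (z t) = R (w t) - stableConv L S w t := by
    rintro t ht ⟨ns, hns, hlim⟩
    constructor
    · have h1 := ((projC L).continuous.tendsto _).comp hlim
      rw [hze t ht, hwe t ht]
      refine tendsto_nhds_unique (h1.congr' ?_) tendsto_const_nhds
      filter_upwards [hns.tendsto_atTop.eventually_gt_atTop 0] with i hi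
      change projC L (convolutionSum S W t (ns i) ω) = _
      rw [projC_convolutionSum hL ht hi, hW0, map_zero, sub_zero]
    · have h1 := (R.continuous.tendsto _).comp hlim
      have h2 := (hR.tendsto_riemannSum hL hwc hw0 ht).comp hns.tendsto_atTop
      rw [hze t ht]
      refine tendsto_nhds_unique h1 (h2.congr fun i => ?_)
      change _ = R (convolutionSum S W t (ns i) ω)
      rw [hconvw t ht]
      rfl
  have hkeyq : ∀ q : ℚ, projC L (z q) = projC L (w q) ∧
      R (z (max (q : ℝ) 0)) = R (w (max (q : ℝ) 0)) - stableConv L S w (max (q : ℝ) 0) := by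
    intro q
    obtain ⟨h1, h2⟩ := hkey (max (q : ℝ) 0) (le_max_right _ _) (hq q)
    refine ⟨?_, h2⟩
    simpa [hz, hw] using h1
  have hC : ∀ t : ℝ, projC L (z t) = projC L (w t) :=
    eq_of_forall_rat ((projC L).continuous.comp hzc) ((projC L).continuous.comp hwc)
      fun q => (hkeyq q).1
  have hRz : ∀ t : ℝ, 0 ≤ t → R (z t) = R (w t) - stableConv L S w t := fun t ht => by
    have h1 := eq_of_forall_rat (f := fun t : ℝ => R (z (max t 0)))
      (g := fun t : ℝ => R (w (max t 0)) - stableConv L S w (max t 0))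
      (R.continuous.comp (hzc.comp hmc))
      ((R.continuous.comp (hwc.comp hmc)).sub ((hL.continuous_stableConv hwc).comp hmc))
      (fun q => (hkeyq q).2) t
    simpa only [max_eq_left ht] using h1
  refine ⟨hW0, ?_, hWc, hZc, fun t ht => ?_, fun t ht => ?_⟩
  · obtain ⟨ns, -, hlim⟩ := hZ0
    refine tendsto_nhds_unique hlim (tendsto_const_nhds.congr fun i => ?_)
    simp [convolutionSum]
  · rw [← hze t ht, ← hwe t ht, hC t]
  · rw [← hze t ht, ← hwe t ht, ← hR.integral_projS hL hwc hzc hRz ht]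
    refine intervalIntegral.integral_congr fun τ hτ => ?_
    rw [Set.uIcc_of_le ht] at hτ
    simp only [hze τ hτ.1]

end NoisePaths

/-! ### An energy estimate and a Young integral estimate -/

section EnergyYoung

lemma exists_continuous_extension {E : Type*} [NormedAddCommGroup E] {φ : ℝ → E} {T : ℝ}
    (hT : 0 ≤ T) (hφ : ContinuousOn φ (Set.Icc 0 T)) :
    ∃ φ' : ℝ → E, Continuous φ' ∧ ∀ t ∈ Set.Icc 0 T, φ' t = φ t :=
  ⟨Set.IccExtend hT (Set.domRestrict (Set.Icc 0 T) φ),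
    (continuousOn_iff_continuous_domRestrict.1 hφ).Icc_extend',
    fun t ht => by rw [Set.IccExtend_of_mem _ _ ht]; rfl⟩

/-- Gronwall's inequality for `‖q‖² - m`, where `q` has the continuous derivative `φ`, a hypothesis
stated in integrated form. -/
lemma norm_sq_sub_le_of_inner_le {E : Type*} [NormedAddCommGroup E] [InnerProductSpace ℝ E]
    [CompleteSpace E] {q φ : ℝ → E} {q₀ : E} {T l m : ℝ} (hφ : ContinuousOn φ (Set.Icc 0 T))
    (hq : ∀ t ∈ Set.Icc 0 T, q t = q₀ + ∫ s in (0 : ℝ)..t, φ s)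
    (h : ∀ t ∈ Set.Icc 0 T, 2 * inner ℝ (q t) (φ t) ≤ l * (‖q t‖ ^ 2 - m)) :
    ∀ t ∈ Set.Icc 0 T, ‖q t‖ ^ 2 - m ≤ (‖q₀‖ ^ 2 - m) * Real.exp (l * t) := by
  intro t ht
  have hT : 0 ≤ T := ht.1.trans ht.2
  obtain ⟨φ', hφ'c, hφ'⟩ := exists_continuous_extension hT hφ
  set p : ℝ → E := fun t => q₀ + ∫ s in (0 : ℝ)..t, φ' s with hp
  have hpd : ∀ s, HasDerivAt p (φ' s) s := fun s =>
    (intervalIntegral.integral_hasDerivAt_right (hφ'c.intervalIntegrable _ _)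
      hφ'c.stronglyMeasurable.stronglyMeasurableAtFilter hφ'c.continuousAt).const_add q₀
  have hpq : ∀ s ∈ Set.Icc 0 T, p s = q s := fun s hs => by
    have h1 : ∫ τ in (0 : ℝ)..s, φ' τ = ∫ τ in (0 : ℝ)..s, φ τ := by
      refine intervalIntegral.integral_congr fun τ hτ => ?_
      rw [Set.uIcc_of_le hs.1] at hτ
      exact hφ' τ ⟨hτ.1, hτ.2.trans hs.2⟩
    rw [hq s hs, ← h1]
  set g : ℝ → ℝ := fun s => (‖p s‖ ^ 2 - m) * Real.exp (-(l * s)) with hg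
  have hgd : ∀ s, HasDerivAt g ((2 * inner ℝ (p s) (φ' s)) * Real.exp (-(l * s))
      + (‖p s‖ ^ 2 - m) * (Real.exp (-(l * s)) * -l)) s := fun s => by
    have h1 : HasDerivAt (fun s : ℝ => -(l * s)) (-l) s := by
      simpa using ((hasDerivAt_id s).const_mul l).fun_neg
    exact ((hpd s).norm_sq.sub_const m).mul h1.exp
  have hanti : AntitoneOn g (Set.Icc 0 T) := by
    refine antitoneOn_of_deriv_nonpos (convex_Icc 0 T)
      (fun s _ => (hgd s).continuousAt.continuousWithinAt)
      (fun s _ => (hgd s).differentiableAt.differentiableWithinAt) fun s hs => ?_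
    have hs' : s ∈ Set.Icc 0 T := interior_subset hs
    rw [(hgd s).deriv]
    have h1 := h s hs'
    rw [← hpq s hs', ← hφ' s hs'] at h1
    have h2 := Real.exp_pos (-(l * s))
    nlinarith
  have h1 := hanti ⟨le_rfl, hT⟩ ht ht.1
  have h2 : g 0 = ‖q₀‖ ^ 2 - m := by simp [hg, hp]
  rw [h2] at h1
  simp only [hg, hpq t ht] at h1
  have h3 : Real.exp (-(l * t)) * Real.exp (l * t) = 1 := by rw [← Real.exp_add]; simp
  have h4 := mul_le_mul_of_nonneg_right h1 (Real.exp_pos (l * t)).le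
  rwa [mul_assoc, h3, mul_one] at h4

variable {X Y : Type*} [NormedAddCommGroup X] [NormedSpace ℝ X] [CompleteSpace X]
  [NormedAddCommGroup Y] [NormedSpace ℝ Y] [CompleteSpace Y]

/-- The local Young estimate: one bisection step for
`I(s, t) = ∫ₛᵗ (g τ - g s) (ρ τ) dτ` reads
`I(s, t) = I(s, m) + I(m, t) + (g m - g s) (∫ₘᵗ ρ)`; iterating it, the crude bound for `I` on short
intervals becomes negligible because `b > 0`. -/
lemma norm_integral_sub_apply_le {g : ℝ → X →L[ℝ] Y} {ρ : ℝ → X} {T b d c k : ℝ}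
    (hb : 0 < b) (hbd : 1 < b + d) (hc : 0 ≤ c) (hk : 0 ≤ k)
    (hg : ContinuousOn g (Set.Icc 0 T)) (hρ : ContinuousOn ρ (Set.Icc 0 T))
    (hgb : ∀ s t, 0 ≤ s → s ≤ t → t ≤ T → ‖g t - g s‖ ≤ c * (t - s) ^ b)
    (hρd : ∀ s t, 0 ≤ s → s ≤ t → t ≤ T → ‖∫ τ in s..t, ρ τ‖ ≤ k * (t - s) ^ d)
    {s t : ℝ} (hs : 0 ≤ s) (hst : s ≤ t) (ht : t ≤ T) :
    ‖∫ τ in s..t, (g τ - g s) (ρ τ)‖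
      ≤ (1 - 2 ^ (1 - (b + d)))⁻¹ * (c * k) * (t - s) ^ (b + d) := by
  obtain ⟨m, hm⟩ := (isCompact_Icc.image_of_continuousOn hρ.norm).bddAbove
  have hm' : ∀ τ ∈ Set.Icc 0 T, ‖ρ τ‖ ≤ m := fun τ hτ => hm ⟨τ, hτ, rfl⟩
  set D : ℝ := (1 - 2 ^ (1 - (b + d)))⁻¹ with hD
  have h2p : (2 : ℝ) ^ (1 - (b + d)) < 1 :=
    Real.rpow_lt_one_of_one_lt_of_neg (by norm_num) (by linarith)
  have hD0 : 0 < D := inv_pos.2 (by linarith)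
  have hDe : 2 ^ (1 - (b + d)) * D + 1 = D := by
    have : D * (1 - 2 ^ (1 - (b + d))) = 1 := inv_mul_cancel₀ (by linarith)
    linarith
  have hDle : (2 * D + 1) * (2 : ℝ) ^ (-(b + d)) ≤ D := by
    have e1 : (2 : ℝ) ^ (1 - (b + d)) = 2 * 2 ^ (-(b + d)) := by
      rw [sub_eq_add_neg, Real.rpow_add two_pos, Real.rpow_one]
    have e2 : (2 : ℝ) ^ (-(b + d)) ≤ 1 :=
      Real.rpow_le_one_of_one_le_of_nonpos (by norm_num) (by linarith)
    rw [e1] at hDe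
    linarith
  have hsubset : ∀ s t, 0 ≤ s → s ≤ t → t ≤ T → Set.uIcc s t ⊆ Set.Icc 0 T :=
    fun s t hs hst ht => by rw [Set.uIcc_of_le hst]; exact Set.Icc_subset_Icc hs ht
  have hci : ∀ (A : X →L[ℝ] Y) s t, 0 ≤ s → s ≤ t → t ≤ T →
      IntervalIntegrable (fun τ => (g τ - A) (ρ τ)) volume s t := fun A s t hs hst ht =>
    (((hg.sub continuousOn_const).clm_apply hρ).mono (hsubset s t hs hst ht)).intervalIntegrable
  have hind : ∀ n : ℕ, ∀ s t, 0 ≤ s → s ≤ t → t ≤ T → ‖∫ τ in s..t, (g τ - g s) (ρ τ)‖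
      ≤ D * (c * k) * (t - s) ^ (b + d) + c * m * (t - s) ^ (1 + b) * (2 ^ (-b)) ^ n := by
    intro n
    induction n with
    | zero =>
      intro s t hs hst ht
      have hl : 0 ≤ t - s := sub_nonneg.2 hst
      have hm0 : 0 ≤ m := (norm_nonneg _).trans (hm' s ⟨hs, hst.trans ht⟩)
      have h1 : ‖∫ τ in s..t, (g τ - g s) (ρ τ)‖ ≤ (c * (t - s) ^ b * m) * |t - s| := by
        refine intervalIntegral.norm_integral_le_of_norm_le_const fun τ hτ => ?_
        rw [Set.uIoc_of_le hst] at hτ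
        have hτT := hτ.2.trans ht
        have hτ0 := hs.trans hτ.1.le
        refine (ContinuousLinearMap.le_opNorm _ _).trans ?_
        have h2 : ‖g τ - g s‖ ≤ c * (t - s) ^ b := by
          refine (hgb s τ hs hτ.1.le hτT).trans ?_
          have h3 : 0 ≤ τ - s := sub_nonneg.2 hτ.1.le
          have h4 : τ - s ≤ t - s := sub_le_sub_right hτ.2 s
          gcongr
        gcongr
        exact hm' τ ⟨hτ0, hτT⟩
      rw [abs_of_nonneg hl] at h1
      have h3 : (t - s) ^ (1 + b) = (t - s) ^ b * (t - s) := by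
        rw [add_comm, Real.rpow_add_one' hl (by linarith)]
      rw [pow_zero, mul_one, h3]
      have h4 : 0 ≤ D * (c * k) * (t - s) ^ (b + d) := by positivity
      linarith
    | succ n ih =>
      intro s t hs hst ht
      have hl : 0 ≤ t - s := sub_nonneg.2 hst
      set r := (s + t) / 2 with hr
      have hsr : s ≤ r := by linarith
      have hrt : r ≤ t := by linarith
      have hr0 : 0 ≤ r := hs.trans hsr
      have hrT : r ≤ T := hrt.trans ht
      have e1 : r - s = (t - s) * 2⁻¹ := by rw [hr]; ring
      have e2 : t - r = (t - s) * 2⁻¹ := by rw [hr]; ring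
      have hρi : IntervalIntegrable ρ volume r t :=
        (hρ.mono (hsubset r t hr0 hrt ht)).intervalIntegrable
      have hsplit : ∫ τ in s..t, (g τ - g s) (ρ τ) = (∫ τ in s..r, (g τ - g s) (ρ τ))
          + ((∫ τ in r..t, (g τ - g r) (ρ τ)) + (g r - g s) (∫ τ in r..t, ρ τ)) := by
        have hAi : IntervalIntegrable (fun τ => (g r - g s) (ρ τ)) volume r t :=
          ((g r - g s).continuous.comp_continuousOn
            (hρ.mono (hsubset r t hr0 hrt ht))).intervalIntegrable
        rw [← ContinuousLinearMap.intervalIntegral_comp_comm _ hρi,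
          ← intervalIntegral.integral_add (hci _ r t hr0 hrt ht) hAi,
          ← intervalIntegral.integral_add_adjacent_intervals (hci _ s r hs hsr hrT)
            (hci _ r t hr0 hrt ht)]
        congr 1
        refine intervalIntegral.integral_congr fun τ _ => ?_
        simp only [sub_apply]
        abel
      have h1 := ih s r hs hsr hrT
      have h2 := ih r t hr0 hrt ht
      have h3 : ‖(g r - g s) (∫ τ in r..t, ρ τ)‖ ≤ (c * (r - s) ^ b) * (k * (t - r) ^ d) :=
        (ContinuousLinearMap.le_opNorm _ _).trans
          (mul_le_mul (hgb s r hs hsr hrT) (hρd r t hr0 hrt ht) (norm_nonneg _) (by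
            rw [e1]; positivity))
      rw [e1] at h1 h3
      rw [e2] at h2 h3
      rw [hsplit]
      refine (norm_add_le _ _).trans ((add_le_add_right (norm_add_le _ _) _).trans ?_)
      rcases hl.eq_or_lt with h0 | h0
      · rw [← h0, zero_mul] at h1 h2 h3
        rw [← h0]
        rw [Real.zero_rpow (by linarith : 1 + b ≠ 0), Real.zero_rpow (by linarith : b + d ≠ 0)] at *
        rw [Real.zero_rpow (by linarith : b ≠ 0)] at h3
        linarith
      · have hp : ((t - s) * 2⁻¹) ^ (b + d) = (t - s) ^ (b + d) * 2 ^ (-(b + d)) := by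
          rw [Real.mul_rpow hl (by norm_num), Real.inv_rpow (by norm_num), Real.rpow_neg (by norm_num)]
        have hq : 2 * ((t - s) * 2⁻¹) ^ (1 + b) = (t - s) ^ (1 + b) * 2 ^ (-b) := by
          rw [Real.mul_rpow hl (by norm_num), Real.inv_rpow (by norm_num), Real.rpow_add two_pos,
            Real.rpow_one, Real.rpow_neg (by norm_num)]
          field_simp
        have hs' : ((t - s) * 2⁻¹) ^ b * ((t - s) * 2⁻¹) ^ d
            = (t - s) ^ (b + d) * 2 ^ (-(b + d)) := by
          rw [← Real.rpow_add (by positivity), hp]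
        have e3 : c * ((t - s) * 2⁻¹) ^ b * (k * ((t - s) * 2⁻¹) ^ d)
            = c * k * ((t - s) ^ (b + d) * 2 ^ (-(b + d))) := by rw [← hs']; ring
        rw [e3] at h3
        rw [hp] at h1 h2
        have hfin : (2 * D + 1) * 2 ^ (-(b + d)) * ((c * k) * (t - s) ^ (b + d))
            ≤ D * ((c * k) * (t - s) ^ (b + d)) := by gcongr
        calc _ ≤ 2 * (D * (c * k) * ((t - s) ^ (b + d) * 2 ^ (-(b + d)))
              + c * m * ((t - s) * 2⁻¹) ^ (1 + b) * (2 ^ (-b)) ^ n)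
              + c * k * ((t - s) ^ (b + d) * 2 ^ (-(b + d))) := by linarith
          _ = (2 * D + 1) * 2 ^ (-(b + d)) * ((c * k) * (t - s) ^ (b + d))
              + c * m * (2 * ((t - s) * 2⁻¹) ^ (1 + b)) * (2 ^ (-b)) ^ n := by ring
          _ ≤ D * ((c * k) * (t - s) ^ (b + d))
              + c * m * (2 * ((t - s) * 2⁻¹) ^ (1 + b)) * (2 ^ (-b)) ^ n := by gcongr
          _ = _ := by rw [hq, pow_succ]; ring
  have hlim : Tendsto (fun n : ℕ => D * (c * k) * (t - s) ^ (b + d)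
      + c * m * (t - s) ^ (1 + b) * ((2 : ℝ) ^ (-b)) ^ n) atTop
      (𝓝 (D * (c * k) * (t - s) ^ (b + d) + c * m * (t - s) ^ (1 + b) * 0)) := by
    refine ((tendsto_pow_atTop_nhds_zero_of_lt_one (by positivity) ?_).const_mul _).const_add _
    exact Real.rpow_lt_one_of_one_lt_of_neg (by norm_num) (by linarith)
  rw [mul_zero, add_zero] at hlim
  exact ge_of_tendsto' hlim fun n => hind n s t hs hst ht

/-- Young's estimate for `∫₀ᵗ g ρ` in terms of Hölder bounds for `g` and the primitive of `ρ`. -/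
lemma norm_integral_apply_le {g : ℝ → X →L[ℝ] Y} {ρ : ℝ → X} {T b d c k g₀ : ℝ}
    (hb : 0 < b) (hd : 0 ≤ d) (hbd : 1 < b + d) (hc : 0 ≤ c) (hk : 0 ≤ k)
    (hg : ContinuousOn g (Set.Icc 0 T)) (hρ : ContinuousOn ρ (Set.Icc 0 T))
    (hg0 : ‖g 0‖ ≤ g₀)
    (hgb : ∀ s t, 0 ≤ s → s ≤ t → t ≤ T → ‖g t - g s‖ ≤ c * (t - s) ^ b)
    (hρd : ∀ s t, 0 ≤ s → s ≤ t → t ≤ T → ‖∫ τ in s..t, ρ τ‖ ≤ k * (t - s) ^ d)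
    {t : ℝ} (ht : t ∈ Set.Icc 0 T) :
    ‖∫ τ in (0 : ℝ)..t, g τ (ρ τ)‖
      ≤ (g₀ * T ^ d + (1 - 2 ^ (1 - (b + d)))⁻¹ * c * T ^ (b + d)) * k := by
  have h1 := norm_integral_sub_apply_le hb hbd hc hk hg hρ hgb hρd le_rfl ht.1 ht.2
  have hsub : Set.uIcc 0 t ⊆ Set.Icc 0 T := by
    rw [Set.uIcc_of_le ht.1]; exact Set.Icc_subset_Icc_right ht.2
  have hρi : ContinuousOn ρ (Set.uIcc 0 t) := hρ.mono hsub
  have e1 : ∫ τ in (0 : ℝ)..t, g τ (ρ τ)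
      = (∫ τ in (0 : ℝ)..t, (g τ - g 0) (ρ τ)) + g 0 (∫ τ in (0 : ℝ)..t, ρ τ) := by
    have hi1 : IntervalIntegrable (fun τ => (g τ - g 0) (ρ τ)) volume 0 t :=
      (((hg.mono hsub).sub continuousOn_const).clm_apply hρi).intervalIntegrable
    have hi2 : IntervalIntegrable (fun τ => g 0 (ρ τ)) volume 0 t :=
      ((g 0).continuous.comp_continuousOn hρi).intervalIntegrable
    rw [← ContinuousLinearMap.intervalIntegral_comp_comm _ hρi.intervalIntegrable,
      ← intervalIntegral.integral_add hi1 hi2]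
    refine intervalIntegral.integral_congr fun τ _ => ?_
    simp only [sub_apply]
    abel
  have h2 : ‖g 0 (∫ τ in (0 : ℝ)..t, ρ τ)‖ ≤ g₀ * (k * (t - 0) ^ d) :=
    (ContinuousLinearMap.le_opNorm _ _).trans
      (mul_le_mul hg0 (hρd 0 t le_rfl ht.1 ht.2) (norm_nonneg _) ((norm_nonneg _).trans hg0))
  have h2p : (2 : ℝ) ^ (1 - (b + d)) < 1 :=
    Real.rpow_lt_one_of_one_lt_of_neg (by norm_num) (by linarith)
  have hD0 : 0 < (1 - (2 : ℝ) ^ (1 - (b + d)))⁻¹ := inv_pos.2 (by linarith)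
  have hg₀ : 0 ≤ g₀ := (norm_nonneg _).trans hg0
  rw [sub_zero] at h1 h2
  rw [e1]
  have ht0 := ht.1
  calc _ ≤ (1 - (2 : ℝ) ^ (1 - (b + d)))⁻¹ * (c * k) * t ^ (b + d) + g₀ * (k * t ^ d) :=
        (norm_add_le _ _).trans (add_le_add h1 h2)
    _ ≤ (1 - (2 : ℝ) ^ (1 - (b + d)))⁻¹ * (c * k) * T ^ (b + d) + g₀ * (k * T ^ d) := by
      have := ht.2
      gcongr
    _ = _ := by ring

end EnergyYoung

/-! ### The cubic nonlinearity on the kernel -/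

section Cubic

set_option maxSynthPendingDepth 3

variable {X : Type u} [NormedAddCommGroup X] [InnerProductSpace ℝ X]

/-- A symmetric bounded trilinear map with the sign conditions that the projected nonlinearity
`F_c = P_c F` satisfies on the kernel `N` of the linear operator. -/
structure IsDissipativeCubic (N : Submodule ℝ X) (G : X →L[ℝ] X →L[ℝ] X →L[ℝ] X) : Prop where
  swap_left : ∀ u v w, G u v w = G v u w
  swap_right : ∀ u v w, G u v w = G u w v
  sign : ∀ v ∈ N, ∀ w ∈ N, inner ℝ (G v v w) w ≤ 0
  dissipative : ∃ η C : ℝ, 0 < η ∧ 0 < C ∧ ∀ v ∈ N, ∀ φ ∈ N,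
    inner ℝ (G (φ + v) (φ + v) (φ + v)) v ≤ C * ‖φ‖ ^ 4 - η * ‖v‖ ^ 4

lemma norm_trilinear_le (G : X →L[ℝ] X →L[ℝ] X →L[ℝ] X) {K : ℝ} (hK : ‖G‖ ≤ K) {u v w : X}
    {a b c : ℝ} (hu : ‖u‖ ≤ a) (hv : ‖v‖ ≤ b) (hw : ‖w‖ ≤ c) :
    ‖G u v w‖ ≤ K * a * b * c := by
  have ha : 0 ≤ a := (norm_nonneg _).trans hu
  have hb : 0 ≤ b := (norm_nonneg _).trans hv
  have hK0 : 0 ≤ K := (norm_nonneg _).trans hK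
  calc ‖G u v w‖ ≤ ‖G u v‖ * ‖w‖ := (G u v).le_opNorm w
    _ ≤ ‖G u‖ * ‖v‖ * ‖w‖ := by gcongr; exact (G u).le_opNorm v
    _ ≤ ‖G‖ * ‖u‖ * ‖v‖ * ‖w‖ := by gcongr; exact G.le_opNorm u
    _ ≤ K * a * b * c := by gcongr

variable {N : Submodule ℝ X} {G : X →L[ℝ] X →L[ℝ] X →L[ℝ] X}

lemma IsDissipativeCubic.cube_add (hG : IsDissipativeCubic N G) (x y : X) :
    G (x + y) (x + y) (x + y)
      = G x x x + (3 : ℝ) • G x x y + (3 : ℝ) • G x y y + G y y y := by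
  have h1 : G x y x = G x x y := hG.swap_right _ _ _
  have h2 : G y x x = G x x y := by rw [hG.swap_left, h1]
  have h3 : G y x y = G x y y := hG.swap_left _ _ _
  have h4 : G y y x = G x y y := by rw [hG.swap_right, h3]
  simp only [map_add, add_apply, h1, h2, h3, h4]
  module

/-- The one-sided Lipschitz property of the cubic, by a quadrature rule of its derivative. -/
lemma IsDissipativeCubic.inner_cube_sub_le (hG : IsDissipativeCubic N G) {x y : X} (hx : x ∈ N)
    (hy : y ∈ N) : inner ℝ (G (x + y) (x + y) (x + y) - G x x x) y ≤ 0 := by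
  have h1 := hG.sign (x + (1 / 2 : ℝ) • y) (N.add_mem hx (N.smul_mem _ hy)) y hy
  have h2 := hG.sign y hy y hy
  have h3 : G y x y = G x y y := hG.swap_left _ _ _
  have e : G (x + y) (x + y) (x + y) - G x x x
      = (3 : ℝ) • G (x + (1 / 2 : ℝ) • y) (x + (1 / 2 : ℝ) • y) y + (1 / 4 : ℝ) • G y y y := by
    rw [hG.cube_add]
    simp only [map_add, add_apply, map_smul, smul_apply, h3]
    module
  rw [e, inner_add_left, real_inner_smul_left, real_inner_smul_left]
  linarith

lemma IsDissipativeCubic.norm_cube_add_sub_le (hG : IsDissipativeCubic N G) {K : ℝ}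
    (hK : ‖G‖ ≤ K) {x y : X} {b e : ℝ} (hb : 1 ≤ b) (he : e ≤ 1) (hx : ‖x‖ ≤ b) (hy : ‖y‖ ≤ e) :
    ‖G (x + y) (x + y) (x + y) - G x x x‖ ≤ 7 * K * b ^ 2 * e := by
  have he0 : 0 ≤ e := (norm_nonneg _).trans hy
  have hK0 : 0 ≤ K := (norm_nonneg _).trans hK
  have e1 : G (x + y) (x + y) (x + y) - G x x x
      = (3 : ℝ) • G x x y + (3 : ℝ) • G x y y + G y y y := by
    rw [hG.cube_add]; abel
  have h1 := norm_trilinear_le G hK hx hx hy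
  have h2 := norm_trilinear_le G hK hx hy hy
  have h3 := norm_trilinear_le G hK hy hy hy
  have h4 : K * b * e * e ≤ K * b ^ 2 * e := by
    calc K * b * e * e ≤ K * b * b * e := by gcongr; linarith
      _ = _ := by ring
  have h5 : K * e * e * e ≤ K * b ^ 2 * e := by
    calc K * e * e * e ≤ K * b * b * e := by gcongr <;> linarith
      _ = _ := by ring
  rw [e1]
  calc _ ≤ 3 * ‖G x x y‖ + 3 * ‖G x y y‖ + ‖G y y y‖ := by
        refine (norm_add₃_le).trans ?_
        rw [norm_smul, norm_smul, Real.norm_of_nonneg (by norm_num : (0 : ℝ) ≤ 3)]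
    _ ≤ _ := by
      have : K * b * b * e = K * b ^ 2 * e := by ring
      linarith

end Cubic

/-! ### A priori bounds for the amplitude equation -/

section Amplitude

set_option maxSynthPendingDepth 3

variable {X : Type u} [NormedAddCommGroup X] [InnerProductSpace ℝ X] [CompleteSpace X]
  {N : Submodule ℝ X} {G : X →L[ℝ] X →L[ℝ] X →L[ℝ] X}

/-- Young's inequality turns quartic dissipation into linear decay above the level `m B²`. -/
lemma quartic_energy_le {η K Cη c m B y x₁ x₂ β : ℝ} (hη : 0 < η) (hK : 0 ≤ K) (hCη : 0 < Cη)
    (hB : 1 ≤ B) (hy : 0 ≤ y) (hcη : 2 * η * c = 2 * K + η)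
    (hmη : η * m = η + K + Cη + η * c ^ 2) (hβ : β ≤ B ^ 4)
    (h1 : x₁ ≤ K * (B ^ 2 + 2 * y)) (h2 : x₂ ≤ Cη * β - η * y ^ 2) :
    2 * (x₁ + x₂) ≤ -(2 * η * B ^ 2) * (y - m * B ^ 2) := by
  have hB2 : 1 ≤ B ^ 2 := one_le_pow₀ hB
  have h5 : 2 * c * B ^ 2 * y - c ^ 2 * B ^ 4 ≤ y ^ 2 := by
    nlinarith [sq_nonneg (y - c * B ^ 2)]
  have h6 : η * (2 * c * B ^ 2 * y - c ^ 2 * B ^ 4) ≤ η * y ^ 2 := by gcongr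
  have h7 : η * (2 * c * B ^ 2 * y) = (2 * K + η) * B ^ 2 * y := by rw [← hcη]; ring
  have h8 : 2 * K * y * 1 ≤ 2 * K * y * B ^ 2 := by gcongr
  have h9 : K * B ^ 2 ≤ K * B ^ 4 := by
    have : B ^ 2 ≤ B ^ 4 := pow_le_pow_right₀ hB (by norm_num)
    gcongr
  have h10 : Cη * β ≤ Cη * B ^ 4 := by gcongr
  have h11 : η * m * B ^ 4 = (η + K + Cη + η * c ^ 2) * B ^ 4 := by rw [hmη]
  have h12 : 0 ≤ η * B ^ 4 := by positivity
  have h13 : -(2 * η * B ^ 2) * (y - m * B ^ 2) = 2 * (η * m * B ^ 4) - 2 * (η * B ^ 2 * y) := by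
    ring
  rw [h13]
  linarith

/-- The difference `v = a - b` satisfies an ordinary differential equation, and
`d/dT ‖v‖² ≤ -2 η B² (‖v‖² - m B²)` by dissipativity, where `B` bounds `a₀` and the noise `b`. -/
lemma IsDissipativeCubic.exists_amplitude_bound (hG : IsDissipativeCubic N G) (Ac : X →L[ℝ] X) :
    ∃ C : ℝ, 1 ≤ C ∧ ∀ (T B : ℝ) (a b : ℝ → X) (a₀ : X), 0 ≤ T → 1 ≤ B →
      ContinuousOn a (Set.Icc 0 T) →
      (∀ t ∈ Set.Icc 0 T, a t ∈ N) → (∀ t ∈ Set.Icc 0 T, b t ∈ N) →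
      ‖a₀‖ ≤ B → (∀ t ∈ Set.Icc 0 T, ‖b t‖ ≤ B) →
      (∀ t ∈ Set.Icc 0 T, a t = a₀ + (∫ s in (0 : ℝ)..t, (Ac (a s) + G (a s) (a s) (a s))) + b t) →
      (∀ t ∈ Set.Icc 0 T, ‖a t‖ ≤ C * B) ∧
      ∀ s t, 0 ≤ s → s ≤ t → t ≤ T → ‖a t - a s‖ ≤ C * B ^ 3 * (t - s) + ‖b t - b s‖ := by
  obtain ⟨η, Cη, hη, hCη, hdiss⟩ := hG.dissipative
  set K := ‖Ac‖ + ‖G‖ with hK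
  have hK0 : 0 ≤ K := by positivity
  have hKA : ‖Ac‖ ≤ K := by rw [hK]; linarith [norm_nonneg G]
  have hKG : ‖G‖ ≤ K := by rw [hK]; linarith [norm_nonneg Ac]
  -- `c` is the constant for which `η (‖v‖² - c B²)² ≥ 0` absorbs the terms linear in `‖v‖²`, and `m`
  -- collects the constants that remain
  set c : ℝ := (2 * K + η) / (2 * η) with hc
  have hcη : 2 * η * c = 2 * K + η := by rw [hc]; field_simp
  set m : ℝ := 1 + (K + Cη + η * c ^ 2) / η with hm
  have hmη : η * m = η + K + Cη + η * c ^ 2 := by rw [hm]; field_simp; ring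
  have hm1 : 1 ≤ m := by
    rw [hm]
    have : 0 ≤ (K + Cη + η * c ^ 2) / η := by positivity
    linarith
  set C₁ := Real.sqrt m + 1 with hC₁
  have hC₁1 : 1 ≤ C₁ := by rw [hC₁]; linarith [Real.sqrt_nonneg m]
  have hC₁C : C₁ ≤ C₁ + 2 * K * C₁ ^ 3 := by linarith [show 0 ≤ 2 * K * C₁ ^ 3 by positivity]
  refine ⟨C₁ + 2 * K * C₁ ^ 3, by linarith, ?_⟩
  intro T B a b a₀ hT hB hac haN hbN ha₀ hbB heq
  set φ : ℝ → X := fun s => Ac (a s) + G (a s) (a s) (a s) with hφ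
  have hφc : ContinuousOn φ (Set.Icc 0 T) := by
    rw [hφ]
    exact (Ac.continuous.comp_continuousOn hac).add
      (((G.continuous.comp_continuousOn hac).clm_apply hac).clm_apply hac)
  set v : ℝ → X := fun t => a t - b t with hv
  have hveq : ∀ t ∈ Set.Icc 0 T, v t = a₀ + ∫ s in (0 : ℝ)..t, φ s := fun t ht => by
    rw [hv]
    simp only [heq t ht]
    abel
  have hvN : ∀ t ∈ Set.Icc 0 T, v t ∈ N := fun t ht => N.sub_mem (haN t ht) (hbN t ht)
  have henergy := norm_sq_sub_le_of_inner_le (l := -(2 * η * B ^ 2)) (m := m * B ^ 2) hφc hveq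
    (fun t ht => by
      have hav : a t = b t + v t := by simp [hv]
      have h1 := hdiss (v t) (hvN t ht) (b t) (hbN t ht)
      rw [← hav] at h1
      have hbt := hbB t ht
      have h2 : inner ℝ (Ac (a t)) (v t) ≤ K * (B ^ 2 + 2 * ‖v t‖ ^ 2) := by
        calc inner ℝ (Ac (a t)) (v t) ≤ ‖Ac (a t)‖ * ‖v t‖ := real_inner_le_norm _ _
          _ ≤ (K * (B + ‖v t‖)) * ‖v t‖ := by
            gcongr
            refine (Ac.le_of_opNorm_le hKA _).trans ?_
            gcongr
            rw [hav]
            exact (norm_add_le _ _).trans (by gcongr)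
          _ = K * (B * ‖v t‖ + ‖v t‖ ^ 2) := by ring
          _ ≤ _ := by
            refine mul_le_mul_of_nonneg_left ?_ hK0
            nlinarith [sq_nonneg (B - ‖v t‖)]
      have h3 : ‖b t‖ ^ 4 ≤ B ^ 4 := by gcongr
      have h4 : inner ℝ (v t) (φ t) = inner ℝ (Ac (a t)) (v t)
          + inner ℝ (G (a t) (a t) (a t)) (v t) := by
        rw [real_inner_comm, hφ, inner_add_left]
      rw [h4]
      have hy4 : ‖v t‖ ^ 4 = (‖v t‖ ^ 2) ^ 2 := by ring
      rw [hy4] at h1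
      exact quartic_energy_le hη hK0 hCη hB (by positivity) hcη hmη h3 h2 h1)
  have hvb : ∀ t ∈ Set.Icc 0 T, ‖v t‖ ≤ Real.sqrt m * B := fun t ht => by
    have h1 := henergy t ht
    have h2 : ‖a₀‖ ^ 2 - m * B ^ 2 ≤ 0 := by
      have : ‖a₀‖ ^ 2 ≤ B ^ 2 := by gcongr
      nlinarith [sq_nonneg B]
    have h3 : ‖v t‖ ^ 2 ≤ m * B ^ 2 := by
      have := mul_nonpos_of_nonpos_of_nonneg h2 (Real.exp_pos (-(2 * η * B ^ 2) * t)).le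
      linarith
    have h4 : (Real.sqrt m * B) ^ 2 = m * B ^ 2 := by
      rw [mul_pow, Real.sq_sqrt (by linarith)]
    exact abs_le_of_sq_le_sq' (by rw [h4]; exact h3) (by positivity) |>.2
  have hab : ∀ t ∈ Set.Icc 0 T, ‖a t‖ ≤ C₁ * B := fun t ht => by
    have hav : a t = v t + b t := by simp [hv]
    rw [hav]
    refine (norm_add_le _ _).trans ?_
    have := hvb t ht
    have := hbB t ht
    rw [hC₁]
    linarith
  refine ⟨fun t ht => (hab t ht).trans (by gcongr), fun s t hs hst ht => ?_⟩
  have hsI : s ∈ Set.Icc 0 T := ⟨hs, hst.trans ht⟩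
  have htI : t ∈ Set.Icc 0 T := ⟨hs.trans hst, ht⟩
  have hφi : ∀ r ∈ Set.Icc 0 T, IntervalIntegrable φ volume 0 r := fun r hr =>
    (hφc.mono (by rw [Set.uIcc_of_le hr.1]; exact Set.Icc_subset_Icc_right hr.2)).intervalIntegrable
  have e1 : a t - a s = (∫ τ in s..t, φ τ) + (b t - b s) := by
    rw [heq t htI, heq s hsI, ← intervalIntegral.integral_interval_sub_left (hφi t htI) (hφi s hsI)]
    abel
  rw [e1]
  refine (norm_add_le _ _).trans (add_le_add_left ?_ _)
  have h1 : ‖∫ τ in s..t, φ τ‖ ≤ (2 * K * C₁ ^ 3 * B ^ 3) * |t - s| := by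
    refine intervalIntegral.norm_integral_le_of_norm_le_const fun τ hτ => ?_
    rw [Set.uIoc_of_le hst] at hτ
    have hτI : τ ∈ Set.Icc 0 T := ⟨hs.trans hτ.1.le, hτ.2.trans ht⟩
    have h2 := hab τ hτI
    have h3 : ‖Ac (a τ)‖ ≤ K * (C₁ * B) := (Ac.le_of_opNorm_le hKA _).trans (by gcongr)
    have h4 := norm_trilinear_le G hKG h2 h2 h2
    have h5 : C₁ * B ≤ (C₁ * B) ^ 3 := by
      have : 1 ≤ C₁ * B := by nlinarith
      exact le_self_pow₀ this (by norm_num)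
    refine (norm_add_le _ _).trans ?_
    have h6 : K * (C₁ * B) ≤ K * (C₁ * B) ^ 3 := by gcongr
    calc ‖Ac (a τ)‖ + ‖G (a τ) (a τ) (a τ)‖
        ≤ K * (C₁ * B) ^ 3 + K * (C₁ * B) * (C₁ * B) * (C₁ * B) := by linarith
      _ = _ := by ring
  rw [abs_of_nonneg (sub_nonneg.2 hst)] at h1
  refine h1.trans ?_
  have : 0 ≤ t - s := sub_nonneg.2 hst
  gcongr
  nlinarith [show (0 : ℝ) ≤ B ^ 3 by positivity]

end Amplitude

/-! ### The remainder estimate in slow time -/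

section Remainder

set_option maxSynthPendingDepth 3

variable {X : Type u} [NormedAddCommGroup X] [InnerProductSpace ℝ X]
  {N : Submodule ℝ X} {G : X →L[ℝ] X →L[ℝ] X →L[ℝ] X}

/-- The pointwise energy estimate behind the remainder bound, for `r = q + H` with `q` the
corrected remainder and `H` the averaged effect of the fast perturbation. -/
lemma IsDissipativeCubic.inner_vectorField_le (hG : IsDissipativeCubic N G) (Ac : X →L[ℝ] X)
    {K Ca B d d' h : ℝ} {a r q H ρ w : X} (hK0 : 0 ≤ K) (hKA : ‖Ac‖ ≤ K) (hKG : ‖G‖ ≤ K)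
    (hCa : 1 ≤ Ca) (hB : 1 ≤ B) (hBd : B * d ≤ 1) (hd'1 : d' ≤ 1) (hh1 : h ≤ 1) (hd0 : 0 ≤ d)
    (hrt : r = q + H) (haN : a ∈ N) (hqN : q ∈ N) (hab : ‖a‖ ≤ Ca * B) (hrb : ‖r‖ ≤ 1)
    (hρb : ‖ρ‖ ≤ d) (hwb : ‖w‖ ≤ d') (hHb : ‖H‖ ≤ h) :
    inner ℝ q (Ac (r + ρ + w) + (G (a + r + ρ + w) (a + r + ρ + w) (a + r + ρ + w) - G a a a)
        - (Ac ρ + (3 : ℝ) • G a a ρ))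
      ≤ 40 * K * (Ca + 2) ^ 2 * ‖q‖ ^ 2
        + 40 * K * (Ca + 2) ^ 2 * (B ^ 2 * (h + d') + B * d ^ 2) * ‖q‖ := by
  have hd'0 : 0 ≤ d' := (norm_nonneg _).trans hwb
  have hh0 : 0 ≤ h := (norm_nonneg _).trans hHb
  have hd1 : d ≤ 1 := by nlinarith
  set b₁ := Ca + 2 with hb₁
  have hb₁1 : 1 ≤ b₁ := by linarith
  set C₁ := 40 * K * b₁ ^ 2 with hC₁
  set E := B ^ 2 * (h + d') + B * d ^ 2 with hE
  have hrq : ‖r‖ ≤ ‖q‖ + h := by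
    rw [hrt]; exact (norm_add_le _ _).trans (by gcongr)
  have hqr : ‖q‖ ≤ 2 := by
    have e2 : q = r - H := by rw [hrt]; abel
    rw [e2]
    exact (norm_sub_le _ _).trans (by linarith)
  have hBb : Ca * B + 2 ≤ b₁ * B := by rw [hb₁]; nlinarith
  have hbB1 : 1 ≤ b₁ * B := by nlinarith
  -- `a + r = (a + q) + H`: the dissipative increment from `a` to `a + q` is separated from the
  -- increments by `H`, `ρ` and `w`, which are small
  set c := a + r with hc
  have hcb : ‖c‖ ≤ b₁ * B := by
    refine (norm_add_le _ _).trans ?_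
    linarith
  have hcρ : ‖c + ρ‖ ≤ b₁ * B := by
    refine (norm_add_le _ _).trans ?_
    have h3 : ‖c‖ ≤ Ca * B + 1 := (norm_add_le _ _).trans (by linarith)
    linarith
  have haq : ‖a + q‖ ≤ b₁ * B := (norm_add_le _ _).trans (by linarith)
  have e1 : Ac (r + ρ + w) + (G (c + ρ + w) (c + ρ + w) (c + ρ + w) - G a a a)
      - (Ac ρ + (3 : ℝ) • G a a ρ) = Ac (r + w)
      + (G (a + q) (a + q) (a + q) - G a a a)
      + (G c c c - G (a + q) (a + q) (a + q))
      + (G (c + ρ + w) (c + ρ + w) (c + ρ + w)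
          - G (c + ρ) (c + ρ) (c + ρ))
      + ((3 : ℝ) • (G c c ρ - G a a ρ) + (3 : ℝ) • G c ρ ρ
          + G ρ ρ ρ) := by
    have hA : Ac (r + ρ + w) = Ac (r + w) + Ac ρ := by
      rw [← map_add]; congr 1; abel
    rw [hA, hG.cube_add c ρ]
    module
  have h1 : ‖Ac (r + w)‖ ≤ K * (‖q‖ + h + d') := by
    refine (Ac.le_of_opNorm_le hKA _).trans ?_
    gcongr
    exact (norm_add_le _ _).trans (add_le_add hrq hwb)
  have h2 : inner ℝ (G (a + q) (a + q) (a + q) - G a a a) q ≤ 0 :=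
    hG.inner_cube_sub_le haN hqN
  have h3 : ‖G c c c - G (a + q) (a + q) (a + q)‖ ≤ 7 * K * (b₁ * B) ^ 2 * h := by
    have e2 : c = a + q + H := by rw [hc, hrt]; abel
    rw [e2]
    exact hG.norm_cube_add_sub_le hKG hbB1 hh1 haq hHb
  have h4 : ‖G (c + ρ + w) (c + ρ + w) (c + ρ + w)
          - G (c + ρ) (c + ρ) (c + ρ)‖ ≤ 7 * K * (b₁ * B) ^ 2 * d' :=
    hG.norm_cube_add_sub_le hKG hbB1 hd'1 hcρ hwb
  have h5 : ‖G c c ρ - G a a ρ‖ ≤ 3 * K * b₁ * (‖q‖ + h) := by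
    have e2 : G c c ρ - G a a ρ
        = G c r ρ + G r a ρ := by
      rw [hc]
      simp only [map_add, add_apply]
      abel
    have h6 := norm_trilinear_le G hKG hcb hrq hρb
    have h7 := norm_trilinear_le G hKG hrq hab hρb
    have hqh : 0 ≤ ‖q‖ + h := by positivity
    have h8 : K * (b₁ * B) * (‖q‖ + h) * d ≤ K * b₁ * (‖q‖ + h) := by
      calc K * (b₁ * B) * (‖q‖ + h) * d = K * b₁ * (‖q‖ + h) * (B * d) := by ring
        _ ≤ K * b₁ * (‖q‖ + h) * 1 := by gcongr
        _ = _ := by ring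
    have h9 : K * (‖q‖ + h) * (Ca * B) * d ≤ K * b₁ * (‖q‖ + h) := by
      calc K * (‖q‖ + h) * (Ca * B) * d = K * Ca * (‖q‖ + h) * (B * d) := by ring
        _ ≤ K * b₁ * (‖q‖ + h) * 1 := by gcongr; linarith
        _ = _ := by ring
    have h10 : 0 ≤ K * b₁ * (‖q‖ + h) := by positivity
    rw [e2]
    refine (norm_add_le _ _).trans ?_
    linarith
  have h6 := norm_trilinear_le G hKG hcb hρb hρb
  have h7 := norm_trilinear_le G hKG hρb hρb hρb
  have h8 : ‖(3 : ℝ) • (G c c ρ - G a a ρ) + (3 : ℝ) • G c ρ ρ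
          + G ρ ρ ρ‖ ≤ 9 * K * b₁ * (‖q‖ + h) + 4 * K * b₁ * (B * d ^ 2) := by
    refine norm_add₃_le.trans ?_
    rw [norm_smul, norm_smul, Real.norm_of_nonneg (by norm_num : (0 : ℝ) ≤ 3)]
    have h9 : K * d * d * d ≤ K * b₁ * (B * d ^ 2) := by
      calc K * d * d * d = K * d * d ^ 2 := by ring
        _ ≤ K * (b₁ * B) * d ^ 2 := by gcongr; linarith
        _ = _ := by ring
    have h10 : K * (b₁ * B) * d * d = K * b₁ * (B * d ^ 2) := by ring
    linarith
  have hB2 : 1 ≤ B ^ 2 := one_le_pow₀ hB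
  have hb2 : b₁ ≤ b₁ ^ 2 := le_self_pow₀ hb₁1 (by norm_num)
  have hb21 : 1 ≤ b₁ ^ 2 := one_le_pow₀ hb₁1
  have hq0 := norm_nonneg q
  -- all the terms except the dissipative one
  have h9 : K * (‖q‖ + h + d') + 7 * K * (b₁ * B) ^ 2 * h + 7 * K * (b₁ * B) ^ 2 * d'
      + (9 * K * b₁ * (‖q‖ + h) + 4 * K * b₁ * (B * d ^ 2)) ≤ C₁ * ‖q‖ + C₁ * E := by
    have hx1 : K * ‖q‖ ≤ K * b₁ ^ 2 * ‖q‖ := by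
      calc K * ‖q‖ = K * 1 * ‖q‖ := by ring
        _ ≤ _ := by gcongr
    have hx2 : K * b₁ * ‖q‖ ≤ K * b₁ ^ 2 * ‖q‖ := by gcongr
    have hx3 : K * (h + d') ≤ K * b₁ ^ 2 * (B ^ 2 * (h + d')) := by
      calc K * (h + d') = K * 1 * (1 * (h + d')) := by ring
        _ ≤ _ := by gcongr
    have hx4 : K * b₁ * h ≤ K * b₁ ^ 2 * (B ^ 2 * (h + d')) := by
      calc K * b₁ * h = K * b₁ * (1 * (h + 0)) := by ring
        _ ≤ _ := by gcongr
    have hx5 : K * b₁ * (B * d ^ 2) ≤ K * b₁ ^ 2 * (B * d ^ 2) := by gcongr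
    have hx6 : 0 ≤ K * b₁ ^ 2 * ‖q‖ := by positivity
    have hx7 : 0 ≤ K * b₁ ^ 2 * (B ^ 2 * (h + d')) := by positivity
    have hx8 : 0 ≤ K * b₁ ^ 2 * (B * d ^ 2) := by positivity
    have hx9 : 7 * K * (b₁ * B) ^ 2 * h + 7 * K * (b₁ * B) ^ 2 * d'
        = 7 * (K * b₁ ^ 2 * (B ^ 2 * (h + d'))) := by ring
    have hx10 : C₁ * ‖q‖ + C₁ * E = 40 * (K * b₁ ^ 2 * ‖q‖)
        + 40 * (K * b₁ ^ 2 * (B ^ 2 * (h + d'))) + 40 * (K * b₁ ^ 2 * (B * d ^ 2)) := by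
      rw [hC₁, hE]; ring
    rw [hx10]
    linarith
  have hin : ∀ x : X, ∀ y : ℝ, ‖x‖ ≤ y → inner ℝ x q ≤ y * ‖q‖ := fun x y hxy =>
    (real_inner_le_norm _ _).trans (by gcongr)
  have i1 := hin _ _ h1
  have i3 := hin _ _ h3
  have i4 := hin _ _ h4
  have i8 := hin _ _ h8
  rw [real_inner_comm, e1, inner_add_left, inner_add_left, inner_add_left, inner_add_left]
  have h10 := mul_le_mul_of_nonneg_right h9 hq0
  linarith

variable [CompleteSpace X]

/-- Let `U = a + r + ρ + w`, where `a` is the amplitude, `ρ` a fast perturbation and `w` a small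
one, and let `r` collect the error in the kernel. If the averaged effect of `ρ` on the linearized
equation is at most `h`, then `r` is of order `B² (h + d') + B d²`. The energy estimate is applied
to `r` minus that averaged effect; the sign condition absorbs the linearization at `a`, which is too
large for Gronwall's inequality alone. -/
lemma IsDissipativeCubic.exists_remainder_bound (hG : IsDissipativeCubic N G) (Ac : X →L[ℝ] X)
    (Ca T₀ : ℝ) (hCa : 1 ≤ Ca) :
    ∃ C : ℝ, 1 ≤ C ∧ ∀ (T B d d' h : ℝ) (a r ρ w : ℝ → X), 0 ≤ T → T ≤ T₀ → 1 ≤ B →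
      B * d ≤ 1 → d' ≤ 1 → h ≤ 1 →
      ContinuousOn a (Set.Icc 0 T) → ContinuousOn r (Set.Icc 0 T) →
      ContinuousOn ρ (Set.Icc 0 T) → ContinuousOn w (Set.Icc 0 T) →
      (∀ t ∈ Set.Icc 0 T, a t ∈ N) → (∀ t ∈ Set.Icc 0 T, r t ∈ N) →
      (∀ t ∈ Set.Icc 0 T, (∫ s in (0 : ℝ)..t, (Ac (ρ s) + (3 : ℝ) • G (a s) (a s) (ρ s))) ∈ N) →
      (∀ t ∈ Set.Icc 0 T, ‖a t‖ ≤ Ca * B) → (∀ t ∈ Set.Icc 0 T, ‖r t‖ ≤ 1) →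
      (∀ t ∈ Set.Icc 0 T, ‖ρ t‖ ≤ d) → (∀ t ∈ Set.Icc 0 T, ‖w t‖ ≤ d') →
      (∀ t ∈ Set.Icc 0 T,
        ‖∫ s in (0 : ℝ)..t, (Ac (ρ s) + (3 : ℝ) • G (a s) (a s) (ρ s))‖ ≤ h) →
      (∀ t ∈ Set.Icc 0 T, r t = ∫ s in (0 : ℝ)..t, (Ac (r s + ρ s + w s)
        + (G (a s + r s + ρ s + w s) (a s + r s + ρ s + w s) (a s + r s + ρ s + w s)
          - G (a s) (a s) (a s)))) →
      ∀ t ∈ Set.Icc 0 T, ‖r t‖ ≤ C * (B ^ 2 * (h + d') + B * d ^ 2) := by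
  set K := ‖Ac‖ + ‖G‖ with hK
  have hK0 : 0 ≤ K := by positivity
  have hKA : ‖Ac‖ ≤ K := by rw [hK]; linarith [norm_nonneg G]
  have hKG : ‖G‖ ≤ K := by rw [hK]; linarith [norm_nonneg Ac]
  set b₁ := Ca + 2 with hb₁
  have hb₁1 : 1 ≤ b₁ := by linarith
  set C₁ := 40 * K * b₁ ^ 2 with hC₁
  have hC₁0 : 0 ≤ C₁ := by positivity
  refine ⟨Real.exp (3 * C₁ * |T₀|) + 1, by linarith [Real.exp_pos (3 * C₁ * |T₀|)], ?_⟩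
  intro T B d d' h a r ρ w hT hTT hB hBd hd'1 hh1 hac hrc hρc hwc haN hrN hhN hab hrb hρb hwb hhb
    hreq t₁ ht₁
  have h0I : (0 : ℝ) ∈ Set.Icc 0 T := ⟨le_rfl, hT⟩
  have hd0 : 0 ≤ d := (norm_nonneg _).trans (hρb 0 h0I)
  have hd'0 : 0 ≤ d' := (norm_nonneg _).trans (hwb 0 h0I)
  have hh0 : 0 ≤ h := (norm_nonneg _).trans (hhb 0 h0I)
  have hd1 : d ≤ 1 := by nlinarith
  set E := B ^ 2 * (h + d') + B * d ^ 2 with hE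
  have hE0 : 0 ≤ E := by positivity
  set θ : ℝ → X := fun s => Ac (ρ s) + (3 : ℝ) • G (a s) (a s) (ρ s) with hθ
  set p : ℝ → X := fun s => Ac (r s + ρ s + w s)
        + (G (a s + r s + ρ s + w s) (a s + r s + ρ s + w s) (a s + r s + ρ s + w s)
          - G (a s) (a s) (a s)) with hp
  have hUc : ContinuousOn (fun s => a s + r s + ρ s + w s) (Set.Icc 0 T) :=
    ((hac.add hrc).add hρc).add hwc
  have hθc : ContinuousOn θ (Set.Icc 0 T) :=
    (Ac.continuous.comp_continuousOn hρc).add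
      ((((G.continuous.comp_continuousOn hac).clm_apply hac).clm_apply hρc).const_smul _)
  have hpc : ContinuousOn p (Set.Icc 0 T) :=
    (Ac.continuous.comp_continuousOn ((hrc.add hρc).add hwc)).add
      ((((G.continuous.comp_continuousOn hUc).clm_apply hUc).clm_apply hUc).sub
        (((G.continuous.comp_continuousOn hac).clm_apply hac).clm_apply hac))
  set H : ℝ → X := fun t => ∫ s in (0 : ℝ)..t, θ s with hH
  set q : ℝ → X := fun t => r t - H t with hq
  have hii : ∀ {f : ℝ → X}, ContinuousOn f (Set.Icc 0 T) → ∀ t ∈ Set.Icc 0 T,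
      IntervalIntegrable f volume 0 t := fun hf t ht =>
    (hf.mono (by rw [Set.uIcc_of_le ht.1]; exact Set.Icc_subset_Icc_right ht.2)).intervalIntegrable
  have hqeq : ∀ t ∈ Set.Icc 0 T, q t = 0 + ∫ s in (0 : ℝ)..t, (p s - θ s) := fun t ht => by
    rw [zero_add, intervalIntegral.integral_sub (hii hpc t ht) (hii hθc t ht), ← hreq t ht]
  have hmain : ∀ t ∈ Set.Icc 0 T, inner ℝ (q t) (p t - θ t) ≤ C₁ * ‖q t‖ ^ 2 + C₁ * E * ‖q t‖ := by
    intro t ht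
    have hrt : r t = q t + H t := by simp [hq]
    exact hG.inner_vectorField_le Ac hK0 hKA hKG hCa hB hBd hd'1 hh1 hd0 hrt (haN t ht)
      (N.sub_mem (hrN t ht) (hhN t ht)) (hab t ht) (hrb t ht) (hρb t ht) (hwb t ht) (hhb t ht)
  -- Gronwall's inequality for `‖q‖² + E²`
  have henergy := norm_sq_sub_le_of_inner_le (l := 3 * C₁) (m := -E ^ 2) (hpc.sub hθc) hqeq
    (fun t ht => by
      have h1 := hmain t ht
      have h2 : C₁ * (2 * (E * ‖q t‖)) ≤ C₁ * (E ^ 2 + ‖q t‖ ^ 2) := by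
        gcongr
        nlinarith [sq_nonneg (E - ‖q t‖)]
      have h3 : 0 ≤ C₁ * E ^ 2 := by positivity
      change 2 * inner ℝ (q t) (p t - θ t) ≤ _
      linarith)
  have h1 := henergy t₁ ht₁
  rw [norm_zero] at h1
  have h2 : Real.exp (3 * C₁ * t₁) ≤ Real.exp (3 * C₁ * |T₀|) := by
    gcongr
    exact (ht₁.2.trans hTT).trans (le_abs_self _)
  set M := Real.exp (3 * C₁ * |T₀|) with hM
  have hM1 : 1 ≤ M := Real.one_le_exp (by positivity)
  have h3 : ‖q t₁‖ ^ 2 ≤ (E * M) ^ 2 := by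
    have h4 : E ^ 2 * Real.exp (3 * C₁ * t₁) ≤ E ^ 2 * M := by gcongr
    have h5 : E ^ 2 * M ≤ E ^ 2 * M ^ 2 := by gcongr; exact le_self_pow₀ hM1 (by norm_num)
    have h6 : 0 ≤ E ^ 2 := by positivity
    rw [mul_pow]
    linarith
  have h4 : ‖q t₁‖ ≤ E * M := abs_le_of_sq_le_sq' h3 (by positivity) |>.2
  have h5 : h ≤ E := by
    have hB2 : 1 ≤ B ^ 2 := one_le_pow₀ hB
    have : 0 ≤ B * d ^ 2 := by positivity
    rw [hE]
    nlinarith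
  have hr1 : r t₁ = q t₁ + H t₁ := by simp [hq]
  rw [hr1]
  calc ‖q t₁ + H t₁‖ ≤ E * M + E := (norm_add_le _ _).trans (add_le_add h4 ((hhb t₁ ht₁).trans h5))
    _ = _ := by ring

end Remainder

/-! ### The projected nonlinearity -/

section Projected

set_option maxSynthPendingDepth 3

variable {X : Type u} [NormedAddCommGroup X] [InnerProductSpace ℝ X]

lemma exists_curry_three {Y : Type*} [NormedAddCommGroup Y] [NormedSpace ℝ Y]
    (f : X [×3]→L[ℝ] Y) :
    ∃ G : X →L[ℝ] X →L[ℝ] X →L[ℝ] Y, ∀ u v w, G u v w = f ![u, v, w] := by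
  let c₁ : (X [×1]→L[ℝ] Y) →L[ℝ] X →L[ℝ] Y :=
    (continuousMultilinearCurryFin1 ℝ X Y).toContinuousLinearEquiv.toContinuousLinearMap
  let c₂ : (X [×2]→L[ℝ] Y) →L[ℝ] X →L[ℝ] X [×1]→L[ℝ] Y :=
    (continuousMultilinearCurryLeftEquiv ℝ (fun _ : Fin 2 => X)
      Y).toContinuousLinearEquiv.toContinuousLinearMap
  refine ⟨(ContinuousLinearMap.compL ℝ X (X [×1]→L[ℝ] Y) (X →L[ℝ] Y) c₁).comp
    (c₂.comp f.curryLeft), fun u v w => ?_⟩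
  change f (Fin.cons u (Fin.cons v (Fin.snoc 0 w))) = _
  congr 1
  ext i
  fin_cases i <;> rfl

/-- The curried form of `F_c = P_c F`. -/
lemma CubicAssumption.exists_isDissipativeCubic {L : X →ₗ.[ℝ] X} [FiniteDimensional ℝ (kerOf L)]
    {S : ℝ → X →L[ℝ] X} {α : ℝ} {F : X [×3]→L[ℝ] NegSpace S α} (hF : CubicAssumption L S α F)
    {PC : NegSpace S α →L[ℝ] X} (hPC : ∀ y, extendNeg S α (projC L) y = PC y) :
    ∃ G : X →L[ℝ] X →L[ℝ] X →L[ℝ] X, (∀ u v w, G u v w = PC (F ![u, v, w])) ∧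
      IsDissipativeCubic (kerOf L) G := by
  obtain ⟨G, hG⟩ := exists_curry_three (PC.compContinuousMultilinearMap F)
  have hG' : ∀ u v w, G u v w = PC (F ![u, v, w]) := hG
  refine ⟨G, hG', ?_, ?_, ?_, ?_⟩
  · intro u v w
    rw [hG', hG', ← hF.symmetric (Equiv.swap 0 1) ![u, v, w]]
    congr 2
    ext i
    fin_cases i <;> rfl
  · intro u v w
    rw [hG', hG', ← hF.symmetric (Equiv.swap 1 2) ![u, v, w]]
    congr 2
    ext i
    fin_cases i <;> rfl
  · intro v hv w hw
    rcases eq_or_ne v 0 with rfl | hv0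
    · simp
    rcases eq_or_ne w 0 with rfl | hw0
    · simp
    rw [hG', ← hPC]
    exact (hF.sign_linearized v hv w hw hv0 hw0).le
  · obtain ⟨η, C, hη, hC, h⟩ := hF.dissipative
    refine ⟨η, C, hη, hC, fun v hv φ hφ => ?_⟩
    rw [hG', ← hPC]
    exact h v hv φ hφ

end Projected

/-! ### Averaging of the fast Ornstein-Uhlenbeck process -/

section Fast

variable {X : Type u} [NormedAddCommGroup X]

lemma norm_le_of_hoelderNorm_le {β T c : ℝ} (hβ : 0 < β) (hc : 0 ≤ c) {f : ℝ → X}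
    (h : hoelderNorm β T f ≤ ENNReal.ofReal c) :
    (∀ t ∈ Set.Icc 0 T, ‖f t‖ ≤ c) ∧
      ∀ s t, 0 ≤ s → s ≤ t → t ≤ T → ‖f t - f s‖ ≤ c * (t - s) ^ β := by
  have h1 : (⨆ t : Set.Icc (0 : ℝ) T, ‖f t‖ₑ) ≤ ENNReal.ofReal c := le_self_add.trans h
  have h2 : eHolderNorm β.toNNReal (fun t : Set.Icc (0 : ℝ) T => f t) ≤ ENNReal.ofReal c :=
    le_add_self.trans h
  refine ⟨fun t ht => ?_, fun s t hs hst ht => ?_⟩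
  · have h3 : ‖f t‖ₑ ≤ ENNReal.ofReal c :=
      (le_iSup (fun t : Set.Icc (0 : ℝ) T => ‖f t‖ₑ) ⟨t, ht⟩).trans h1
    rw [← ofReal_norm] at h3
    exact (ENNReal.ofReal_le_ofReal_iff hc).1 h3
  · have hne : eHolderNorm β.toNNReal (fun t : Set.Icc (0 : ℝ) T => f t) ≠ ⊤ :=
      (h2.trans_lt ENNReal.ofReal_lt_top).ne
    have hm : MemHolder β.toNNReal (fun t : Set.Icc (0 : ℝ) T => f t) :=
      eHolderNorm_ne_top.1 hne
    have h4 := hm.holderWith.dist_le (⟨t, hs.trans hst, ht⟩ : Set.Icc (0 : ℝ) T)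
      ⟨s, hs, hst.trans ht⟩
    have h5 : ((nnHolderNorm β.toNNReal (fun t : Set.Icc (0 : ℝ) T => f t) : ℝ≥0) : ℝ) ≤ c := by
      rw [← hm.coe_nnHolderNorm_eq_eHolderNorm] at h2
      rw [← ENNReal.ofReal_coe_nnreal] at h2
      exact (ENNReal.ofReal_le_ofReal_iff hc).1 h2
    rw [dist_eq_norm, Real.coe_toNNReal _ hβ.le] at h4
    have h6 : dist (⟨t, hs.trans hst, ht⟩ : Set.Icc (0 : ℝ) T) ⟨s, hs, hst.trans ht⟩ = t - s := by
      rw [Subtype.dist_eq, Real.dist_eq, abs_of_nonneg (sub_nonneg.2 hst)]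
    rw [h6] at h4
    refine h4.trans ?_
    have : 0 ≤ (t - s) ^ β := Real.rpow_nonneg (sub_nonneg.2 hst) _
    gcongr

/-- Interpolation between a Hölder bound and a Lipschitz bound. -/
lemma le_mul_rpow_of_le_of_le {x p q τ β θ : ℝ} (hx : 0 ≤ x) (hp : 0 ≤ p) (hq : 0 ≤ q) (hτ : 0 < τ)
    (hθ0 : 0 ≤ θ) (hθ1 : θ ≤ 1) (h1 : x ≤ p * τ ^ β) (h2 : x ≤ q * τ) :
    x ≤ p ^ (1 - θ) * q ^ θ * τ ^ (β * (1 - θ) + θ) := by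
  have hθ' : 0 ≤ 1 - θ := by linarith
  rcases hx.eq_or_lt with rfl | hx
  · positivity
  calc x = x ^ (1 - θ) * x ^ θ := by rw [← Real.rpow_add hx]; simp
    _ ≤ (p * τ ^ β) ^ (1 - θ) * (q * τ) ^ θ := by gcongr
    _ = _ := by
      rw [Real.mul_rpow hp (by positivity), Real.mul_rpow hq hτ.le, ← Real.rpow_mul hτ.le,
        Real.rpow_add hτ]
      ring

variable [InnerProductSpace ℝ X] {L : X →ₗ.[ℝ] X} [FiniteDimensional ℝ (kerOf L)]
  {S : ℝ → X →L[ℝ] X}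

/-- The integral of the fast Ornstein-Uhlenbeck process is a bounded function of the increments of
the noise and of the process itself. -/
lemma IsStableInverse.integral_fast {R : X →L[ℝ] X} (hL : OperatorAssumption L S)
    (hR : IsStableInverse L S R) {w z : ℝ → X} {v₀ : X} (hz : ContinuousOn z (Set.Ici 0))
    (hzR : ∀ t, 0 ≤ t → ∫ τ in (0 : ℝ)..t, projS L (z τ) = R (w t - z t))
    (hv₀ : projS L v₀ = v₀) {s t : ℝ} (hs : 0 ≤ s) (hst : s ≤ t) :
    ∫ τ in s..t, (S τ v₀ + projS L (z τ))
      = R (w t - w s) - R (S t v₀ + projS L (z t)) + R (S s v₀ + projS L (z s)) := by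
  have ht : 0 ≤ t := hs.trans hst
  have hzs : ContinuousOn (fun τ => projS L (z τ)) (Set.Ici 0) :=
    (projS L).continuous.comp_continuousOn hz
  have hsub : ∀ a b : ℝ, 0 ≤ a → 0 ≤ b → Set.uIcc a b ⊆ Set.Ici 0 := fun a b ha hb x hx =>
    (le_min ha hb).trans hx.1
  have hi : ∀ a b : ℝ, 0 ≤ a → 0 ≤ b →
      IntervalIntegrable (fun τ => projS L (z τ)) volume a b := fun a b ha hb =>
    (hzs.mono (hsub a b ha hb)).intervalIntegrable
  have hSi : IntervalIntegrable (fun τ => S τ v₀) volume s t :=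
    ((hL.semigroup.continuous v₀).mono (hsub s t hs ht)).intervalIntegrable
  have e1 : ∫ τ in s..t, projS L (z τ) = R (w t - z t) - R (w s - z s) := by
    rw [← intervalIntegral.integral_interval_sub_left (hi 0 t le_rfl ht) (hi 0 s le_rfl hs),
      hzR t ht, hzR s hs]
  have e2 : ∫ τ in s..t, S τ v₀ = R (S s v₀) - R (S t v₀) := by
    rw [hR.apply_sub_apply hL v₀ hs hst]
    refine intervalIntegral.integral_congr fun τ hτ => ?_
    have : 0 ≤ τ := hsub s t hs ht hτ
    simp only [max_eq_left this, hv₀]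
  rw [intervalIntegral.integral_add hSi (hi s t hs ht), e1, e2]
  simp only [map_add, map_sub, hR.comp_projS]
  abel

/-- In slow time the fast process `ρ` is small, and its primitive is smaller still: it is of order
`ε²` in the Hölder norm of the noise. -/
lemma IsStableInverse.exists_fast_bound {R : X →L[ℝ] X} (hL : OperatorAssumption L S)
    (hR : IsStableInverse L S R) :
    ∃ C : ℝ, 1 ≤ C ∧ ∀ (ε H β B T₀ : ℝ) (w z : ℝ → X) (v₀ : X), 0 < ε → ε ≤ 1 → 0 ≤ β → β ≤ H → β ≤ 1 →
      0 ≤ B → ContinuousOn z (Set.Ici 0) →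
      (∀ t, 0 ≤ t → ∫ τ in (0 : ℝ)..t, projS L (z τ) = R (w t - z t)) →
      projS L v₀ = v₀ → ‖v₀‖ ≤ B → (∀ t ∈ Set.Icc 0 (T₀ / ε ^ 2), ‖projS L (z t)‖ ≤ B) →
      (∀ s t, 0 ≤ s → s ≤ t → t ≤ T₀ →
        ‖w (t / ε ^ 2) - w (s / ε ^ 2)‖ ≤ ε ^ (-2 * H) * B * (t - s) ^ β) →
      (∀ t ∈ Set.Icc 0 T₀,
        ‖ε ^ (2 * H) • (S (t / ε ^ 2) v₀ + projS L (z (t / ε ^ 2)))‖ ≤ C * (ε ^ (2 * H) * B)) ∧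
      ∀ s t, 0 ≤ s → s ≤ t → t ≤ T₀ →
        ‖∫ τ in s..t, ε ^ (2 * H) • (S (τ / ε ^ 2) v₀ + projS L (z (τ / ε ^ 2)))‖
          ≤ C * (ε ^ (2 * H) * B) * (t - s) ∧
        ‖∫ τ in s..t, ε ^ (2 * H) • (S (τ / ε ^ 2) v₀ + projS L (z (τ / ε ^ 2)))‖
          ≤ C * (ε ^ 2 * B) * (t - s) ^ β := by
  obtain ⟨K, hK1, hK⟩ := hL.exists_bound
  have hR0 := norm_nonneg R
  refine ⟨(K + 1) + ‖R‖ + 2 * (‖R‖ * (K + 1)), by nlinarith, ?_⟩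
  intro ε H β B T₀ w z v₀ hε hε1 hβ0 hβH hβ1 hB hz hzR hv₀ hv₀B hzB hw
  set C := (K + 1) + ‖R‖ + 2 * (‖R‖ * (K + 1)) with hC
  have hRK : 0 ≤ ‖R‖ * (K + 1) := by positivity
  have hKC : K + 1 ≤ C := by rw [hC]; linarith
  have hε2 : 0 < ε ^ 2 := by positivity
  set y : ℝ → X := fun t => S t v₀ + projS L (z t) with hy
  have hyb : ∀ t ∈ Set.Icc 0 T₀, ‖y (t / ε ^ 2)‖ ≤ (K + 1) * B := fun t ht => by
    have h0 : 0 ≤ t / ε ^ 2 := div_nonneg ht.1 hε2.le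
    have h1 : ‖S (t / ε ^ 2) v₀‖ ≤ K * B :=
      ((S (t / ε ^ 2)).le_of_opNorm_le (hK _ h0) v₀).trans (by gcongr)
    have h2 := hzB (t / ε ^ 2) ⟨h0, by gcongr; exact ht.2⟩
    calc ‖y (t / ε ^ 2)‖ ≤ K * B + B := (norm_add_le _ _).trans (add_le_add h1 h2)
      _ = _ := by ring
  have hH0 : 0 < ε ^ (2 * H) := Real.rpow_pos_of_pos hε _
  have hρb : ∀ t ∈ Set.Icc 0 T₀, ‖ε ^ (2 * H) • y (t / ε ^ 2)‖ ≤ (K + 1) * (ε ^ (2 * H) * B) :=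
    fun t ht => by
      rw [norm_smul, Real.norm_of_nonneg hH0.le]
      calc ε ^ (2 * H) * ‖y (t / ε ^ 2)‖ ≤ ε ^ (2 * H) * ((K + 1) * B) := by
            gcongr; exact hyb t ht
        _ = _ := by ring
  refine ⟨fun t ht => (hρb t ht).trans (by gcongr), fun s t hs hst ht => ?_⟩
  have hts : 0 ≤ t - s := sub_nonneg.2 hst
  have h1 : ‖∫ τ in s..t, ε ^ (2 * H) • y (τ / ε ^ 2)‖
      ≤ (K + 1) * (ε ^ (2 * H) * B) * (t - s) := by
    have := intervalIntegral.norm_integral_le_of_norm_le_const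
      (f := fun τ => ε ^ (2 * H) • y (τ / ε ^ 2)) (a := s) (b := t)
      (C := (K + 1) * (ε ^ (2 * H) * B)) (fun τ hτ => by
        rw [Set.uIoc_of_le hst] at hτ
        exact hρb τ ⟨hs.trans hτ.1.le, hτ.2.trans ht⟩)
    rwa [abs_of_nonneg hts] at this
  refine ⟨h1.trans (by gcongr), ?_⟩
  rcases hts.eq_or_lt with h0 | h0
  · have : s = t := by linarith
    subst this
    rw [intervalIntegral.integral_same, norm_zero]
    have : 0 ≤ (s - s) ^ β := Real.rpow_nonneg hts _
    positivity
  have hτβ : 0 < (t - s) ^ β := Real.rpow_pos_of_pos h0 _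
  have hεβ : ∀ r : ℝ, (ε ^ 2) ^ r = ε ^ (2 * r) := fun r => by
    rw [← Real.rpow_natCast, ← Real.rpow_mul hε.le]; norm_num
  rcases le_total (t - s) (ε ^ 2) with hle | hle
  · -- below the fast time scale the trivial bound is the better one
    have h2 : (t - s) ^ (1 - β) ≤ ε ^ (2 * (1 - β)) := by
      rw [← hεβ]
      exact Real.rpow_le_rpow hts hle (by linarith)
    have h3 : ε ^ (2 * H) * ε ^ (2 * (1 - β)) ≤ ε ^ 2 := by
      rw [← Real.rpow_add hε, ← Real.rpow_natCast ε 2]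
      exact Real.rpow_le_rpow_of_exponent_ge hε hε1 (by push_cast; linarith)
    calc _ ≤ (K + 1) * (ε ^ (2 * H) * B) * (t - s) := h1
      _ = (K + 1) * B * (t - s) ^ β * (ε ^ (2 * H) * (t - s) ^ (1 - β)) := by
        have : t - s = (t - s) ^ β * (t - s) ^ (1 - β) := by
          rw [← Real.rpow_add h0]; simp
        nth_rw 1 [this]
        ring
      _ ≤ (K + 1) * B * (t - s) ^ β * ε ^ 2 := by
        gcongr
        exact le_trans (by gcongr) h3
      _ = (K + 1) * (ε ^ 2 * B) * (t - s) ^ β := by ring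
      _ ≤ _ := by gcongr
  · -- above it the boundary terms `R y` are at most of the size of the noise increment
    have hsε : 0 ≤ s / ε ^ 2 := div_nonneg hs hε2.le
    have e1 : ∫ τ in s..t, ε ^ (2 * H) • y (τ / ε ^ 2)
        = (ε ^ (2 * H) * ε ^ 2) • (R (w (t / ε ^ 2) - w (s / ε ^ 2)) - R (y (t / ε ^ 2))
          + R (y (s / ε ^ 2))) := by
      rw [← hR.integral_fast hL hz hzR hv₀ hsε (by gcongr), intervalIntegral.integral_smul,
        intervalIntegral.integral_comp_div _ hε2.ne', smul_smul]
    have h2 : ε ^ (2 * H) ≤ (t - s) ^ β := by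
      calc ε ^ (2 * H) ≤ ε ^ (2 * β) := Real.rpow_le_rpow_of_exponent_ge hε hε1 (by linarith)
        _ = (ε ^ 2) ^ β := (hεβ β).symm
        _ ≤ _ := by gcongr
    have h3 : ‖R (w (t / ε ^ 2) - w (s / ε ^ 2)) - R (y (t / ε ^ 2)) + R (y (s / ε ^ 2))‖
        ≤ ‖R‖ * (ε ^ (-2 * H) * B * (t - s) ^ β) + 2 * (‖R‖ * (K + 1)) * B := by
      have h4 : ‖R (w (t / ε ^ 2) - w (s / ε ^ 2))‖
          ≤ ‖R‖ * (ε ^ (-2 * H) * B * (t - s) ^ β) :=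
        (R.le_opNorm _).trans (by gcongr; exact hw s t hs hst ht)
      have h5 : ‖R (y (t / ε ^ 2))‖ ≤ ‖R‖ * ((K + 1) * B) :=
        (R.le_opNorm _).trans (by gcongr; exact hyb t ⟨hs.trans hst, ht⟩)
      have h6 : ‖R (y (s / ε ^ 2))‖ ≤ ‖R‖ * ((K + 1) * B) :=
        (R.le_opNorm _).trans (by gcongr; exact hyb s ⟨hs, hst.trans ht⟩)
      refine (norm_add_le _ _).trans ((add_le_add_left (norm_sub_le _ _) _).trans ?_)
      linarith
    have h7 : ε ^ (2 * H) * ε ^ (-2 * H) = 1 := by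
      rw [← Real.rpow_add hε, show 2 * H + -2 * H = 0 by ring, Real.rpow_zero]
    rw [e1, norm_smul, Real.norm_of_nonneg (by positivity)]
    calc _ ≤ ε ^ (2 * H) * ε ^ 2 * (‖R‖ * (ε ^ (-2 * H) * B * (t - s) ^ β)
          + 2 * (‖R‖ * (K + 1)) * B) := by gcongr
      _ = (ε ^ (2 * H) * ε ^ (-2 * H)) * ‖R‖ * (ε ^ 2 * B) * (t - s) ^ β
          + 2 * (‖R‖ * (K + 1)) * (ε ^ 2 * B) * ε ^ (2 * H) := by ring
      _ ≤ 1 * ‖R‖ * (ε ^ 2 * B) * (t - s) ^ β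
          + 2 * (‖R‖ * (K + 1)) * (ε ^ 2 * B) * (t - s) ^ β := by rw [h7]; gcongr
      _ = (‖R‖ + 2 * (‖R‖ * (K + 1))) * (ε ^ 2 * B) * (t - s) ^ β := by ring
      _ ≤ _ := by gcongr; rw [hC]; linarith

end Fast

section Average

/-- For `H > 1/2` the Hölder exponent `β` of the noise suffices for Young's estimate. For `H ≤ 1/2`
the two bounds for the primitive of the fast process are interpolated, at the cost of powers of `ε`,
so that the Hölder exponents add up to `1 + κ`. -/
lemma exists_interpolated_exponent {H κ β : ℝ} (hκ : 0 < κ) (hκH : 2 * κ ≤ H) (hH1 : H < 1)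
    (hβ1 : 1 / 2 < H → 1 / 2 < β ∧ β < H) (hβ2 : H ≤ 1 / 2 → β = H - κ) :
    ∃ γ e : ℝ, 0 ≤ γ ∧ 1 < β + γ ∧ (1 / 2 < H → e = 2 - κ) ∧ (H ≤ 1 / 2 → e = 4 * H - 7 * κ) ∧
      ∀ ε C τ x : ℝ, 0 < ε → ε ≤ 1 → 0 ≤ C → 0 ≤ τ → 0 ≤ x →
        x ≤ C * (ε ^ (2 * H) * ε ^ (-κ)) * τ → x ≤ C * (ε ^ 2 * ε ^ (-κ)) * τ ^ β →
        x ≤ C * ε ^ e * τ ^ γ := by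
  have hp : ∀ ε : ℝ, 0 < ε → ε ^ 2 * ε ^ (-κ) = ε ^ (2 - κ) := fun ε hε => by
    rw [← Real.rpow_natCast ε 2, ← Real.rpow_add hε]; norm_num [sub_eq_add_neg]
  rcases lt_or_ge (1 / 2) H with hH | hH
  · obtain ⟨h1, h2⟩ := hβ1 hH
    refine ⟨β, 2 - κ, by linarith, by linarith, fun _ => rfl, fun h => by linarith, ?_⟩
    intro ε C τ x hε _ _ _ _ _ hx
    rwa [hp ε hε] at hx
  · have hβ := hβ2 hH
    -- the weight for which `β + (β (1 - θ) + θ) = 1 + κ`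
    set θ : ℝ := (1 - 2 * β + κ) / (1 - β) with hθ
    have h1β : 0 < 1 - β := by linarith
    have hθβ : θ * (1 - β) = 1 - 2 * β + κ := by rw [hθ]; field_simp
    have hθ0 : 0 ≤ θ := div_nonneg (by linarith) h1β.le
    have hθ1 : θ ≤ 1 := by rw [hθ, div_le_one h1β]; linarith
    refine ⟨β * (1 - θ) + θ, 4 * H - 7 * κ, ?_, by linarith, fun h => by linarith, fun _ => rfl, ?_⟩
    · have : 0 ≤ β * (1 - θ) := mul_nonneg (by linarith) (by linarith)
      linarith
    intro ε C τ x hε hε1 hC hτ hx h1 h2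
    rcases hτ.eq_or_lt with rfl | hτ
    · rw [mul_zero] at h1
      have : 0 ≤ (0 : ℝ) ^ (β * (1 - θ) + θ) := Real.rpow_nonneg le_rfl _
      exact h1.trans (by positivity)
    refine (le_mul_rpow_of_le_of_le hx (by positivity) (by positivity) hτ hθ0 hθ1 h2 h1).trans ?_
    have hτ' : 0 ≤ τ ^ (β * (1 - θ) + θ) := Real.rpow_nonneg hτ.le _
    refine mul_le_mul_of_nonneg_right ?_ hτ'
    have hC1 : C ^ (1 - θ) * C ^ θ = C := by
      rcases hC.eq_or_lt with rfl | hC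
      · rcases hθ0.eq_or_lt with h | h
        · rw [← h]; simp
        · rw [Real.zero_rpow h.ne', mul_zero]
      · rw [← Real.rpow_add hC]; simp
    have hexp : 4 * H - 7 * κ ≤ (2 - κ) * (1 - θ) + (2 * H + -κ) * θ := by
      have h3 : θ * (1 - H) ≤ 1 - 2 * β + κ := by
        rw [← hθβ]; gcongr; linarith
      linarith
    calc (C * (ε ^ 2 * ε ^ (-κ))) ^ (1 - θ) * (C * (ε ^ (2 * H) * ε ^ (-κ))) ^ θ
        = (C ^ (1 - θ) * C ^ θ) * ε ^ ((2 - κ) * (1 - θ) + (2 * H + -κ) * θ) := by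
          rw [hp ε hε, ← Real.rpow_add hε, Real.mul_rpow hC (by positivity),
            Real.mul_rpow hC (by positivity), ← Real.rpow_mul hε.le, ← Real.rpow_mul hε.le,
            Real.rpow_add hε]
          ring
      _ ≤ C * ε ^ (4 * H - 7 * κ) := by
        rw [hC1]
        gcongr ?_ * ?_
        exact Real.rpow_le_rpow_of_exponent_ge hε hε1 hexp

set_option maxSynthPendingDepth 3

variable {X : Type u} [NormedAddCommGroup X] [InnerProductSpace ℝ X] [CompleteSpace X]

/-- The effect of the fast perturbation `ρ` on the equation linearized at the amplitude `a` is
controlled by Young's estimate. -/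
lemma exists_average_bound (G : X →L[ℝ] X →L[ℝ] X →L[ℝ] X) (Ac : X →L[ℝ] X) {Ca T₀ β γ : ℝ}
    (hCa : 1 ≤ Ca) (hT₀ : 0 < T₀) (hβ0 : 0 < β) (hβ1 : β ≤ 1) (hγ : 0 ≤ γ) (hβγ : 1 < β + γ) :
    ∃ C : ℝ, 1 ≤ C ∧ ∀ (B k : ℝ) (a ρ : ℝ → X), 1 ≤ B → 0 ≤ k →
      ContinuousOn a (Set.Icc 0 T₀) → ContinuousOn ρ (Set.Icc 0 T₀) →
      (∀ t ∈ Set.Icc 0 T₀, ‖a t‖ ≤ Ca * B) →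
      (∀ s t, 0 ≤ s → s ≤ t → t ≤ T₀ →
        ‖a t - a s‖ ≤ Ca * B ^ 3 * (t - s) + B * (t - s) ^ β) →
      (∀ s t, 0 ≤ s → s ≤ t → t ≤ T₀ → ‖∫ τ in s..t, ρ τ‖ ≤ k * (t - s) ^ γ) →
      ∀ t ∈ Set.Icc 0 T₀,
        ‖∫ s in (0 : ℝ)..t, (Ac (ρ s) + (3 : ℝ) • G (a s) (a s) (ρ s))‖ ≤ C * (B ^ 4 * k) := by
  set K := ‖Ac‖ + ‖G‖ with hK
  have hK0 : 0 ≤ K := by positivity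
  have hKA : ‖Ac‖ ≤ K := by rw [hK]; linarith [norm_nonneg G]
  have hKG : ‖G‖ ≤ K := by rw [hK]; linarith [norm_nonneg Ac]
  set m : ℝ := 4 * K * Ca ^ 2 with hm
  set c : ℝ := 6 * K * Ca * (Ca * T₀ ^ (1 - β) + 1) with hc
  set D : ℝ := (1 - 2 ^ (1 - (β + γ)))⁻¹ with hD
  have hTγ : 0 < T₀ ^ γ := Real.rpow_pos_of_pos hT₀ _
  have hTβ : 0 < T₀ ^ (1 - β) := Real.rpow_pos_of_pos hT₀ _
  have hTβγ : 0 < T₀ ^ (β + γ) := Real.rpow_pos_of_pos hT₀ _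
  have hm0 : 0 ≤ m := by positivity
  have hc0 : 0 ≤ c := by positivity
  have hD0 : 0 ≤ D := by
    rw [hD, inv_nonneg, sub_nonneg]
    exact Real.rpow_le_one_of_one_le_of_nonpos (by norm_num) (by linarith)
  refine ⟨m * T₀ ^ γ + D * c * T₀ ^ (β + γ) + 1, by
    linarith [show 0 ≤ m * T₀ ^ γ + D * c * T₀ ^ (β + γ) by positivity], ?_⟩
  intro B k a ρ hB hk hac hρc hab hai hρi t ht
  have hB24 : B ^ 2 ≤ B ^ 4 := pow_le_pow_right₀ hB (by norm_num)
  have hB4 : 1 ≤ B ^ 4 := one_le_pow₀ hB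
  set g : ℝ → X →L[ℝ] X := fun s => Ac + (3 : ℝ) • G (a s) (a s) with hg
  have hgc : ContinuousOn g (Set.Icc 0 T₀) :=
    by
    have h : ContinuousOn (fun s => G (a s) (a s)) (Set.Icc 0 T₀) :=
      (G.continuous.comp_continuousOn hac).clm_apply hac
    exact continuousOn_const.add (h.const_smul (3 : ℝ))
  have hg0 : ‖g 0‖ ≤ m * B ^ 4 := by
    have h0 := hab 0 ⟨le_rfl, hT₀.le⟩
    have h1 : ‖G (a 0) (a 0)‖ ≤ K * (Ca * B) * (Ca * B) :=
      ((G (a 0)).le_opNorm _).trans (by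
        gcongr
        exact (G.le_opNorm _).trans (by gcongr))
    have h2 : ‖g 0‖ ≤ K + 3 * (K * (Ca * B) * (Ca * B)) := by
      refine (norm_add_le _ _).trans ?_
      rw [norm_smul, Real.norm_of_nonneg (by norm_num : (0 : ℝ) ≤ 3)]
      gcongr
    have h3 : K * (1 * 1) ≤ K * (Ca ^ 2 * B ^ 2) := by
      gcongr
      · exact one_le_pow₀ hCa
      · exact one_le_pow₀ hB
    have h4 : m * B ^ 2 ≤ m * B ^ 4 := by gcongr
    have h5 : m * B ^ 2 = 4 * (K * (Ca ^ 2 * B ^ 2)) := by rw [hm]; ring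
    have h6 : K * (Ca * B) * (Ca * B) = K * (Ca ^ 2 * B ^ 2) := by ring
    rw [h6] at h2
    linarith
  have hgi : ∀ s t, 0 ≤ s → s ≤ t → t ≤ T₀ → ‖g t - g s‖ ≤ (c * B ^ 4) * (t - s) ^ β := by
    intro s t hs hst ht
    have hts : 0 ≤ t - s := sub_nonneg.2 hst
    have hτ : 0 ≤ (t - s) ^ β := Real.rpow_nonneg hts _
    have h1 : t - s ≤ T₀ ^ (1 - β) * (t - s) ^ β := by
      rcases hts.eq_or_lt with h | h
      · rw [← h]; positivity
      · calc t - s = (t - s) ^ (1 - β) * (t - s) ^ β := by rw [← Real.rpow_add h]; simp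
          _ ≤ _ := by
            gcongr
            linarith
    have h2 : ‖a t - a s‖ ≤ (Ca * T₀ ^ (1 - β) + 1) * B ^ 3 * (t - s) ^ β := by
      have hB3 : B ≤ B ^ 3 := le_self_pow₀ hB (by norm_num)
      calc ‖a t - a s‖ ≤ Ca * B ^ 3 * (t - s) + B * (t - s) ^ β := hai s t hs hst ht
        _ ≤ Ca * B ^ 3 * (T₀ ^ (1 - β) * (t - s) ^ β) + B ^ 3 * (t - s) ^ β := by gcongr
        _ = _ := by ring
    have e1 : g t - g s = (3 : ℝ) • (G (a t - a s) (a t) + G (a s) (a t - a s)) := by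
      rw [hg]
      simp only [map_sub, sub_apply]
      module
    have h3 : ‖G (a t - a s) (a t)‖ ≤ K * ‖a t - a s‖ * (Ca * B) :=
      ((G _).le_opNorm _).trans (by
        gcongr
        · exact (G.le_opNorm _).trans (by gcongr)
        · exact hab t ⟨hs.trans hst, ht⟩)
    have h4 : ‖G (a s) (a t - a s)‖ ≤ K * (Ca * B) * ‖a t - a s‖ :=
      ((G _).le_opNorm _).trans (by
        gcongr
        exact (G.le_opNorm _).trans (by gcongr; exact hab s ⟨hs, hst.trans ht⟩))
    rw [e1, norm_smul, Real.norm_of_nonneg (by norm_num : (0 : ℝ) ≤ 3)]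
    calc 3 * ‖G (a t - a s) (a t) + G (a s) (a t - a s)‖
        ≤ 3 * (K * ‖a t - a s‖ * (Ca * B) + K * (Ca * B) * ‖a t - a s‖) := by
          gcongr; exact (norm_add_le _ _).trans (add_le_add h3 h4)
      _ = 6 * K * Ca * B * ‖a t - a s‖ := by ring
      _ ≤ 6 * K * Ca * B * ((Ca * T₀ ^ (1 - β) + 1) * B ^ 3 * (t - s) ^ β) := by gcongr
      _ = _ := by rw [hc]; ring
  have h1 := norm_integral_apply_le hβ0 hγ hβγ (c := c * B ^ 4) (by positivity) hk hgc hρc hg0 hgi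
    hρi ht
  have e2 : (fun s => Ac (ρ s) + (3 : ℝ) • G (a s) (a s) (ρ s)) = fun s => g s (ρ s) := by
    ext s; rw [hg]; rfl
  rw [e2]
  refine h1.trans ?_
  have h2 : 0 ≤ B ^ 4 * k := by positivity
  rw [← hD]
  linarith

end Average

/-! ### A continuation argument for the error -/

section Bootstrap

lemma le_one_of_continuation {f : ℝ → ℝ} {T : ℝ} (hf : ContinuousOn f (Set.Icc 0 T))
    (h0 : f 0 < 1)
    (h : ∀ t ∈ Set.Icc 0 T, (∀ s ∈ Set.Icc 0 t, f s ≤ 1) → f t < 1) :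
    ∀ t ∈ Set.Icc 0 T, f t ≤ 1 := by
  by_contra! hcon
  obtain ⟨t, ht, hft⟩ := hcon
  have hA : IsCompact (Set.Icc 0 t ∩ f ⁻¹' Set.Ici 1) :=
    (hf.mono (Set.Icc_subset_Icc_right ht.2)).preimage_isClosed_of_isClosed isClosed_Icc
      isClosed_Ici |> fun hc => isCompact_Icc.of_isClosed_subset hc Set.inter_subset_left
  obtain ⟨s, ⟨hs, hfs⟩, hmin⟩ := hA.exists_isLeast ⟨t, ⟨ht.1, le_rfl⟩, hft.le⟩
  have hsT : s ∈ Set.Icc 0 T := ⟨hs.1, hs.2.trans ht.2⟩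
  -- by minimality and the intermediate value theorem, `f` does not exceed `1` up to time `s`
  have h1 : f s ≤ 1 := by
    by_contra! hgt
    obtain ⟨r, hr, hfr⟩ := intermediate_value_Icc hs.1 (hf.mono (Set.Icc_subset_Icc_right hsT.2))
      (Set.mem_Icc.2 ⟨h0.le, hgt.le⟩)
    have := hmin ⟨⟨hr.1, hr.2.trans hs.2⟩, hfr.ge⟩
    have hrs : r = s := le_antisymm hr.2 this
    rw [hrs] at hfr
    linarith
  refine absurd (h s hsT fun r hr => ?_) (not_lt.2 hfs)
  rcases hr.2.eq_or_lt with rfl | hrs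
  · exact h1
  · by_contra! hgt
    exact absurd (hmin ⟨⟨hr.1, hr.2.trans hs.2⟩, hgt.le⟩) (not_le.2 hrs)

set_option maxSynthPendingDepth 3

variable {X : Type u} [NormedAddCommGroup X] [InnerProductSpace ℝ X] [CompleteSpace X]
  {N : Submodule ℝ X} {G : X →L[ℝ] X →L[ℝ] X →L[ℝ] X}

/-- The bound for the error `r` in the kernel and the bound for the stable error `w` hold as long
as both errors are at most one, and they improve on this; hence they hold throughout. -/
lemma IsDissipativeCubic.exists_error_bound (hG : IsDissipativeCubic N G) (Ac : X →L[ℝ] X)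
    (T₀ : ℝ) {Ca K : ℝ} (hCa : 1 ≤ Ca) (hK : 0 ≤ K) :
    ∃ C : ℝ, 1 ≤ C ∧ ∀ (ε T B d h : ℝ) (a r ρ w : ℝ → X), 0 ≤ T → T ≤ T₀ → 1 ≤ B →
      B * d ≤ 1 → h ≤ 1 → C * (ε ^ 2 * B ^ 3) ≤ 1 / 2 →
      C * (B ^ 2 * (h + C * (ε ^ 2 * B ^ 3)) + B * d ^ 2) ≤ 1 / 2 →
      ContinuousOn a (Set.Icc 0 T) → ContinuousOn r (Set.Icc 0 T) →
      ContinuousOn ρ (Set.Icc 0 T) → ContinuousOn w (Set.Icc 0 T) →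
      (∀ t ∈ Set.Icc 0 T, a t ∈ N) → (∀ t ∈ Set.Icc 0 T, r t ∈ N) →
      (∀ t ∈ Set.Icc 0 T, (∫ s in (0 : ℝ)..t, (Ac (ρ s) + (3 : ℝ) • G (a s) (a s) (ρ s))) ∈ N) →
      (∀ t ∈ Set.Icc 0 T, ‖a t‖ ≤ Ca * B) → (∀ t ∈ Set.Icc 0 T, ‖ρ t‖ ≤ d) →
      (∀ t ∈ Set.Icc 0 T,
        ‖∫ s in (0 : ℝ)..t, (Ac (ρ s) + (3 : ℝ) • G (a s) (a s) (ρ s))‖ ≤ h) →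
      (∀ t ∈ Set.Icc 0 T, r t = ∫ s in (0 : ℝ)..t, (Ac (r s + ρ s + w s)
        + (G (a s + r s + ρ s + w s) (a s + r s + ρ s + w s) (a s + r s + ρ s + w s)
          - G (a s) (a s) (a s)))) →
      w 0 = 0 →
      (∀ t ∈ Set.Icc 0 T, ∀ m : ℝ, 1 ≤ m → (∀ s ∈ Set.Icc 0 t, ‖a s + r s + ρ s + w s‖ ≤ m) →
        ‖w t‖ ≤ K * (ε ^ 2 * m ^ 3)) →
      ∀ t ∈ Set.Icc 0 T, ‖r t‖ ≤ C * (B ^ 2 * (h + C * (ε ^ 2 * B ^ 3)) + B * d ^ 2) ∧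
        ‖w t‖ ≤ C * (ε ^ 2 * B ^ 3) := by
  obtain ⟨C₁, hC₁, hrem⟩ := hG.exists_remainder_bound Ac Ca T₀ hCa
  set C := C₁ + K * (Ca + 3) ^ 3 with hC
  have hC₁C : C₁ ≤ C := by rw [hC]; linarith [show 0 ≤ K * (Ca + 3) ^ 3 by positivity]
  have hKC : K * (Ca + 3) ^ 3 ≤ C := by rw [hC]; linarith
  have hC0 : 0 ≤ C := by linarith
  refine ⟨C, by linarith, ?_⟩
  intro ε T B d h a r ρ w hT hTT hB hBd hh1 hw2 hr2 hac hrc hρc hwc haN hrN hhN hab hρb hhb hreq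
    hw0 hwm
  have h0I : (0 : ℝ) ∈ Set.Icc 0 T := ⟨le_rfl, hT⟩
  have hd0 : 0 ≤ d := (norm_nonneg _).trans (hρb 0 h0I)
  have hh0 : 0 ≤ h := (norm_nonneg _).trans (hhb 0 h0I)
  have hd1 : d ≤ 1 := by nlinarith
  have hwB : 0 ≤ C * (ε ^ 2 * B ^ 3) := by positivity
  have hr0 : r 0 = 0 := by rw [hreq 0 h0I, intervalIntegral.integral_same]
  have himp : ∀ t ∈ Set.Icc 0 T, (∀ s ∈ Set.Icc 0 t, ‖r s‖ ≤ 1 ∧ ‖w s‖ ≤ 1) →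
      ‖r t‖ ≤ C * (B ^ 2 * (h + C * (ε ^ 2 * B ^ 3)) + B * d ^ 2) ∧
        ‖w t‖ ≤ C * (ε ^ 2 * B ^ 3) := by
    intro t ht hrw
    have hsub : Set.Icc 0 t ⊆ Set.Icc 0 T := Set.Icc_subset_Icc_right ht.2
    have hU : ∀ s ∈ Set.Icc 0 t, ‖a s + r s + ρ s + w s‖ ≤ (Ca + 3) * B := fun s hs => by
      have h1 := hab s (hsub hs)
      have h2 := hρb s (hsub hs)
      obtain ⟨h3, h4⟩ := hrw s hs
      have h5 := norm_add₃_le (a := a s) (b := r s) (c := ρ s)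
      have h6 := norm_add_le (a s + r s + ρ s) (w s)
      linarith
    have hw : ∀ s ∈ Set.Icc 0 t, ‖w s‖ ≤ C * (ε ^ 2 * B ^ 3) := fun s hs => by
      have h1 := hwm s (hsub hs) ((Ca + 3) * B) (by nlinarith)
        (fun s' hs' => hU s' ⟨hs'.1, hs'.2.trans hs.2⟩)
      calc ‖w s‖ ≤ K * (ε ^ 2 * ((Ca + 3) * B) ^ 3) := h1
        _ = (K * (Ca + 3) ^ 3) * (ε ^ 2 * B ^ 3) := by ring
        _ ≤ _ := by gcongr
    refine ⟨?_, hw t ⟨ht.1, le_rfl⟩⟩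
    refine (hrem t B d (C * (ε ^ 2 * B ^ 3)) h a r ρ w ht.1 (ht.2.trans hTT) hB hBd (by linarith)
      hh1 (hac.mono hsub) (hrc.mono hsub) (hρc.mono hsub) (hwc.mono hsub)
      (fun s hs => haN s (hsub hs)) (fun s hs => hrN s (hsub hs)) (fun s hs => hhN s (hsub hs))
      (fun s hs => hab s (hsub hs)) (fun s hs => (hrw s hs).1) (fun s hs => hρb s (hsub hs)) hw
      (fun s hs => hhb s (hsub hs)) (fun s hs => hreq s (hsub hs)) t ⟨ht.1, le_rfl⟩).trans ?_
    gcongr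
  have hboot := le_one_of_continuation (f := fun t => max ‖r t‖ ‖w t‖) (T := T)
    (hrc.norm.sup hwc.norm) (by simp [hr0, hw0]) (fun t ht hs => by
      obtain ⟨h1, h2⟩ := himp t ht fun s hs' => max_le_iff.1 (hs s hs')
      exact max_lt (by linarith) (by linarith))
  exact fun t ht => himp t ht fun s hs => max_le_iff.1 (hboot s ⟨hs.1, hs.2.trans ht.2⟩)

end Bootstrap

/-! ### The equation in slow time -/

section SlowTime

set_option maxSynthPendingDepth 3

variable {X : Type u} [NormedAddCommGroup X] [InnerProductSpace ℝ X]
  {L : X →ₗ.[ℝ] X} [FiniteDimensional ℝ (kerOf L)] {S : ℝ → X →L[ℝ] X} {α : ℝ}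
  {A : X →L[ℝ] NegSpace S α} {F : X [×3]→L[ℝ] NegSpace S α}

/-- The fast Ornstein-Uhlenbeck process started at `v₀`, in slow time and on the scale of the
amplitude. -/
def slowOU (L : X →ₗ.[ℝ] X) [FiniteDimensional ℝ (kerOf L)] (S : ℝ → X →L[ℝ] X) (H ε : ℝ)
    (z : ℝ → X) (v₀ : X) (T : ℝ) : X :=
  ε ^ (2 * H) • (S (T / ε ^ 2) v₀ + projS L (z (T / ε ^ 2)))

/-- The difference between the rescaled kernel component of `u` and the amplitude `a`. -/
def kernelError (L : X →ₗ.[ℝ] X) [FiniteDimensional ℝ (kerOf L)] (ε : ℝ) (u a : ℝ → X) (T : ℝ) :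
    X :=
  ε⁻¹ • projC L (u (T / ε ^ 2)) - a T

/-- The difference between the rescaled stable component of `u` and the process `ρ`. -/
def stableError (L : X →ₗ.[ℝ] X) [FiniteDimensional ℝ (kerOf L)] (ε : ℝ) (u ρ : ℝ → X) (T : ℝ) :
    X :=
  ε⁻¹ • projS L (u (T / ε ^ 2)) - ρ T

lemma add_errors (ε : ℝ) (u a ρ : ℝ → X) (T : ℝ) :
    a T + kernelError L ε u a T + ρ T + stableError L ε u ρ T = ε⁻¹ • u (T / ε ^ 2) := by
  conv_rhs => rw [← projC_add_projS (L := L) (u (T / ε ^ 2)), smul_add]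
  rw [kernelError, stableError]
  abel

lemma continuous_drift (ε : ℝ) (A : X →L[ℝ] NegSpace S α) (F : X [×3]→L[ℝ] NegSpace S α) :
    Continuous fun x : X => ε ^ 2 • A x + F ![x, x, x] := by
  have h : Continuous fun x : X => (![x, x, x] : Fin 3 → X) := by
    refine continuous_pi fun i => ?_
    fin_cases i <;> exact continuous_id
  exact (A.continuous.const_smul (ε ^ 2)).add (F.cont.comp h)

lemma norm_cube_le (F : X [×3]→L[ℝ] NegSpace S α) (x : X) : ‖F ![x, x, x]‖ ≤ ‖F‖ * ‖x‖ ^ 3 := by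
  refine (F.le_opNorm _).trans (le_of_eq ?_)
  rw [Fin.prod_univ_three]
  simp only [Matrix.cons_val]
  ring

lemma drift_smul (ε : ℝ) (A : X →L[ℝ] NegSpace S α) (F : X [×3]→L[ℝ] NegSpace S α) (x : X) :
    ε ^ 2 • A (ε • x) + F ![ε • x, ε • x, ε • x] = ε ^ 3 • (A x + F ![x, x, x]) := by
  have h : (![ε • x, ε • x, ε • x] : Fin 3 → X) = ε • ![x, x, x] := by simp
  have h2 := F.toMultilinearMap.map_smul_univ (fun _ => ε) ![x, x, x]
  simp only [Finset.prod_const, Finset.card_univ, Fintype.card_fin] at h2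
  have h3 : F (ε • ![x, x, x]) = ε ^ 3 • F ![x, x, x] := h2
  rw [h, h3, map_smul, smul_smul, smul_add]
  congr 2

variable [CompleteSpace X]

/-- The kernel component of the mild formulation, rescaled. -/
lemma kernel_equation (hL : OperatorAssumption L S) {PC : NegSpace S α →L[ℝ] X}
    {G : X →L[ℝ] X →L[ℝ] X →L[ℝ] X} (hG : ∀ u v w, G u v w = PC (F ![u, v, w]))
    {H ε : ℝ} (hε : 0 < ε) {w z u : ℝ → X} {u₀ : X} {T : ℝ} (hT : 0 < T)
    (hPC : projC L (∫ τ in (0 : ℝ)..T / ε ^ 2, extendNeg S α (S (T / ε ^ 2 - τ))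
        (ε ^ 2 • A (u τ) + F ![u τ, u τ, u τ]))
      = ∫ τ in (0 : ℝ)..T / ε ^ 2, PC (ε ^ 2 • A (u τ) + F ![u τ, u τ, u τ]))
    (hzw : projC L (z (T / ε ^ 2)) = projC L (w (T / ε ^ 2)))
    (hmild : u (T / ε ^ 2) = S (T / ε ^ 2) u₀
      + (∫ τ in (0 : ℝ)..T / ε ^ 2, extendNeg S α (S (T / ε ^ 2 - τ))
          (ε ^ 2 • A (u τ) + F ![u τ, u τ, u τ]))
      + ε ^ (2 * H + 1) • z (T / ε ^ 2)) :
    ε⁻¹ • projC L (u (T / ε ^ 2)) = ε⁻¹ • projC L u₀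
      + (∫ s in (0 : ℝ)..T, (PC.comp A (ε⁻¹ • u (s / ε ^ 2))
          + G (ε⁻¹ • u (s / ε ^ 2)) (ε⁻¹ • u (s / ε ^ 2)) (ε⁻¹ • u (s / ε ^ 2))))
      + ε ^ (2 * H) • projC L (w (T / ε ^ 2)) := by
  have hε2 : 0 < ε ^ 2 := by positivity
  have e1 : ∀ s : ℝ, PC (ε ^ 2 • A (u (s / ε ^ 2))
        + F ![u (s / ε ^ 2), u (s / ε ^ 2), u (s / ε ^ 2)])
      = ε ^ 3 • (PC.comp A (ε⁻¹ • u (s / ε ^ 2))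
          + G (ε⁻¹ • u (s / ε ^ 2)) (ε⁻¹ • u (s / ε ^ 2)) (ε⁻¹ • u (s / ε ^ 2))) := fun s => by
    have h := drift_smul ε A F (ε⁻¹ • u (s / ε ^ 2))
    rw [smul_inv_smul₀ hε.ne'] at h
    rw [h, map_smul, map_add, hG]
    rfl
  have e2 : ∫ τ in (0 : ℝ)..T / ε ^ 2, PC (ε ^ 2 • A (u τ) + F ![u τ, u τ, u τ])
      = ε • ∫ s in (0 : ℝ)..T, (PC.comp A (ε⁻¹ • u (s / ε ^ 2))
          + G (ε⁻¹ • u (s / ε ^ 2)) (ε⁻¹ • u (s / ε ^ 2)) (ε⁻¹ • u (s / ε ^ 2))) := by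
    have h := intervalIntegral.integral_comp_div (a := 0) (b := T)
      (fun τ => PC (ε ^ 2 • A (u τ) + F ![u τ, u τ, u τ])) hε2.ne'
    rw [zero_div] at h
    rw [← inv_smul_smul₀ hε2.ne' (∫ τ in (0 : ℝ)..T / ε ^ 2, _), ← h]
    simp only [e1]
    rw [intervalIntegral.integral_smul, smul_smul]
    congr 1
    field_simp
  have e3 : ε⁻¹ * ε ^ (2 * H + 1) = ε ^ (2 * H) := by
    rw [Real.rpow_add hε, Real.rpow_one]
    field_simp
  rw [hmild, map_add, map_add, hL.projC_apply (by positivity), hPC, map_smul, hzw, smul_add,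
    smul_add, e2, inv_smul_smul₀ hε.ne', smul_smul, e3]

/-- The stable component of the mild formulation, rescaled. -/
lemma stableError_eq (hL : OperatorAssumption L S) {H ε : ℝ} (hε : 0 < ε) {z u : ℝ → X} {u₀ I : X}
    {T : ℝ} (hT : 0 ≤ T)
    (hmild : u (T / ε ^ 2) = S (T / ε ^ 2) u₀ + I + ε ^ (2 * H + 1) • z (T / ε ^ 2)) :
    stableError L ε u (slowOU L S H ε z (ε ^ (-2 * H - 1) • projS L u₀)) T = ε⁻¹ • projS L I := by
  have e1 : ε⁻¹ * ε ^ (2 * H + 1) = ε ^ (2 * H) := by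
    rw [Real.rpow_add hε, Real.rpow_one]
    field_simp
  have e2 : ε ^ (2 * H) * ε ^ (-2 * H - 1) = ε⁻¹ := by
    rw [← Real.rpow_add hε, ← Real.rpow_neg_one]
    congr 1
    ring
  rw [stableError, slowOU, hmild, map_add, map_add, hL.projS_apply_comm (by positivity), map_smul,
    map_smul, smul_add, smul_add, smul_add, smul_smul, smul_smul, e1, e2]
  abel

end SlowTime

/-! ### The pathwise approximation result -/

section Pathwise

set_option maxSynthPendingDepth 3

lemma rpow_powers {ε κ e : ℝ} (hε : 0 < ε) (n : ℕ) :
    (ε ^ (-κ)) ^ n * ε ^ e = ε ^ (e - n * κ) := by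
  rw [← Real.rpow_natCast, ← Real.rpow_mul hε.le, ← Real.rpow_add hε]
  congr 1
  ring

lemma mul_rpow_le {ε p f c : ℝ} (hε : 0 < ε) (hε1 : ε ≤ 1) (hc : 0 ≤ c) (h : f ≤ p) :
    c * ε ^ p ≤ c * ε ^ f :=
  mul_le_mul_of_nonneg_left (Real.rpow_le_rpow_of_exponent_ge hε hε1 h) hc

/-- The error bound `c₃ (B² (h + d') + B d²)` in powers of `ε`, for `B = ε^{-κ}`,
`h = c₂ B⁴ c₁ ε^e`, `d' = c₃ ε² B³` and `d = c₁ ε^{2H} B`. -/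
lemma total_error_le {H κ e f ε c₁ c₂ c₃ : ℝ} (hε : 0 < ε) (hε1 : ε ≤ 1) (hc₁ : 0 ≤ c₁)
    (hc₂ : 0 ≤ c₂) (hc₃ : 0 ≤ c₃) (hf1 : f ≤ e - 6 * κ) (hf2 : f ≤ 2 - 5 * κ)
    (hf3 : f ≤ 4 * H - 3 * κ) :
    c₃ * ((ε ^ (-κ)) ^ 2 * (c₂ * ((ε ^ (-κ)) ^ 4 * (c₁ * ε ^ e)) + c₃ * (ε ^ 2 * (ε ^ (-κ)) ^ 3))
        + ε ^ (-κ) * (c₁ * (ε ^ (2 * H) * ε ^ (-κ))) ^ 2)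
      ≤ c₃ * (c₂ * c₁ + c₃ + c₁ ^ 2) * ε ^ f := by
  have e1 := rpow_powers (κ := κ) (e := e) hε 6
  have e2 := rpow_powers (κ := κ) (e := 2) hε 5
  have e3 := rpow_powers (κ := κ) (e := 4 * H) hε 3
  have e4 : (ε ^ (2 * H)) ^ 2 = ε ^ (4 * H) := by
    rw [← Real.rpow_natCast, ← Real.rpow_mul hε.le]
    congr 1
    push_cast
    ring
  rw [Real.rpow_two] at e2
  push_cast at e1 e2 e3
  have h1 := mul_rpow_le hε hε1 (mul_nonneg hc₂ hc₁) hf1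
  have h2 := mul_rpow_le hε hε1 hc₃ hf2
  have h3 := mul_rpow_le hε hε1 (sq_nonneg c₁) hf3
  rw [← e1] at h1
  rw [← e2] at h2
  rw [← e3, ← e4] at h3
  rw [mul_assoc]
  refine mul_le_mul_of_nonneg_left ?_ hc₃
  calc _ = c₂ * c₁ * ((ε ^ (-κ)) ^ 6 * ε ^ e) + c₃ * ((ε ^ (-κ)) ^ 5 * ε ^ 2)
        + c₁ ^ 2 * ((ε ^ (-κ)) ^ 3 * (ε ^ (2 * H)) ^ 2) := by ring
    _ ≤ c₂ * c₁ * ε ^ f + c₃ * ε ^ f + c₁ ^ 2 * ε ^ f := by linarith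
    _ = _ := by ring

variable {X : Type u} [NormedAddCommGroup X] [InnerProductSpace ℝ X]

/-- What the hypotheses on the noise, on the solution `u` and on the amplitude `a` say about a
single realization in the set of large probability: `w` and `z` are the paths of the noise and of
the stochastic convolution. -/
structure IsGoodPath (L : X →ₗ.[ℝ] X) [FiniteDimensional ℝ (kerOf L)] (S : ℝ → X →L[ℝ] X) (α : ℝ)
    (A : X →L[ℝ] NegSpace S α) (F : X [×3]→L[ℝ] NegSpace S α) (R : X →L[ℝ] X)
    (H κ β T₀ ε : ℝ) (w z u a : ℝ → X) (u₀ : X) (τ : EReal) : Prop where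
  z_zero : z 0 = 0
  z_continuous : ContinuousOn z (Set.Ici 0)
  projC_z : ∀ t, 0 ≤ t → projC L (z t) = projC L (w t)
  integral_z : ∀ t, 0 ≤ t → ∫ s in (0 : ℝ)..t, projS L (z s) = R (w t - z t)
  u_continuous : ContinuousOn u {t | 0 ≤ t ∧ (t : EReal) < τ}
  u_zero : u 0 = u₀
  mild : ∀ t : ℝ, 0 < t → (t : EReal) < τ →
    u t = S t u₀
      + (∫ s in (0 : ℝ)..t, extendNeg S α (S (t - s)) (ε ^ 2 • A (u s) + F ![u s, u s, u s]))
      + ε ^ (2 * H + 1) • z t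
  a_continuous : ContinuousOn a (Set.Icc 0 T₀)
  a_mem : ∀ T ∈ Set.Icc 0 T₀, a T ∈ kerOf L
  a_eq : ∀ T ∈ Set.Icc (0 : ℝ) T₀,
    a T = ε⁻¹ • projC L u₀
      + (∫ s in (0 : ℝ)..T, (extendNeg S α (projC L) (A (a s))
          + extendNeg S α (projC L) (F ![a s, a s, a s])))
      + ε ^ (2 * H) • projC L (w (T / ε ^ 2))
  projS_z : ∀ t ∈ Set.Icc (0 : ℝ) (T₀ / ε ^ 2), ‖projS L (z t)‖ ≤ ε ^ (-κ)
  hoelder : hoelderNorm β T₀ (fun T => w (T / ε ^ 2)) ≤ ENNReal.ofReal (ε ^ (-2 * H - κ))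
  projS_initial : ‖ε ^ (-2 * H - 1) • projS L u₀‖ ≤ ε ^ (-κ)
  projC_initial : ‖ε⁻¹ • projC L u₀‖ ≤ ε ^ (-κ)

variable {L : X →ₗ.[ℝ] X} [FiniteDimensional ℝ (kerOf L)] {S : ℝ → X →L[ℝ] X} {α : ℝ}
  {A : X →L[ℝ] NegSpace S α} {F : X [×3]→L[ℝ] NegSpace S α} {R : X →L[ℝ] X}
  {H κ β T₀ ε : ℝ} {w z u a : ℝ → X} {u₀ : X} {τ : EReal}

lemma IsGoodPath.continuousOn_rescaled (hp : IsGoodPath L S α A F R H κ β T₀ ε w z u a u₀ τ)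
    (hε : 0 < ε) {T : ℝ} (hT : ((T / ε ^ 2 : ℝ) : EReal) < τ) :
    ContinuousOn (fun s => u (s / ε ^ 2)) (Set.Icc 0 T) := by
  have hε2 : 0 < ε ^ 2 := by positivity
  refine hp.u_continuous.comp (by fun_prop) fun s hs => ⟨div_nonneg hs.1 hε2.le, lt_of_le_of_lt ?_ hT⟩
  rw [EReal.coe_le_coe_iff]
  gcongr
  exact hs.2

lemma IsGoodPath.continuousOn_slowOU (hL : OperatorAssumption L S)
    (hp : IsGoodPath L S α A F R H κ β T₀ ε w z u a u₀ τ) (hε : 0 < ε) (v₀ : X) (T : ℝ) :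
    ContinuousOn (slowOU L S H ε z v₀) (Set.Icc 0 T) := by
  have hm : Set.MapsTo (fun s : ℝ => s / ε ^ 2) (Set.Icc 0 T) (Set.Ici 0) := fun s hs =>
    div_nonneg hs.1 (by positivity)
  have h1 : ContinuousOn (fun s : ℝ => S (s / ε ^ 2) v₀) (Set.Icc 0 T) :=
    (hL.semigroup.continuous v₀).comp (by fun_prop) hm
  have h2 : ContinuousOn (fun s : ℝ => projS L (z (s / ε ^ 2))) (Set.Icc 0 T) :=
    (projS L).continuous.comp_continuousOn (hp.z_continuous.comp (by fun_prop) hm)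
  exact (h1.add h2).const_smul (ε ^ (2 * H))

variable [CompleteSpace X]

lemma integral_mem_kerOf {f : ℝ → X} {a b : ℝ}
    (hf : IntervalIntegrable f volume a b) (h : ∀ s, f s ∈ kerOf L) :
    ∫ s in a..b, f s ∈ kerOf L := by
  have e : ∫ s in a..b, f s = projC L (∫ s in a..b, f s) := by
    rw [← ContinuousLinearMap.intervalIntegral_comp_comm _ hf]
    exact intervalIntegral.integral_congr fun s _ => (projC_of_mem (h s)).symm
  rw [e]
  exact projC_mem _

/-- The stable error is controlled by the size of the rescaled solution. -/
lemma IsGoodPath.norm_stableError_le (hL : OperatorAssumption L S)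
    (hp : IsGoodPath L S α A F R H κ β T₀ ε w z u a u₀ τ) (hε : 0 < ε) {K : ℝ} (hK : 0 ≤ K)
    (hKb : ∀ t : ℝ, 0 < t → ∀ ξ : ℝ → NegSpace S α, ContinuousOn ξ (Set.Icc 0 t) →
      ∀ m : ℝ, (∀ s ∈ Set.Icc 0 t, ‖ξ s‖ ≤ m) →
        ‖projS L (∫ s in (0 : ℝ)..t, extendNeg S α (S (t - s)) (ξ s))‖ ≤ K * m)
    {t : ℝ} (ht0 : 0 ≤ t) (htτ : ((t / ε ^ 2 : ℝ) : EReal) < τ) {m : ℝ} (hm : 1 ≤ m)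
    (hu : ∀ s ∈ Set.Icc 0 t, ‖ε⁻¹ • u (s / ε ^ 2)‖ ≤ m) :
    ‖stableError L ε u (slowOU L S H ε z (ε ^ (-2 * H - 1) • projS L u₀)) t‖
      ≤ K * (‖A‖ + ‖F‖) * (ε ^ 2 * m ^ 3) := by
  have hε2 : 0 < ε ^ 2 := by positivity
  have hm0 : 0 ≤ m := by linarith
  rcases ht0.eq_or_lt with rfl | ht
  · rw [stableError_eq (I := 0) hL hε le_rfl (by
      rw [zero_div, hp.u_zero, hp.z_zero, hL.semigroup.zero]; simp)]
    rw [map_zero, smul_zero, norm_zero]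
    positivity
  have htε : 0 < t / ε ^ 2 := by positivity
  rw [stableError_eq hL hε ht0 (hp.mild _ htε htτ), norm_smul, norm_inv, Real.norm_of_nonneg hε.le]
  have hc : ContinuousOn u (Set.Icc 0 (t / ε ^ 2)) := hp.u_continuous.mono fun s hs =>
    ⟨hs.1, lt_of_le_of_lt (EReal.coe_le_coe_iff.2 hs.2) htτ⟩
  have h1 := hKb _ htε _ ((continuous_drift ε A F).comp_continuousOn hc)
    (ε ^ 3 * ((‖A‖ + ‖F‖) * m ^ 3)) (fun s hs => by
      have hsm := hu (s * ε ^ 2) ⟨by have := hs.1; positivity, (le_div_iff₀ hε2).1 hs.2⟩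
      rw [mul_div_cancel_right₀ _ hε2.ne'] at hsm
      have e := drift_smul ε A F (ε⁻¹ • u s)
      rw [smul_inv_smul₀ hε.ne'] at e
      rw [Function.comp_apply, e, norm_smul, Real.norm_of_nonneg (by positivity)]
      gcongr
      have h2 : m ≤ m ^ 3 := le_self_pow₀ hm (by norm_num)
      calc _ ≤ ‖A‖ * ‖ε⁻¹ • u s‖ + ‖F‖ * ‖ε⁻¹ • u s‖ ^ 3 :=
            (norm_add_le _ _).trans (add_le_add (A.le_opNorm _) (norm_cube_le F _))
        _ ≤ ‖A‖ * m ^ 3 + ‖F‖ * m ^ 3 := by gcongr; exact hsm.trans h2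
        _ = _ := by ring)
  calc _ ≤ ε⁻¹ * (K * (ε ^ 3 * ((‖A‖ + ‖F‖) * m ^ 3))) := by gcongr; exact h1
    _ = _ := by field_simp

/-- The kernel error solves the integral equation of the remainder. -/
lemma IsGoodPath.kernelError_eq (hL : OperatorAssumption L S)
    (hp : IsGoodPath L S α A F R H κ β T₀ ε w z u a u₀ τ) (hε : 0 < ε)
    {PC : NegSpace S α →L[ℝ] X} (hPCe : ∀ y, extendNeg S α (projC L) y = PC y)
    {G : X →L[ℝ] X →L[ℝ] X →L[ℝ] X} (hG : ∀ u v w, G u v w = PC (F ![u, v, w]))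
    (hPC : ∀ t : ℝ, 0 < t → ∀ ξ : ℝ → NegSpace S α, ContinuousOn ξ (Set.Icc 0 t) →
      projC L (∫ s in (0 : ℝ)..t, extendNeg S α (S (t - s)) (ξ s)) = ∫ s in (0 : ℝ)..t, PC (ξ s))
    {t : ℝ} (ht : t ∈ Set.Icc 0 T₀) (htτ : ((t / ε ^ 2 : ℝ) : EReal) < τ) :
    kernelError L ε u a t = ∫ s in (0 : ℝ)..t,
      (PC.comp A (ε⁻¹ • u (s / ε ^ 2) - a s)
        + (G (ε⁻¹ • u (s / ε ^ 2)) (ε⁻¹ • u (s / ε ^ 2)) (ε⁻¹ • u (s / ε ^ 2))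
          - G (a s) (a s) (a s))) := by
  have hε2 : 0 < ε ^ 2 := by positivity
  have haeq := hp.a_eq t ht
  simp only [hPCe, ← hG] at haeq
  rw [kernelError, haeq]
  rcases ht.1.eq_or_lt with rfl | ht0
  · rw [zero_div, hp.u_zero, ← hp.projC_z 0 le_rfl, hp.z_zero]
    simp
  have htε : 0 < t / ε ^ 2 := by positivity
  have huc : ContinuousOn u (Set.Icc 0 (t / ε ^ 2)) := hp.u_continuous.mono fun s hs =>
    ⟨hs.1, lt_of_le_of_lt (EReal.coe_le_coe_iff.2 hs.2) htτ⟩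
  rw [kernel_equation hL hG hε ht0 (hPC _ htε _ ((continuous_drift ε A F).comp_continuousOn huc))
    (hp.projC_z _ htε.le) (hp.mild _ htε htτ)]
  have hUc : ContinuousOn (fun s => ε⁻¹ • u (s / ε ^ 2)) (Set.uIcc 0 t) := by
    rw [Set.uIcc_of_le ht.1]
    exact (hp.continuousOn_rescaled hε htτ).const_smul ε⁻¹
  have hac : ContinuousOn a (Set.uIcc 0 t) := by
    rw [Set.uIcc_of_le ht.1]
    exact hp.a_continuous.mono (Set.Icc_subset_Icc_right ht.2)
  have hi : ∀ x : ℝ → X, ContinuousOn x (Set.uIcc 0 t) →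
      IntervalIntegrable (fun s => PC.comp A (x s) + G (x s) (x s) (x s)) volume 0 t := fun x hx =>
    (((PC.comp A).continuous.comp_continuousOn hx).add
      (((G.continuous.comp_continuousOn hx).clm_apply hx).clm_apply hx)).intervalIntegrable
  have e : (fun s => PC.comp A (ε⁻¹ • u (s / ε ^ 2) - a s)
        + (G (ε⁻¹ • u (s / ε ^ 2)) (ε⁻¹ • u (s / ε ^ 2)) (ε⁻¹ • u (s / ε ^ 2))
          - G (a s) (a s) (a s)))
      = fun s => (PC.comp A (ε⁻¹ • u (s / ε ^ 2))
        + G (ε⁻¹ • u (s / ε ^ 2)) (ε⁻¹ • u (s / ε ^ 2)) (ε⁻¹ • u (s / ε ^ 2)))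
        - (PC.comp A (a s) + G (a s) (a s) (a s)) := by
    ext s
    rw [map_sub]
    abel
  rw [e, intervalIntegral.integral_sub (hi _ hUc) (hi _ hac)]
  simp only [ContinuousLinearMap.comp_apply]
  abel

end Pathwise

section PathwiseBound

set_option maxSynthPendingDepth 3

variable {X : Type u} [NormedAddCommGroup X] [InnerProductSpace ℝ X] [CompleteSpace X]
  {L : X →ₗ.[ℝ] X} [FiniteDimensional ℝ (kerOf L)] {S : ℝ → X →L[ℝ] X} {α : ℝ}
  {A : X →L[ℝ] NegSpace S α} {F : X [×3]→L[ℝ] NegSpace S α} {R : X →L[ℝ] X}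

/-- On every slow time interval on which the solution lives, the errors are of order `ε ^ f` and
the rescaled solution is of order `ε ^ (-κ)`. -/
lemma exists_error_bound_of_isGoodPath (hL : OperatorAssumption L S) (hα0 : 0 ≤ α) (hα1 : α < 1)
    (hF : CubicAssumption L S α F) (hR : IsStableInverse L S R) {H κ β T₀ f : ℝ}
    (hH1 : H < 1) (hκ0 : 0 < κ) (hκ : 50 * κ < H) (hT₀ : 0 < T₀)
    (hβ1 : 1 / 2 < H → 1 / 2 < β ∧ β < H) (hβ2 : H ≤ 1 / 2 → β = H - κ)
    (hf1 : 1 / 2 < H → f ≤ 2 - 7 * κ) (hf2 : H ≤ 1 / 2 → f ≤ 4 * H - 13 * κ) :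
    ∃ C ε₀ : ℝ, 0 < C ∧ 0 < ε₀ ∧ ε₀ ≤ 1 ∧
      ∀ (ε : ℝ) (w z u a : ℝ → X) (u₀ : X) (τ : EReal), 0 < ε → ε ≤ ε₀ →
        IsGoodPath L S α A F R H κ β T₀ ε w z u a u₀ τ →
        ∀ T ∈ Set.Icc 0 T₀, ((T / ε ^ 2 : ℝ) : EReal) < τ →
          ‖kernelError L ε u a T‖ ≤ C * ε ^ f ∧
          ‖stableError L ε u (slowOU L S H ε z (ε ^ (-2 * H - 1) • projS L u₀)) T‖ ≤ C * ε ^ f ∧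
          ‖ε⁻¹ • u (T / ε ^ 2)‖ ≤ C * ε ^ (-κ) := by
  have hβ0 : 0 < β := by
    rcases lt_or_ge (1 / 2) H with h | h
    · linarith [(hβ1 h).1]
    · linarith [hβ2 h]
  have hβH : β ≤ H := by
    rcases lt_or_ge (1 / 2) H with h | h
    · exact (hβ1 h).2.le
    · linarith [hβ2 h]
  obtain ⟨PC, hPCe, hPCx, hPCm⟩ := hL.exists_extension_projC (α := α) hα0
  obtain ⟨K, hK0, hK⟩ := hL.exists_mild_bound hα0 hα1 hPCx
  obtain ⟨G, hGF, hG⟩ := hF.exists_isDissipativeCubic hPCe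
  obtain ⟨Ca, hCa, hamp⟩ := hG.exists_amplitude_bound (PC.comp A)
  obtain ⟨γ, e, hγ, hβγ, he1, he2, hint⟩ :=
    exists_interpolated_exponent hκ0 (by linarith) hH1 hβ1 hβ2
  obtain ⟨c₁, hc₁, hfast⟩ := hR.exists_fast_bound hL
  obtain ⟨c₂, hc₂, hav⟩ := exists_average_bound G (PC.comp A) hCa hT₀ hβ0 (by linarith) hγ hβγ
  have hKAF : 0 ≤ K * (‖A‖ + ‖F‖) := by positivity
  obtain ⟨c₃, hc₃, herr⟩ := hG.exists_error_bound (PC.comp A) T₀ hCa hKAF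
  have heH : H ≤ e - 6 * κ ∧ f ≤ e - 6 * κ ∧ f ≤ 2 - 7 * κ ∧ f ≤ 4 * H - 3 * κ := by
    rcases lt_or_ge (1 / 2) H with h | h
    · have := he1 h
      have := hf1 h
      refine ⟨?_, ?_, ?_, ?_⟩ <;> linarith
    · have := he2 h
      have := hf2 h
      refine ⟨?_, ?_, ?_, ?_⟩ <;> linarith
  obtain ⟨heH, hfe, hf2', hf4⟩ := heH
  set C := c₃ * (c₂ * c₁ + c₃ + c₁ ^ 2) with hC
  have hc₁0 : 0 ≤ c₁ := by linarith
  have hc₂0 : 0 ≤ c₂ := by linarith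
  have hc₃0 : 0 ≤ c₃ := by linarith
  have hC21 : 1 ≤ c₂ * c₁ := one_le_mul_of_one_le_of_one_le hc₂ hc₁
  have hsq : 1 ≤ c₁ ^ 2 := one_le_pow₀ hc₁
  have hCs : c₂ * c₁ + c₃ + c₁ ^ 2 ≤ C := by
    rw [hC]
    exact le_mul_of_one_le_left (by positivity) hc₃
  have hC1 : c₁ ≤ C := by
    have : c₁ ≤ c₁ ^ 2 := le_self_pow₀ hc₁ (by norm_num)
    linarith
  have hC2 : c₂ * c₁ ≤ C := by linarith
  have hC3 : c₃ ≤ C := by linarith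
  have hC0 : 0 < C := by linarith
  have hH0 : 0 < H := by linarith
  -- `C ε₀ ^ H = 1 / 2`, and every quantity that has to be small is at most `C ε ^ H`
  refine ⟨C + Ca + 3, (2 * C) ^ (-H⁻¹), by linarith, by positivity, ?_, ?_⟩
  · exact Real.rpow_le_one_of_one_le_of_nonpos (by linarith) (by
      have := inv_pos.2 hH0
      linarith)
  intro ε w z u a u₀ τ hε hεε hp T hT hTτ
  have hε1 : ε ≤ 1 := hεε.trans (Real.rpow_le_one_of_one_le_of_nonpos (by linarith) (by
      have := inv_pos.2 hH0
      linarith))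
  have hsmall : C * ε ^ H ≤ 1 / 2 := by
    have h1 : ε ^ H ≤ ((2 * C) ^ (-H⁻¹)) ^ H := by gcongr
    rw [← Real.rpow_mul (by positivity), neg_mul, inv_mul_cancel₀ hH0.ne',
      Real.rpow_neg_one] at h1
    calc C * ε ^ H ≤ C * (2 * C)⁻¹ := by gcongr
      _ = 1 / 2 := by field_simp
  set B := ε ^ (-κ) with hB
  have hB1 : 1 ≤ B := Real.one_le_rpow_of_pos_of_le_one_of_nonpos hε hε1 (by linarith)
  have hB0 : 0 ≤ B := by linarith
  have hHpos : 0 < ε ^ (2 * H) := Real.rpow_pos_of_pos hε _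
  have hsplit : ε ^ (-2 * H - κ) = ε ^ (-2 * H) * B := by
    rw [hB, ← Real.rpow_add hε]; rfl
  have hcancel : ε ^ (2 * H) * (ε ^ (-2 * H) * B) = B := by
    rw [← mul_assoc, ← Real.rpow_add hε, show 2 * H + -2 * H = 0 by ring, Real.rpow_zero, one_mul]
  obtain ⟨hWb, hWh⟩ := norm_le_of_hoelderNorm_le hβ0 (by positivity) hp.hoelder
  rw [hsplit] at hWb hWh
  -- the amplitude equation, driven by the projected noise `b`
  set b : ℝ → X := fun T => ε ^ (2 * H) • projC L (w (T / ε ^ 2)) with hb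
  have hbb : ∀ t ∈ Set.Icc 0 T₀, ‖b t‖ ≤ B := fun t ht => by
    rw [hb]
    simp only [norm_smul, Real.norm_of_nonneg hHpos.le]
    calc _ ≤ ε ^ (2 * H) * (ε ^ (-2 * H) * B) := by
          gcongr
          exact (norm_projC_le _).trans (hWb t ht)
      _ = B := hcancel
  have hbh : ∀ s t, 0 ≤ s → s ≤ t → t ≤ T₀ → ‖b t - b s‖ ≤ B * (t - s) ^ β := fun s t hs hst ht => by
    rw [hb]
    simp only [← smul_sub, ← map_sub, norm_smul, Real.norm_of_nonneg hHpos.le]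
    calc _ ≤ ε ^ (2 * H) * ((ε ^ (-2 * H) * B) * (t - s) ^ β) := by
          gcongr
          exact (norm_projC_le _).trans (hWh s t hs hst ht)
      _ = (ε ^ (2 * H) * (ε ^ (-2 * H) * B)) * (t - s) ^ β := by ring
      _ = _ := by rw [hcancel]
  obtain ⟨hab, hai⟩ := hamp T₀ B a b (ε⁻¹ • projC L u₀) hT₀.le hB1 hp.a_continuous hp.a_mem
    (fun t _ => (kerOf L).smul_mem _ (projC_mem _)) hp.projC_initial hbb (fun t ht => by
      have h := hp.a_eq t ht
      simp only [hPCe, ← hGF] at h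
      exact h)
  set v₀ : X := ε ^ (-2 * H - 1) • projS L u₀ with hv₀
  set ρ : ℝ → X := slowOU L S H ε z v₀ with hρ
  have hv₀s : projS L v₀ = v₀ := by rw [hv₀, map_smul, projS_projS]
  obtain ⟨hρb, hρi⟩ := hfast ε H β B T₀ w z v₀ hε hε1 hβ0.le hβH (by linarith) hB0
    hp.z_continuous hp.integral_z hv₀s hp.projS_initial hp.projS_z hWh
  have hρk : ∀ s t, 0 ≤ s → s ≤ t → t ≤ T₀ → ‖∫ x in s..t, ρ x‖ ≤ c₁ * ε ^ e * (t - s) ^ γ :=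
    fun s t hs hst ht => by
      obtain ⟨h1, h2⟩ := hρi s t hs hst ht
      exact hint ε c₁ (t - s) _ hε hε1 hc₁0 (sub_nonneg.2 hst) (norm_nonneg _) h1 h2
  have hρc : ∀ T, ContinuousOn ρ (Set.Icc 0 T) := fun T => hp.continuousOn_slowOU hL hε v₀ T
  have hθb := hav B (c₁ * ε ^ e) a ρ hB1 (by positivity) hp.a_continuous (hρc T₀) hab
    (fun s t hs hst ht => (hai s t hs hst ht).trans (by
      gcongr
      exact hbh s t hs hst ht)) hρk
  have hsm1 : B * (c₁ * (ε ^ (2 * H) * B)) ≤ 1 := by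
    have h1 := rpow_powers (κ := κ) (e := 2 * H) hε 2
    push_cast at h1
    calc B * (c₁ * (ε ^ (2 * H) * B)) = c₁ * (B ^ 2 * ε ^ (2 * H)) := by ring
      _ ≤ c₁ * ε ^ H := by rw [h1]; exact mul_rpow_le hε hε1 hc₁0 (by linarith)
      _ ≤ C * ε ^ H := by gcongr
      _ ≤ 1 := by linarith
  have hsm2 : c₂ * (B ^ 4 * (c₁ * ε ^ e)) ≤ 1 := by
    have h1 := rpow_powers (κ := κ) (e := e) hε 4
    push_cast at h1
    calc c₂ * (B ^ 4 * (c₁ * ε ^ e)) = c₂ * c₁ * (B ^ 4 * ε ^ e) := by ring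
      _ ≤ c₂ * c₁ * ε ^ H := by
        rw [h1]; exact mul_rpow_le hε hε1 (by positivity) (by linarith)
      _ ≤ C * ε ^ H := by gcongr
      _ ≤ 1 := by linarith
  have hsm3 : ∀ p : ℝ, p ≤ 2 - 3 * κ → c₃ * (ε ^ 2 * B ^ 3) ≤ C * ε ^ p := fun p hp => by
    have h1 := rpow_powers (κ := κ) (e := 2) hε 3
    rw [Real.rpow_two] at h1
    push_cast at h1
    calc c₃ * (ε ^ 2 * B ^ 3) = c₃ * (B ^ 3 * ε ^ 2) := by ring
      _ ≤ c₃ * ε ^ p := by rw [h1]; exact mul_rpow_le hε hε1 hc₃0 hp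
      _ ≤ C * ε ^ p := by gcongr
  have hsm4 : ∀ p : ℝ, p ≤ e - 6 * κ → p ≤ 2 - 5 * κ → p ≤ 4 * H - 3 * κ → _ := fun p h1 h2 h3 =>
    total_error_le (κ := κ) hε hε1 hc₁0 hc₂0 hc₃0 h1 h2 h3
  rw [← hB, ← hC] at hsm4
  -- on the time interval where the solution lives, `r` and `wS` satisfy the hypotheses of the
  -- continuation argument
  set r := kernelError L ε u a with hr
  set wS := stableError L ε u ρ with hwS
  have hsum : ∀ s, a s + r s + ρ s + wS s = ε⁻¹ • u (s / ε ^ 2) := fun s => add_errors ε u a ρ s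
  have hdiff : ∀ s, r s + ρ s + wS s = ε⁻¹ • u (s / ε ^ 2) - a s := fun s => by
    rw [← hsum]; abel
  have hsub : Set.Icc 0 T ⊆ Set.Icc 0 T₀ := Set.Icc_subset_Icc_right hT.2
  have hτt : ∀ t ∈ Set.Icc 0 T, ((t / ε ^ 2 : ℝ) : EReal) < τ := fun t ht =>
    lt_of_le_of_lt (EReal.coe_le_coe_iff.2 (by gcongr; exact ht.2)) hTτ
  have huc := hp.continuousOn_rescaled hε hTτ
  have hac := hp.a_continuous.mono hsub
  have hrc : ContinuousOn r (Set.Icc 0 T) :=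
    (((projC L).continuous.comp_continuousOn huc).const_smul ε⁻¹).sub hac
  have hwc : ContinuousOn wS (Set.Icc 0 T) :=
    (((projS L).continuous.comp_continuousOn huc).const_smul ε⁻¹).sub (hρc T)
  have hmain := herr ε T B (c₁ * (ε ^ (2 * H) * B)) (c₂ * (B ^ 4 * (c₁ * ε ^ e))) a r ρ wS hT.1 hT.2
    hB1 hsm1 hsm2 ((hsm3 H (by linarith)).trans hsmall)
    ((hsm4 H heH (by linarith) (by linarith)).trans hsmall) hac hrc (hρc T) hwc
    (fun t ht => hp.a_mem t (hsub ht))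
    (fun t ht => (kerOf L).sub_mem ((kerOf L).smul_mem _ (projC_mem _)) (hp.a_mem t (hsub ht)))
    (fun t ht => integral_mem_kerOf
      ((((PC.comp A).continuous.comp_continuousOn (hρc T)).add
        ((((G.continuous.comp_continuousOn hac).clm_apply hac).clm_apply (hρc T)).const_smul
          (3 : ℝ))).mono (by
            rw [Set.uIcc_of_le ht.1]
            exact Set.Icc_subset_Icc_right ht.2)).intervalIntegrable
      fun s => (kerOf L).add_mem (hPCm _) ((kerOf L).smul_mem _ (by rw [hGF]; exact hPCm _)))
    (fun t ht => hab t (hsub ht)) (fun t ht => hρb t (hsub ht)) (fun t ht => hθb t (hsub ht))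
    (fun t ht => by
      simp only [hsum, hdiff]
      exact hp.kernelError_eq hL hε hPCe hGF (fun t ht ξ hξ => (hK t ht ξ hξ).1) (hsub ht)
        (hτt t ht))
    (by
      rw [hwS, hρ, stableError_eq (u₀ := u₀) (I := 0) hL hε le_rfl (by
        rw [zero_div, hp.u_zero, hp.z_zero, hL.semigroup.zero]; simp), map_zero, smul_zero])
    (fun t ht m hm hU => by
      simp only [hsum] at hU
      exact hp.norm_stableError_le hL hε hK0 (fun t ht ξ hξ => (hK t ht ξ hξ).2) ht.1 (hτt t ht)
        hm hU) T ⟨hT.1, le_rfl⟩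
  obtain ⟨hm1, hm2⟩ := hmain
  have hfpos : 0 ≤ ε ^ f := Real.rpow_nonneg hε.le _
  have hCC : C * ε ^ f ≤ (C + Ca + 3) * ε ^ f := by gcongr; linarith
  refine ⟨(hm1.trans (hsm4 f hfe (by linarith) hf4)).trans hCC,
    (hm2.trans (hsm3 f (by linarith))).trans hCC, ?_⟩
  have hr1 : ‖r T‖ ≤ 1 / 2 := hm1.trans ((hsm4 H heH (by linarith) (by linarith)).trans hsmall)
  have hw1 : ‖wS T‖ ≤ 1 / 2 := hm2.trans ((hsm3 H (by linarith)).trans hsmall)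
  have hρ1 : ‖ρ T‖ ≤ 1 := (hρb T hT).trans (by
    refine le_trans ?_ hsm1
    exact le_mul_of_one_le_left (by positivity) hB1)
  have ha1 := hab T hT
  rw [← hsum]
  have h5 := norm_add₃_le (a := a T) (b := r T) (c := ρ T)
  have h6 := norm_add_le (a T + r T + ρ T) (wS T)
  have h7 : C * 1 ≤ C * B := by gcongr
  have h8 : (C + Ca + 3) * B = C * B + Ca * B + 3 * B := by ring
  linarith

end PathwiseBound

/-! ### From slow time back to the original equation -/

section BlowUp

/-- A maximal path cannot stop while it stays bounded. -/
lemma lt_of_bounded_of_maximal {X : Type u} [NormedAddCommGroup X] {u : ℝ → X} {τ : EReal}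
    {D M : ℝ} (hτ : 0 < τ)
    (hmax : τ = ⊤ ∨ Tendsto (fun t : ℝ => ‖u t‖) (𝓝[<] τ.toReal) atTop)
    (hb : ∀ t ∈ Set.Icc 0 D, (t : EReal) < τ → ‖u t‖ ≤ M) : (D : EReal) < τ := by
  by_contra! hle
  have htop : τ ≠ ⊤ := fun h => by
    rw [h, top_le_iff] at hle
    exact EReal.coe_ne_top _ hle
  have hbot : τ ≠ ⊥ := (bot_lt_iff_ne_bot.1 (lt_of_le_of_lt bot_le hτ))
  have hτr : ((τ.toReal : ℝ) : EReal) = τ := EReal.coe_toReal htop hbot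
  rw [← hτr] at hτ hle hb
  have hpos : 0 < τ.toReal := by exact_mod_cast hτ
  have hD : τ.toReal ≤ D := by exact_mod_cast hle
  have h1 := (hmax.resolve_left htop).eventually (eventually_gt_atTop M)
  have h2 : ∀ᶠ t in 𝓝[<] τ.toReal, t ∈ Set.Ioo 0 τ.toReal := Ioo_mem_nhdsLT hpos
  obtain ⟨t, ht1, ht2⟩ := (h1.and h2).exists
  exact absurd (hb t ⟨ht2.1.le, ht2.2.le.trans hD⟩ (by exact_mod_cast ht2.2)) (not_le.2 ht1)

variable {X : Type u} [NormedAddCommGroup X] [InnerProductSpace ℝ X] [CompleteSpace X]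
  {L : X →ₗ.[ℝ] X} [FiniteDimensional ℝ (kerOf L)] {S : ℝ → X →L[ℝ] X} {α : ℝ}
  {A : X →L[ℝ] NegSpace S α} {F : X [×3]→L[ℝ] NegSpace S α} {R : X →L[ℝ] X}

/-- The approximation result for a single realization. -/
lemma exists_approximation_of_isGoodPath (hL : OperatorAssumption L S) (hα0 : 0 ≤ α) (hα1 : α < 1)
    (hF : CubicAssumption L S α F) (hR : IsStableInverse L S R) {H κ β T₀ f : ℝ}
    (hH1 : H < 1) (hκ0 : 0 < κ) (hκ : 50 * κ < H) (hT₀ : 0 < T₀)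
    (hβ1 : 1 / 2 < H → 1 / 2 < β ∧ β < H) (hβ2 : H ≤ 1 / 2 → β = H - κ)
    (hf1 : 1 / 2 < H → f ≤ 2 - 7 * κ) (hf2 : H ≤ 1 / 2 → f ≤ 4 * H - 13 * κ) :
    ∃ C ε₀ : ℝ, 0 < C ∧ 0 < ε₀ ∧
      ∀ (ε : ℝ) (w z u a : ℝ → X) (u₀ : X) (τ : EReal), 0 < ε → ε ≤ ε₀ →
        IsGoodPath L S α A F R H κ β T₀ ε w z u a u₀ τ → 0 < τ →
        (τ = ⊤ ∨ Tendsto (fun t : ℝ => ‖u t‖) (𝓝[<] τ.toReal) atTop) →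
        ((T₀ / ε ^ 2 : ℝ) : EReal) < τ ∧ ∀ t ∈ Set.Icc (0 : ℝ) (T₀ / ε ^ 2),
          ‖u t - (ε • a (ε ^ 2 * t) + ε ^ (2 * H + 1) •
            (S t (ε ^ (-2 * H - 1) • projS L u₀) + projS L (z t)))‖ ≤ C * ε ^ (1 + f) := by
  obtain ⟨C, ε₀, hC, hε₀, -, h⟩ := exists_error_bound_of_isGoodPath (A := A) hL hα0 hα1 hF hR hH1
    hκ0 hκ hT₀ hβ1 hβ2 hf1 hf2
  refine ⟨2 * C, ε₀, by linarith, hε₀, fun ε w z u a u₀ τ hε hεε hp hτ hmax => ?_⟩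
  have hε2 : 0 < ε ^ 2 := by positivity
  have hslow : ∀ t ∈ Set.Icc (0 : ℝ) (T₀ / ε ^ 2), ε ^ 2 * t ∈ Set.Icc 0 T₀ ∧
      ε ^ 2 * t / ε ^ 2 = t := fun t ht =>
    ⟨⟨mul_nonneg hε2.le ht.1, by have := (le_div_iff₀ hε2).1 ht.2; linarith⟩,
      mul_div_cancel_left₀ _ hε2.ne'⟩
  have hlt : ((T₀ / ε ^ 2 : ℝ) : EReal) < τ :=
    lt_of_bounded_of_maximal (M := ε * (C * ε ^ (-κ))) hτ hmax fun t ht htτ => by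
      obtain ⟨h1, h2⟩ := hslow t ht
      obtain ⟨-, -, h3⟩ := h ε w z u a u₀ τ hε hεε hp (ε ^ 2 * t) h1 (by rwa [h2])
      rw [h2] at h3
      rw [← smul_inv_smul₀ hε.ne' (u t), norm_smul, Real.norm_of_nonneg hε.le]
      gcongr
  refine ⟨hlt, fun t ht => ?_⟩
  obtain ⟨h1, h2⟩ := hslow t ht
  obtain ⟨h3, h4, -⟩ := h ε w z u a u₀ τ hε hεε hp (ε ^ 2 * t) h1 (by
    rw [h2]
    exact lt_of_le_of_lt (EReal.coe_le_coe_iff.2 ht.2) hlt)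
  set ρ := slowOU L S H ε z (ε ^ (-2 * H - 1) • projS L u₀) with hρ
  have hsum := add_errors (L := L) ε u a ρ (ε ^ 2 * t)
  rw [h2] at hsum
  have e1 : ε ^ (2 * H + 1) = ε * ε ^ (2 * H) := by
    rw [Real.rpow_add hε, Real.rpow_one, mul_comm]
  have e2 : u t - (ε • a (ε ^ 2 * t) + ε ^ (2 * H + 1) •
      (S t (ε ^ (-2 * H - 1) • projS L u₀) + projS L (z t)))
      = ε • (kernelError L ε u a (ε ^ 2 * t) + stableError L ε u ρ (ε ^ 2 * t)) := by
    have e3 : ρ (ε ^ 2 * t)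
        = ε ^ (2 * H) • (S t (ε ^ (-2 * H - 1) • projS L u₀) + projS L (z t)) := by
      rw [hρ, slowOU, h2]
    rw [e1, mul_smul, ← e3]
    conv_lhs => rw [← smul_inv_smul₀ hε.ne' (u t), ← hsum]
    rw [← smul_add, ← smul_sub]
    congr 1
    abel
  rw [e2, norm_smul, Real.norm_of_nonneg hε.le]
  calc _ ≤ ε * (C * ε ^ f + C * ε ^ f) := by
        gcongr
        exact (norm_add_le _ _).trans (add_le_add h3 h4)
    _ = 2 * C * (ε * ε ^ f) := by ring
    _ = _ := by rw [Real.rpow_add hε, Real.rpow_one]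

end BlowUp

end AmplitudeSPDE

end

theorem mainTheorem1 (H : ℝ) (hH0 : 0 < H) (hH1 : H < 1) :
    ∃ κ₀ : ℝ, 0 < κ₀ ∧
    ∀ (X : Type u) [NormedAddCommGroup X] [InnerProductSpace ℝ X] [CompleteSpace X]
      [TopologicalSpace.SeparableSpace X] [MeasurableSpace X] [BorelSpace X]
      (L : X →ₗ.[ℝ] X) [FiniteDimensional ℝ (AmplitudeSPDE.kerOf L)]
      (S : ℝ → X →L[ℝ] X) (_hL : AmplitudeSPDE.OperatorAssumption L S)
      (α : ℝ) (_hα0 : 0 ≤ α) (_hα1 : α < 1)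
      (A : X →L[ℝ] AmplitudeSPDE.NegSpace S α)
      (F : X [×3]→L[ℝ] AmplitudeSPDE.NegSpace S α)
      (_hF : AmplitudeSPDE.CubicAssumption L S α F)
      (Ω : Type v) [MeasurableSpace Ω] (P : Measure Ω) [IsProbabilityMeasure P]
      (W : ℝ → Ω → X) (_hW : AmplitudeSPDE.IsTraceClassFBM P H W)
      (Z : ℝ → Ω → X) (_hZ : AmplitudeSPDE.IsStochasticConvolution P S W Z)
      (κ : ℝ) (_hκ0 : 0 < κ) (_hκ : κ < κ₀)
      (T₀ : ℝ) (_hT₀ : 0 < T₀)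
      (β : ℝ) (_hβ1 : 1 / 2 < H → 1 / 2 < β ∧ β < H) (_hβ2 : H ≤ 1 / 2 → β = H - κ),
    ∃ C ε₀ : ℝ, 0 < C ∧ 0 < ε₀ ∧
    ∀ (ε : ℝ) (_hε0 : 0 < ε) (_hε : ε ≤ ε₀)
      (u₀ : Ω → X)
      (tstar : Ω → EReal) (u : ℝ → Ω → X)
      (_hu : AmplitudeSPDE.IsMaximalMildSolution P S α A F H ε Z u₀ tstar u)
      (a : ℝ → Ω → X)
      (_ha : AmplitudeSPDE.IsAmplitudeSolution P L S α A F H ε T₀ W u₀ a),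
    ∀ᵐ ω ∂P, ω ∈ AmplitudeSPDE.largeSet L H κ β T₀ ε W Z u₀ →
      ((T₀ / ε ^ 2 : ℝ) : EReal) < tstar ω ∧
      (1 / 2 < H → ∀ t ∈ Set.Icc (0 : ℝ) (T₀ / ε ^ 2),
        ‖u t ω - AmplitudeSPDE.approximation L S H ε Z u₀ a t ω‖ ≤ C * ε ^ (3 - 18 * κ)) ∧
      (H ≤ 1 / 2 → ∀ t ∈ Set.Icc (0 : ℝ) (T₀ / ε ^ 2),
        ‖u t ω - AmplitudeSPDE.approximation L S H ε Z u₀ a t ω‖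
          ≤ C * ε ^ (2 * H + 1 + 2 * H ^ 2 / (1 - H) - 23 * κ)) := by
  -- for `κ < H / 50` all powers of `ε` that arise as errors have exponent at least `H`
  refine ⟨H / 50, by positivity, ?_⟩
  intro X _ _ _ _ _ _ L _ S hL α hα0 hα1 A F hF Ω _ P _ W hW Z hZ κ hκ0 hκ T₀ hT₀ β hβ1 hβ2
  obtain ⟨R, hR⟩ := hL.exists_stableInverse
  have hpaths := hZ.ae_paths hL hR hH0 hW
  set f : ℝ := if 1 / 2 < H then 2 - 18 * κ else 2 * H + 2 * H ^ 2 / (1 - H) - 23 * κ with hf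
  have hf1 : 1 / 2 < H → f = 2 - 18 * κ := fun h => by rw [hf, if_pos h]
  have hf2 : H ≤ 1 / 2 → f = 2 * H + 2 * H ^ 2 / (1 - H) - 23 * κ := fun h => by
    rw [hf, if_neg (not_lt.2 h)]
  have hfe1 : 1 / 2 < H → f ≤ 2 - 7 * κ := fun h => by rw [hf1 h]; linarith
  have hfe2 : H ≤ 1 / 2 → f ≤ 4 * H - 13 * κ := fun h => by
    -- the interpolated bound gives the exponent `4 H`, which dominates as `H ≤ 1 - H`
    have h1 : 2 * H ^ 2 / (1 - H) ≤ 2 * H := by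
      rw [div_le_iff₀ (by linarith)]
      nlinarith
    rw [hf2 h]
    linarith
  obtain ⟨C, ε₀, hC, hε₀, h⟩ := AmplitudeSPDE.exists_approximation_of_isGoodPath (A := A) hL hα0 hα1
    hF hR hH1 hκ0 (by linarith) hT₀ hβ1 hβ2 hfe1 hfe2
  refine ⟨C, ε₀, hC, hε₀, fun ε hε hεε u₀ tstar u hu a ha => ?_⟩
  filter_upwards [hpaths, hu.pos, hu.continuous, hu.initial, hu.mild, hu.maximal, ha.continuous,
    ha.mem_ker, ha.equation] with ω h1 hpos h2 h3 h4 hmax h5 h6 h7 hω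
  obtain ⟨-, hZ0, -, hZc, hZC, hZS⟩ := h1
  obtain ⟨h8, h9, h10, h11⟩ := hω
  obtain ⟨h12, h13⟩ := h ε (fun t => W t ω) (fun t => Z t ω) (fun t => u t ω) (fun t => a t ω) (u₀ ω)
    (tstar ω) hε hεε ⟨hZ0, hZc, hZC, hZS, h2, h3, h4, h5, h6, h7, h8, h9, h10, h11⟩ hpos hmax
  refine ⟨h12, fun hH t ht => ?_, fun hH t ht => ?_⟩
  · have e : 3 - 18 * κ = 1 + f := by rw [hf1 hH]; ring
    rw [e]
    exact h13 t ht
  · have e : 2 * H + 1 + 2 * H ^ 2 / (1 - H) - 23 * κ = 1 + f := by rw [hf2 hH]; ring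
    rw [e]
    exact h13 t ht
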